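/- **Setting.** Let $\mathbf k$ be a field of characteristic $0$ and $N\ge 1$. A *perfect cylindrical network* $\Gamma$ with $N$ sources and $N$ sinks is a finite directed graph embedded in an oriented cylinder, without oriented cycles, such that: there are $N$ sources on one boundary circle and $N$ sinks on the other, all univalent; all other vertices are interior, trivalent, and neither sources nor sinks. So an interior vertex is either *white* (one incoming edge) or *black* (one outgoing edge). Fix a *cut*: an oriented curve from the source circle to the sink circle that avoids the vertices and is transversal to the edges. Cutting along it turns the cylinder into a rectangle with the sources on the left and the sinks on the right side, both numbered $1,\dots,N$ from top to bottom. Glue the two boundary circles, matching sink $i$ with source $i$ for every $i$. Let $\mathcal C$ be the $\mathbf k$-linear category whose objects are the $N$ glued points and whose morphisms are the $\mathbf k$-linear combinations of directed paths of the resulting network on the torus which start and end at glued points; $fg$ denotes concatenation, first $f$ and then $g$. *Boundary measurements.* $B_\Gamma(\lambda)$ is the $N\times N$ matrix with entries $$B_\Gamma(\lambda)_{ij}=\sum_{p\colon i\to j}\lambda^{d(p)}\,p ,$$ where the sum is over the directed paths $p$ of $\Gamma$ on the cylinder from source $i$ to sink $j$, and $d(p)\in\mathbb Z$ is the oriented intersection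 index of $p$ with the cut. *Double bracket.* $\{\!\{-,-\}\!\}$ is the family of bilinear maps $\mathrm{Hom}(A,B)\times\mathrm{Hom}(C,D)\to\mathrm{Hom}(C,B)\otimes\mathrm{Hom}(A,D)$ on paths that satisfies the double Leibniz identities $$\{\!\{fg,h\}\!\}=(1\otimes f)\{\!\{g,h\}\!\}+\{\!\{f,h\}\!\}(g\otimes 1),\qquad \{\!\{f,gh\}\!\}=(g\otimes 1)\{\!\{f,h\}\!\}+\{\!\{f,g\}\!\}(1\otimes h)$$ and whose value on a pair of edges is the sum of the following contributions of the interior vertices. At a white vertex whose edges are, in counterclockwise order, $x_1,x_2$ (outgoing) and $x_3$ (incoming): $\{\!\{x_1,x_2\}\!\}=\tfrac12 x_1\otimes x_2$ and $\{\!\{x_2,x_1\}\!\}=-\tfrac12x_2\otimes x_1$. At a black vertex whose edges are, in counterclockwise order, $y_1,y_2$ (incoming) and $y_3$ (outgoing): $\{\!\{y_1,y_2\}\!\}=-\tfrac12 y_2\otimes y_1$ and $\{\!\{y_2,y_1\}\!\}=\tfrac12 y_1\otimes y_2$. All other contributions are $0$. It restricts to a double bracket on $\mathcal C$. *Cyclic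 space.* $\mathcal C_\natural=\big(\bigoplus_{X}\mathrm{Hom}_{\mathcal C}(X,X)\big)/[\mathcal C,\mathcal C]$, where $[\mathcal C,\mathcal C]$ is the span of all $fg-gf$ with $f\colon X\to Y$, $g\colon Y\to X$; $\overline f$ is the class of $f$. The double bracket induces a bilinear map $\langle-,-\rangle\colon\mathcal C_\natural\times\mathcal C_\natural\to\mathcal C_\natural$, $\langle\overline f,\overline g\rangle=\overline{\mu(\{\!\{f,g\}\!\})}$, where $\mu(x\otimes y)=xy$. **Theorem.** Define $H_{ij}\in\bigoplus_X\mathrm{Hom}_{\mathcal C}(X,X)$, for integers $i\ge 0$ and $j\in\mathbb Z$, by $$\mathrm{tr}\big(B_\Gamma(\lambda)^i\big)=\sum_j H_{ij}\,\lambda^j .$$ Then $\langle\,\overline{H_{ij}},\,\overline{H_{k\ell}}\,\rangle=0$ for all $i,j,k,\ell$. -/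

import Mathlib

open scoped TensorProduct

noncomputable section

/-! ### The linear category of paths in a quiver -/

/-- The space of `𝕜`-linear combinations of directed paths from `a` to `b`: the morphism space
`Hom(a, b)` of the `𝕜`-linear category of paths. -/
abbrev LinPath (𝕜 : Type*) [CommRing 𝕜] {V : Type*} [Quiver V] (a b : V) : Type _ :=
  Quiver.Path a b →₀ 𝕜

/-- The bilinear extension of a map defined on pairs of basis elements. -/
def bilinearExt (𝕜 : Type*) [CommRing 𝕜] {α β M : Type*} [AddCommMonoid M] [Module 𝕜 M]
    (φ : α → β → M) : (α →₀ 𝕜) →ₗ[𝕜] (β →₀ 𝕜) →ₗ[𝕜] M :=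
  Finsupp.linearCombination 𝕜 fun p => Finsupp.linearCombination 𝕜 (φ p)

theorem bilinearExt_single (𝕜 : Type*) [CommRing 𝕜] {α β M : Type*} [AddCommMonoid M]
    [Module 𝕜 M] (φ : α → β → M) (p : α) (q : β) :
    bilinearExt 𝕜 φ (Finsupp.single p 1) (Finsupp.single q 1) = φ p q := by
  simp [bilinearExt]

/-- Concatenation of paths, `x ⊗ y ↦ xy` (first `x`, then `y`), extended bilinearly. -/
def concat (𝕜 : Type*) [CommRing 𝕜] {V : Type*} [Quiver V] {a b c : V} :
    LinPath 𝕜 a b →ₗ[𝕜] LinPath 𝕜 b c →ₗ[𝕜] LinPath 𝕜 a c :=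
  bilinearExt 𝕜 fun p q => Finsupp.single (p.comp q) 1

section Bracket

variable {𝕜 : Type*} [CommRing 𝕜] {V : Type*} [Quiver V]

theorem concat_single {a b c : V} (p : Quiver.Path a b) (q : Quiver.Path b c) :
    concat 𝕜 (Finsupp.single p 1) (Finsupp.single q 1) = Finsupp.single (p.comp q) 1 :=
  bilinearExt_single ..

theorem concat_assoc {a b c d : V} (x : LinPath 𝕜 a b) (y : LinPath 𝕜 b c)
    (z : LinPath 𝕜 c d) : concat 𝕜 (concat 𝕜 x y) z = concat 𝕜 x (concat 𝕜 y z) := by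
  induction x using Finsupp.induction_linear with
  | zero => simp
  | add x x' h h' => simp [h, h']
  | single p r =>
  induction y using Finsupp.induction_linear with
  | zero => simp
  | add x x' h h' => simp [h, h']
  | single q s =>
  induction z using Finsupp.induction_linear with
  | zero => simp
  | add x x' h h' => simp [h, h']
  | single u t =>
  rw [← mul_one r, ← mul_one s, ← mul_one t, ← smul_eq_mul, ← smul_eq_mul, ← smul_eq_mul,
    ← Finsupp.smul_single, ← Finsupp.smul_single, ← Finsupp.smul_single]
  simp only [map_smul, LinearMap.smul_apply, concat_single, Quiver.Path.comp_assoc]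

/-- `(f ⊗ 1) t`. -/
def lmul₁ {a b c d e : V} (f : LinPath 𝕜 a b) :
    LinPath 𝕜 b c ⊗[𝕜] LinPath 𝕜 d e →ₗ[𝕜] LinPath 𝕜 a c ⊗[𝕜] LinPath 𝕜 d e :=
  LinearMap.rTensor _ (concat 𝕜 f)

/-- `(1 ⊗ f) t`. -/
def lmul₂ {a b c d e : V} (f : LinPath 𝕜 a b) :
    LinPath 𝕜 d e ⊗[𝕜] LinPath 𝕜 b c →ₗ[𝕜] LinPath 𝕜 d e ⊗[𝕜] LinPath 𝕜 a c :=
  LinearMap.lTensor _ (concat 𝕜 f)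

/-- `t (g ⊗ 1)`. -/
def rmul₁ {a b c d e : V} (g : LinPath 𝕜 b c) :
    LinPath 𝕜 a b ⊗[𝕜] LinPath 𝕜 d e →ₗ[𝕜] LinPath 𝕜 a c ⊗[𝕜] LinPath 𝕜 d e :=
  LinearMap.rTensor _ ((concat 𝕜).flip g)

/-- `t (1 ⊗ g)`. -/
def rmul₂ {a b c d e : V} (g : LinPath 𝕜 b c) :
    LinPath 𝕜 d e ⊗[𝕜] LinPath 𝕜 a b →ₗ[𝕜] LinPath 𝕜 d e ⊗[𝕜] LinPath 𝕜 a c :=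
  LinearMap.lTensor _ ((concat 𝕜).flip g)

/-- The concatenation map `μ : Hom(a, b) ⊗ Hom(b, c) → Hom(a, c)`. -/
def concatTensor {a b c : V} :
    LinPath 𝕜 a b ⊗[𝕜] LinPath 𝕜 b c →ₗ[𝕜] LinPath 𝕜 a c :=
  TensorProduct.lift (concat 𝕜)

variable (𝕜 V) in
/-- A biderivation on the linear path category: bilinear maps
`Hom(a, b) × Hom(c, d) → Hom(c, b) ⊗ Hom(a, d)` satisfying both double Leibniz identities. -/
structure Biderivation where
  /-- The double bracket `⦃f, g⦄`. -/
  br : ∀ {a b c d : V}, LinPath 𝕜 a b →ₗ[𝕜] LinPath 𝕜 c d →ₗ[𝕜]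
    LinPath 𝕜 c b ⊗[𝕜] LinPath 𝕜 a d
  leibniz_left : ∀ {a b b' c d : V} (f : LinPath 𝕜 a b) (g : LinPath 𝕜 b b')
    (h : LinPath 𝕜 c d),
    br (concat 𝕜 f g) h = lmul₂ f (br g h) + rmul₁ g (br f h)
  leibniz_right : ∀ {a b c d d' : V} (f : LinPath 𝕜 a b) (g : LinPath 𝕜 c d)
    (h : LinPath 𝕜 d d'),
    br f (concat 𝕜 g h) = lmul₁ g (br f h) + rmul₂ h (br f g)

/-! ### The biderivation determined by its values on arrows -/

/-- A prescription `⦃e, f⦄` of the values of a biderivation on pairs of arrows. -/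
abbrev ArrowBracket (𝕜 : Type*) [CommRing 𝕜] (V : Type*) [Quiver V] : Type _ :=
  ∀ {a b c d : V}, (a ⟶ b) → (c ⟶ d) → LinPath 𝕜 c b ⊗[𝕜] LinPath 𝕜 a d

/-- The linear path consisting of a single path. -/
abbrev pathElt (𝕜 : Type*) [CommRing 𝕜] {V : Type*} [Quiver V] {a b : V}
    (p : Quiver.Path a b) : LinPath 𝕜 a b :=
  Finsupp.single p 1

/-- `⦃p, f⦄` for a path `p` and an arrow `f`, by the Leibniz identity in the first argument. -/
def pathArrowBracket (ε : ArrowBracket 𝕜 V) {a c d : V} (f : c ⟶ d) :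
    ∀ {b : V}, Quiver.Path a b → LinPath 𝕜 c b ⊗[𝕜] LinPath 𝕜 a d
  | _, .nil => 0
  | _, .cons p e => lmul₂ (pathElt 𝕜 p) (ε e f) +
      rmul₁ (pathElt 𝕜 e.toPath) (pathArrowBracket ε f p)

/-- `⦃p, q⦄` for paths `p` and `q`, by the Leibniz identity in the second argument. -/
def pathBracket (ε : ArrowBracket 𝕜 V) {a b c : V} (p : Quiver.Path a b) :
    ∀ {d : V}, Quiver.Path c d → LinPath 𝕜 c b ⊗[𝕜] LinPath 𝕜 a d
  | _, .nil => 0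
  | _, .cons q f => lmul₁ (pathElt 𝕜 q) (pathArrowBracket ε f p) +
      rmul₂ (pathElt 𝕜 f.toPath) (pathBracket ε p q)

theorem tensor_ext_single {α β M : Type*} [AddCommMonoid M] [Module 𝕜 M]
    {F G : (α →₀ 𝕜) ⊗[𝕜] (β →₀ 𝕜) →ₗ[𝕜] M}
    (h : ∀ p q, F (Finsupp.single p 1 ⊗ₜ Finsupp.single q 1) =
      G (Finsupp.single p 1 ⊗ₜ Finsupp.single q 1)) : F = G := by
  apply TensorProduct.ext
  ext p q
  exact h p q

theorem lmul₁_comp {a b b' c d e : V} (f : LinPath 𝕜 a b) (g : LinPath 𝕜 b b')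
    (t : LinPath 𝕜 b' c ⊗[𝕜] LinPath 𝕜 d e) :
    lmul₁ (concat 𝕜 f g) t = lmul₁ f (lmul₁ g t) := by
  induction t with
  | zero => simp
  | add x y hx hy => simp [hx, hy]
  | tmul x y => simp [lmul₁, concat_assoc]

theorem lmul₂_comp {a b b' c d e : V} (f : LinPath 𝕜 a b) (g : LinPath 𝕜 b b')
    (t : LinPath 𝕜 d e ⊗[𝕜] LinPath 𝕜 b' c) :
    lmul₂ (concat 𝕜 f g) t = lmul₂ f (lmul₂ g t) := by
  induction t with
  | zero => simp
  | add x y hx hy => simp [hx, hy]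
  | tmul x y => simp [lmul₂, concat_assoc]

theorem rmul₁_comp {a b c c' d e : V} (f : LinPath 𝕜 b c) (g : LinPath 𝕜 c c')
    (t : LinPath 𝕜 a b ⊗[𝕜] LinPath 𝕜 d e) :
    rmul₁ (concat 𝕜 f g) t = rmul₁ g (rmul₁ f t) := by
  induction t with
  | zero => simp
  | add x y hx hy => simp [hx, hy]
  | tmul x y => simp [rmul₁, concat_assoc]

theorem rmul₂_comp {a b c c' d e : V} (f : LinPath 𝕜 b c) (g : LinPath 𝕜 c c')
    (t : LinPath 𝕜 d e ⊗[𝕜] LinPath 𝕜 a b) :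
    rmul₂ (concat 𝕜 f g) t = rmul₂ g (rmul₂ f t) := by
  induction t with
  | zero => simp
  | add x y hx hy => simp [hx, hy]
  | tmul x y => simp [rmul₂, concat_assoc]

theorem lmul₂_rmul₁ {a b c d e d' : V} (f : LinPath 𝕜 a b) (g : LinPath 𝕜 d e)
    (t : LinPath 𝕜 d' d ⊗[𝕜] LinPath 𝕜 b c) :
    lmul₂ f (rmul₁ g t) = rmul₁ g (lmul₂ f t) := by
  induction t with
  | zero => simp
  | add x y hx hy => simp [hx, hy]
  | tmul x y => simp [lmul₂, rmul₁]

theorem lmul₁_rmul₂ {a b c d e d' : V} (f : LinPath 𝕜 a b) (g : LinPath 𝕜 d e)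
    (t : LinPath 𝕜 b c ⊗[𝕜] LinPath 𝕜 d' d) :
    lmul₁ f (rmul₂ g t) = rmul₂ g (lmul₁ f t) := by
  induction t with
  | zero => simp
  | add x y hx hy => simp [hx, hy]
  | tmul x y => simp [lmul₁, rmul₂]

theorem lmul₁_lmul₂ {a b c d e d' : V} (f : LinPath 𝕜 a b) (g : LinPath 𝕜 d e)
    (t : LinPath 𝕜 b c ⊗[𝕜] LinPath 𝕜 e d') :
    lmul₁ f (lmul₂ g t) = lmul₂ g (lmul₁ f t) := by
  induction t with
  | zero => simp
  | add x y hx hy => simp [hx, hy]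
  | tmul x y => simp [lmul₁, lmul₂]

theorem lmul₁_rmul₁ {a b c d e d' : V} (f : LinPath 𝕜 a b) (g : LinPath 𝕜 c d)
    (t : LinPath 𝕜 b c ⊗[𝕜] LinPath 𝕜 e d') :
    lmul₁ f (rmul₁ g t) = rmul₁ g (lmul₁ f t) := by
  induction t with
  | zero => simp
  | add x y hx hy => simp [hx, hy]
  | tmul x y => simp [lmul₁, rmul₁, concat_assoc]

theorem lmul₂_rmul₂ {a b c d e d' : V} (f : LinPath 𝕜 a b) (g : LinPath 𝕜 c d)
    (t : LinPath 𝕜 e d' ⊗[𝕜] LinPath 𝕜 b c) :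
    lmul₂ f (rmul₂ g t) = rmul₂ g (lmul₂ f t) := by
  induction t with
  | zero => simp
  | add x y hx hy => simp [hx, hy]
  | tmul x y => simp [lmul₂, rmul₂, concat_assoc]

theorem rmul₁_rmul₂ {a b c d e d' : V} (f : LinPath 𝕜 a b) (g : LinPath 𝕜 c d)
    (t : LinPath 𝕜 e a ⊗[𝕜] LinPath 𝕜 d' c) :
    rmul₁ f (rmul₂ g t) = rmul₂ g (rmul₁ f t) := by
  induction t with
  | zero => simp
  | add x y hx hy => simp [hx, hy]
  | tmul x y => simp [rmul₁, rmul₂]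

theorem lmul₁_nil {a c d e : V} (t : LinPath 𝕜 a c ⊗[𝕜] LinPath 𝕜 d e) :
    lmul₁ (pathElt 𝕜 (.nil : Quiver.Path a a)) t = t := by
  have : (lmul₁ (pathElt 𝕜 (.nil : Quiver.Path a a)) :
      LinPath 𝕜 a c ⊗[𝕜] LinPath 𝕜 d e →ₗ[𝕜] _) = LinearMap.id :=
    tensor_ext_single fun p q => by
      simp [lmul₁, pathElt, concat_single]
  rw [this]; rfl

theorem lmul₂_nil {a c d e : V} (t : LinPath 𝕜 d e ⊗[𝕜] LinPath 𝕜 a c) :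
    lmul₂ (pathElt 𝕜 (.nil : Quiver.Path a a)) t = t := by
  have : (lmul₂ (pathElt 𝕜 (.nil : Quiver.Path a a)) :
      LinPath 𝕜 d e ⊗[𝕜] LinPath 𝕜 a c →ₗ[𝕜] _) = LinearMap.id :=
    tensor_ext_single fun p q => by
      simp [lmul₂, pathElt, concat_single]
  rw [this]; rfl

theorem rmul₁_nil {a c d e : V} (t : LinPath 𝕜 c a ⊗[𝕜] LinPath 𝕜 d e) :
    rmul₁ (pathElt 𝕜 (.nil : Quiver.Path a a)) t = t := by
  have : (rmul₁ (pathElt 𝕜 (.nil : Quiver.Path a a)) :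
      LinPath 𝕜 c a ⊗[𝕜] LinPath 𝕜 d e →ₗ[𝕜] _) = LinearMap.id :=
    tensor_ext_single fun p q => by
      simp [rmul₁, pathElt, concat_single]
  rw [this]; rfl

theorem rmul₂_nil {a c d e : V} (t : LinPath 𝕜 d e ⊗[𝕜] LinPath 𝕜 c a) :
    rmul₂ (pathElt 𝕜 (.nil : Quiver.Path a a)) t = t := by
  have : (rmul₂ (pathElt 𝕜 (.nil : Quiver.Path a a)) :
      LinPath 𝕜 d e ⊗[𝕜] LinPath 𝕜 c a →ₗ[𝕜] _) = LinearMap.id :=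
    tensor_ext_single fun p q => by
      simp [rmul₂, pathElt, concat_single]
  rw [this]; rfl

theorem pathElt_comp {a b c : V} (p : Quiver.Path a b) (q : Quiver.Path b c) :
    pathElt 𝕜 (p.comp q) = concat 𝕜 (pathElt 𝕜 p) (pathElt 𝕜 q) :=
  (concat_single p q).symm

theorem pathArrowBracket_comp (ε : ArrowBracket 𝕜 V) {a b b' c d : V} (f : c ⟶ d)
    (p : Quiver.Path a b) (q : Quiver.Path b b') :
    pathArrowBracket ε f (p.comp q) =
      lmul₂ (pathElt 𝕜 p) (pathArrowBracket ε f q) +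
        rmul₁ (pathElt 𝕜 q) (pathArrowBracket ε f p) := by
  induction q with
  | nil => simp [pathArrowBracket, rmul₁_nil]
  | cons q e ih =>
    have hq : pathElt 𝕜 (q.cons e) = concat 𝕜 (pathElt 𝕜 q) (pathElt 𝕜 e.toPath) :=
      pathElt_comp q e.toPath
    rw [Quiver.Path.comp_cons, pathArrowBracket, pathArrowBracket, ih, hq]
    simp only [map_add, pathElt_comp p q, lmul₂_comp, rmul₁_comp, lmul₂_rmul₁]
    abel

theorem pathBracket_comp_right (ε : ArrowBracket 𝕜 V) {a b c d d' : V} (p : Quiver.Path a b)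
    (q : Quiver.Path c d) (r : Quiver.Path d d') :
    pathBracket ε p (q.comp r) =
      lmul₁ (pathElt 𝕜 q) (pathBracket ε p r) + rmul₂ (pathElt 𝕜 r) (pathBracket ε p q) := by
  induction r with
  | nil => simp [pathBracket, rmul₂_nil]
  | cons r e ih =>
    have hr : pathElt 𝕜 (r.cons e) = concat 𝕜 (pathElt 𝕜 r) (pathElt 𝕜 e.toPath) :=
      pathElt_comp r e.toPath
    rw [Quiver.Path.comp_cons, pathBracket, pathBracket, ih, hr]
    simp only [map_add, pathElt_comp q r, lmul₁_comp, rmul₂_comp, lmul₁_rmul₂]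
    abel

theorem pathBracket_comp_left (ε : ArrowBracket 𝕜 V) {a b b' c d : V} (p : Quiver.Path a b)
    (q : Quiver.Path b b') (r : Quiver.Path c d) :
    pathBracket ε (p.comp q) r =
      lmul₂ (pathElt 𝕜 p) (pathBracket ε q r) + rmul₁ (pathElt 𝕜 q) (pathBracket ε p r) := by
  induction r with
  | nil => simp [pathBracket]
  | cons r e ih =>
    rw [pathBracket, pathBracket, pathBracket, ih, pathArrowBracket_comp]
    simp only [map_add, lmul₁_lmul₂, lmul₁_rmul₁, lmul₂_rmul₂, rmul₁_rmul₂]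
    abel

/-- The unique biderivation with prescribed values on arrows. -/
def Biderivation.ofArrows (ε : ArrowBracket 𝕜 V) : Biderivation 𝕜 V where
  br := bilinearExt 𝕜 fun p q => pathBracket ε p q
  leibniz_left f g h := by
    induction f using Finsupp.induction_linear with
    | zero => simp [lmul₂]
    | add x x' h h' => simp [h, h', lmul₂, LinearMap.lTensor_add]; abel
    | single p r =>
    induction g using Finsupp.induction_linear with
    | zero => simp [rmul₁]
    | add x x' h h' => simp [h, h', rmul₁, LinearMap.rTensor_add]; abel
    | single q s =>
    induction h using Finsupp.induction_linear with
    | zero => simp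
    | add x x' h h' => simp [h, h']; abel
    | single u t =>
    rw [← mul_one r, ← mul_one s, ← mul_one t, ← smul_eq_mul, ← smul_eq_mul, ← smul_eq_mul,
      ← Finsupp.smul_single, ← Finsupp.smul_single, ← Finsupp.smul_single]
    simp only [map_smul, LinearMap.smul_apply, concat_single, bilinearExt_single,
      pathBracket_comp_left, lmul₂, rmul₁, LinearMap.lTensor_smul, LinearMap.rTensor_smul,
      smul_add]
    simp only [smul_smul, mul_comm, mul_left_comm]
  leibniz_right f g h := by
    induction f using Finsupp.induction_linear with
    | zero => simp
    | add x x' h h' => simp [h, h']; abel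
    | single p r =>
    induction g using Finsupp.induction_linear with
    | zero => simp [lmul₁]
    | add x x' h h' => simp [h, h', lmul₁, LinearMap.rTensor_add]; abel
    | single q s =>
    induction h using Finsupp.induction_linear with
    | zero => simp [rmul₂]
    | add x x' h h' => simp [h, h', rmul₂, LinearMap.lTensor_add]; abel
    | single u t =>
    rw [← mul_one r, ← mul_one s, ← mul_one t, ← smul_eq_mul, ← smul_eq_mul, ← smul_eq_mul,
      ← Finsupp.smul_single, ← Finsupp.smul_single, ← Finsupp.smul_single]
    simp only [map_smul, LinearMap.smul_apply, concat_single, bilinearExt_single,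
      pathBracket_comp_right, lmul₁, rmul₂, LinearMap.lTensor_smul, LinearMap.rTensor_smul,
      smul_add]
    simp only [smul_smul, mul_comm, mul_left_comm]

/-- On single arrows `Biderivation.ofArrows ε` takes the prescribed values. -/
theorem Biderivation.ofArrows_apply (ε : ArrowBracket 𝕜 V) {a b c d : V} (e : a ⟶ b)
    (f : c ⟶ d) : (Biderivation.ofArrows ε).br (pathElt 𝕜 e.toPath) (pathElt 𝕜 f.toPath) =
      ε e f := by
  change bilinearExt 𝕜 (fun p q => pathBracket ε p q) _ _ = _
  rw [bilinearExt_single]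
  simp [Quiver.Hom.toPath, pathBracket, pathArrowBracket, lmul₁_nil, lmul₂_nil]

/-! ### The cyclic space and the induced bracket -/

/-- `⨁ Hom(X, X)` over the objects `X` of the full subcategory on the objects `pt i`:
linear combinations of based loops. -/
abbrev Loops (𝕜 : Type*) [CommRing 𝕜] {V : Type*} [Quiver V] {ι : Type*} (pt : ι → V) :
    Type _ :=
  (Σ i : ι, Quiver.Path (pt i) (pt i)) →₀ 𝕜

variable {ι : Type*}

/-- The inclusion of `Hom(pt i, pt i)` as a direct summand of `Loops 𝕜 pt`. -/
def loop (pt : ι → V) (i : ι) : LinPath 𝕜 (pt i) (pt i) →ₗ[𝕜] Loops 𝕜 pt :=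
  Finsupp.lmapDomain 𝕜 𝕜 fun p => ⟨i, p⟩

variable (𝕜) in
/-- `[𝒞, 𝒞]`: the span of all `fg - gf`, where `f : X → Y` and `g : Y → X`. -/
def commutators (pt : ι → V) : Submodule 𝕜 (Loops 𝕜 pt) :=
  Submodule.span 𝕜 {x | ∃ (i j : ι) (f : LinPath 𝕜 (pt i) (pt j))
    (g : LinPath 𝕜 (pt j) (pt i)),
    x = loop pt i (concat 𝕜 f g) - loop pt j (concat 𝕜 g f)}

variable (𝕜) in
/-- The cyclic space `𝒞_♮` of the full subcategory on the objects `pt i`. -/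
abbrev CyclicSpace (pt : ι → V) : Type _ :=
  Loops 𝕜 pt ⧸ commutators 𝕜 pt

/-- The class in the cyclic space of a linear combination of loops. -/
abbrev cyclicClass (pt : ι → V) : Loops 𝕜 pt →ₗ[𝕜] CyclicSpace 𝕜 pt :=
  (commutators 𝕜 pt).mkQ

/-- The bracket `(f, g) ↦ class of μ ⦃f, g⦄`, before passing to the quotient. -/
def loopBracket (D : Biderivation 𝕜 V) (pt : ι → V) :
    Loops 𝕜 pt →ₗ[𝕜] Loops 𝕜 pt →ₗ[𝕜] CyclicSpace 𝕜 pt :=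
  bilinearExt 𝕜 fun p q => cyclicClass pt
    (loop pt q.1 (concatTensor (D.br (pathElt 𝕜 p.2) (pathElt 𝕜 q.2))))

theorem loopBracket_apply (D : Biderivation 𝕜 V) (pt : ι → V) (i j : ι)
    (f : LinPath 𝕜 (pt i) (pt i)) (g : LinPath 𝕜 (pt j) (pt j)) :
    loopBracket D pt (loop pt i f) (loop pt j g) =
      cyclicClass pt (loop pt j (concatTensor (D.br f g))) := by
  induction f using Finsupp.induction_linear with
  | zero => simp
  | add x x' h h' => simp only [map_add, LinearMap.add_apply, h, h']
  | single p r =>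
  induction g using Finsupp.induction_linear with
  | zero => simp
  | add x x' h h' => simp only [map_add, h, h']
  | single q s =>
  rw [← mul_one r, ← mul_one s, ← smul_eq_mul, ← smul_eq_mul, ← Finsupp.smul_single,
    ← Finsupp.smul_single]
  simp only [map_smul, LinearMap.smul_apply]
  congr 2
  simp only [loop, Finsupp.lmapDomain_apply, Finsupp.mapDomain_single]
  exact bilinearExt_single ..

theorem concatTensor_lmul₂ {a b c d : V} (f : LinPath 𝕜 b c)
    (t : LinPath 𝕜 a b ⊗[𝕜] LinPath 𝕜 c d) :
    concatTensor (lmul₂ f t) = concatTensor (rmul₁ f t) := by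
  induction t with
  | zero => simp
  | add x y hx hy => simp [hx, hy]
  | tmul x y => simp [lmul₂, rmul₁, concatTensor, concat_assoc]

theorem concatTensor_lmul₁ {a b c d : V} (f : LinPath 𝕜 a b)
    (t : LinPath 𝕜 b c ⊗[𝕜] LinPath 𝕜 c d) :
    concatTensor (lmul₁ f t) = concat 𝕜 f (concatTensor t) := by
  induction t with
  | zero => simp
  | add x y hx hy => simp [hx, hy]
  | tmul x y => simp [lmul₁, concatTensor, concat_assoc]

theorem concatTensor_rmul₂ {a b c d : V} (f : LinPath 𝕜 c d)
    (t : LinPath 𝕜 a b ⊗[𝕜] LinPath 𝕜 b c) :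
    concatTensor (rmul₂ f t) = concat 𝕜 (concatTensor t) f := by
  induction t with
  | zero => simp
  | add x y hx hy => simp [hx, hy]
  | tmul x y => simp [rmul₂, concatTensor, concat_assoc]

theorem cyclicClass_comm (pt : ι → V) {i j : ι} (f : LinPath 𝕜 (pt i) (pt j))
    (g : LinPath 𝕜 (pt j) (pt i)) :
    cyclicClass pt (loop pt i (concat 𝕜 f g)) = cyclicClass pt (loop pt j (concat 𝕜 g f)) :=
  (Submodule.Quotient.eq _).2 (Submodule.subset_span ⟨i, j, f, g, rfl⟩)

theorem loopBracket_comm_left (D : Biderivation 𝕜 V) (pt : ι → V) {i j k : ι}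
    (f : LinPath 𝕜 (pt i) (pt j)) (g : LinPath 𝕜 (pt j) (pt i)) (h : LinPath 𝕜 (pt k) (pt k)) :
    loopBracket D pt (loop pt i (concat 𝕜 f g)) (loop pt k h) =
      loopBracket D pt (loop pt j (concat 𝕜 g f)) (loop pt k h) := by
  rw [loopBracket_apply, loopBracket_apply, D.leibniz_left f g, D.leibniz_left g f,
    map_add concatTensor, map_add concatTensor, concatTensor_lmul₂ f, concatTensor_lmul₂ g,
    add_comm]

theorem loopBracket_comm_right (D : Biderivation 𝕜 V) (pt : ι → V) {i j k : ι}
    (f : LinPath 𝕜 (pt i) (pt j)) (g : LinPath 𝕜 (pt j) (pt i)) (h : LinPath 𝕜 (pt k) (pt k)) :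
    loopBracket D pt (loop pt k h) (loop pt i (concat 𝕜 f g)) =
      loopBracket D pt (loop pt k h) (loop pt j (concat 𝕜 g f)) := by
  rw [loopBracket_apply, loopBracket_apply, D.leibniz_right h f g, D.leibniz_right h g f,
    map_add concatTensor, map_add concatTensor, concatTensor_lmul₁, concatTensor_lmul₁,
    concatTensor_rmul₂, concatTensor_rmul₂, map_add (loop pt i), map_add (loop pt j),
    map_add (cyclicClass pt), map_add (cyclicClass pt), cyclicClass_comm pt f,
    cyclicClass_comm pt _ g, add_comm]

theorem lsingle_eq_loop (pt : ι → V) (k : ι) (u : Quiver.Path (pt k) (pt k)) :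
    (Finsupp.single ⟨k, u⟩ 1 : Loops 𝕜 pt) = loop pt k (pathElt 𝕜 u) := by
  simp [loop]

theorem loopBracket_left (D : Biderivation 𝕜 V) (pt : ι → V) :
    commutators 𝕜 pt ≤ LinearMap.ker (loopBracket D pt) := by
  refine Submodule.span_le.2 ?_
  rintro _ ⟨i, j, f, g, rfl⟩
  rw [SetLike.mem_coe, LinearMap.mem_ker, map_sub, sub_eq_zero]
  refine Finsupp.lhom_ext' fun u => LinearMap.ext_ring ?_
  rw [LinearMap.comp_apply, LinearMap.comp_apply, Finsupp.lsingle_apply, lsingle_eq_loop]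
  exact loopBracket_comm_left D pt f g _

theorem loopBracket_right (D : Biderivation 𝕜 V) (pt : ι → V) :
    commutators 𝕜 pt ≤ LinearMap.ker (loopBracket D pt).flip := by
  refine Submodule.span_le.2 ?_
  rintro _ ⟨i, j, f, g, rfl⟩
  rw [SetLike.mem_coe, LinearMap.mem_ker, map_sub, sub_eq_zero]
  refine Finsupp.lhom_ext' fun u => LinearMap.ext_ring ?_
  rw [LinearMap.comp_apply, LinearMap.comp_apply, Finsupp.lsingle_apply, lsingle_eq_loop,
    LinearMap.flip_apply, LinearMap.flip_apply]
  exact loopBracket_comm_right D pt f g _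

/-- The bracket `⟨-, -⟩ : 𝒞_♮ × 𝒞_♮ → 𝒞_♮` induced by a biderivation: on classes of loops it is
the class of `μ ⦃f, g⦄`. -/
def cyclicBracket (D : Biderivation 𝕜 V) (pt : ι → V) :
    CyclicSpace 𝕜 pt →ₗ[𝕜] CyclicSpace 𝕜 pt →ₗ[𝕜] CyclicSpace 𝕜 pt :=
  (commutators 𝕜 pt).liftQ
    (LinearMap.flip ((commutators 𝕜 pt).liftQ (loopBracket D pt).flip (loopBracket_right D pt)))
    (fun x hx => by
      have h0 : loopBracket D pt x = 0 := loopBracket_left D pt hx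
      refine LinearMap.mem_ker.2 (LinearMap.ext fun y => ?_)
      obtain ⟨y, rfl⟩ := Submodule.mkQ_surjective _ y
      change loopBracket D pt x y = 0
      rw [h0]; rfl)

theorem cyclicBracket_mk (D : Biderivation 𝕜 V) (pt : ι → V) (i j : ι)
    (f : LinPath 𝕜 (pt i) (pt i)) (g : LinPath 𝕜 (pt j) (pt j)) :
    cyclicBracket D pt (cyclicClass pt (loop pt i f))
        (cyclicClass pt (loop pt j g)) =
      cyclicClass pt (loop pt j (concatTensor (D.br f g))) :=
  loopBracket_apply D pt i j f g

end Bracket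

/-! ### Perfect cylindrical networks -/

/-- The vertices of a network with `m` sources, `n` sinks and set `V` of internal vertices. -/
inductive NetVertex (m n : ℕ) (V : Type) : Type
  | source (i : Fin m) : NetVertex m n V
  | sink (j : Fin n) : NetVertex m n V
  | inner (v : V) : NetVertex m n V

/-- A finite acyclic perfect network on a cylinder, with `m` sources on one boundary circle and
`n` sinks on the other.

The cylinder is drawn as a rectangle whose top and bottom sides are glued, with the sources
`0, …, m - 1` on the left side and the sinks `0, …, n - 1` on the right side, both numbered from
top to bottom. The embedding is recorded combinatorially. Each edge `e` has two half-edges: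
`Sum.inl e` at its tail and `Sum.inr e` at its head. Collapsing each boundary circle to a point
turns the cylinder into a sphere, and `rot` sends each half-edge to the next one in
counterclockwise order around its vertex on that oriented sphere. Every vertex of an acyclic
network is joined to both boundary circles, so the collapsed graph is connected and, by Euler's
formula, the rotation system comes from an embedding in the cylinder exactly when the number of
faces is `2 - #vertices + #edges`. -/
structure PerfectCylindricalNetwork (m n : ℕ) [NeZero m] [NeZero n] where
  /-- internal vertices -/
  V : Type
  /-- edges -/
  E : Type
  [fintypeV : Fintype V]
  [fintypeE : Fintype E]
  /-- the tail of an edge -/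
  src : E → NetVertex m n V
  /-- the head of an edge -/
  tgt : E → NetVertex m n V
  /-- the unique edge at a source -/
  sourceEdge : Fin m → E
  /-- the unique edge at a sink -/
  sinkEdge : Fin n → E
  src_eq_source : ∀ e i, src e = .source i ↔ e = sourceEdge i
  tgt_ne_source : ∀ e i, tgt e ≠ .source i
  tgt_eq_sink : ∀ e j, tgt e = .sink j ↔ e = sinkEdge j
  src_ne_sink : ∀ e j, src e ≠ .sink j
  /-- internal vertices are trivalent -/
  trivalent : ∀ v : V, Nat.card {h : E ⊕ E // Sum.elim src tgt h = .inner v} = 3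
  /-- internal vertices are not sources -/
  exists_in : ∀ v : V, ∃ e, tgt e = .inner v
  /-- internal vertices are not sinks -/
  exists_out : ∀ v : V, ∃ e, src e = .inner v
  /-- there are no oriented cycles -/
  acyclic : ∀ x : NetVertex m n V,
    ¬ Relation.TransGen (fun a b => ∃ e, src e = a ∧ tgt e = b) x x
  /-- the counterclockwise rotation of half-edges -/
  rot : Equiv.Perm (E ⊕ E)
  rot_inner : ∀ h v, Sum.elim src tgt h = .inner v → Sum.elim src tgt (rot h) = .inner v
  rot_cyclic : ∀ h h' v, Sum.elim src tgt h = .inner v → Sum.elim src tgt h' = .inner v →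
    rot.SameCycle h h'
  /-- On the left boundary circle the next source counterclockwise is the previous one. -/
  rot_source : ∀ i, rot (.inl (sourceEdge (i + 1))) = .inl (sourceEdge i)
  /-- On the right boundary circle the next sink counterclockwise is the following one. -/
  rot_sink : ∀ j, rot (.inr (sinkEdge j)) = .inr (sinkEdge (j + 1))
  /-- Euler's formula; the faces are the orbits of the face permutation, which sends a half-edge
  `h`, viewed as the edge directed away from `h`, to the next directed edge along the boundary of
  the face on its left. -/
  euler : Nat.card (Quotient (⟨Equiv.Perm.SameCycle ((Equiv.sumComm E E).trans rot.symm),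
    Equiv.Perm.SameCycle.equivalence _⟩ : Setoid (E ⊕ E))) + Fintype.card V = Fintype.card E

namespace PerfectCylindricalNetwork

attribute [instance] fintypeV fintypeE

section Cylinder

variable {m n : ℕ} [NeZero m] [NeZero n] (Γ : PerfectCylindricalNetwork m n)

/-- The opposite end of a half-edge. -/
def opp : Equiv.Perm (Γ.E ⊕ Γ.E) := Equiv.sumComm Γ.E Γ.E

/-- The face permutation: along the edge directed away from `h`, then sharp left. -/
def facePerm : Equiv.Perm (Γ.E ⊕ Γ.E) := Γ.opp.trans Γ.rot.symm

/-- `Γ.IsDualWalk h l h'`: a curve which starts in the face on the left of `h`, ends in the face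
on the left of `h'`, avoids the vertices, and crosses transversally, one after the other, the
directed edges in `l`, each of them from its left to its right. -/
def IsDualWalk : Γ.E ⊕ Γ.E → List (Γ.E ⊕ Γ.E) → Γ.E ⊕ Γ.E → Prop
  | h, [], h' => Γ.facePerm.SameCycle h h'
  | h, x :: l, h' => Γ.facePerm.SameCycle h x ∧ IsDualWalk (Γ.opp x) l h'

/-- A cut: a curve from the left to the right boundary circle which avoids the vertices and is
transversal to the edges, up to isotopy. Its left end lies between the last and the first source,
that is, just above source `0`, and its right end just above sink `0`. -/
structure Cut where
  /-- the directed edges crossed by the cut, each from its left to its right -/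
  crossings : List (Γ.E ⊕ Γ.E)
  isDualWalk : Γ.IsDualWalk (.inl (Γ.sourceEdge 0)) crossings (.inl (Γ.sinkEdge 0))

variable {Γ} in
open Classical in
/-- The oriented intersection number of an edge with the cut: an edge which goes from the right
to the left of the cut counts `+1`. -/
def Cut.index (κ : Γ.Cut) (e : Γ.E) : ℤ :=
  (κ.crossings.count (.inl e) : ℤ) - κ.crossings.count (.inr e)

/-- The vertices of `Γ`, as a quiver with the edges of `Γ` as arrows. -/
def Vertex : Type := NetVertex m n Γ.V

/-- The `i`-th source as a vertex. -/
def source (i : Fin m) : Γ.Vertex := NetVertex.source i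

/-- The `j`-th sink as a vertex. -/
def sink (j : Fin n) : Γ.Vertex := NetVertex.sink j

instance : Quiver Γ.Vertex := ⟨fun a b => {e : Γ.E // Γ.src e = a ∧ Γ.tgt e = b}⟩

theorem finite_path (a b : Γ.Vertex) : Finite (Quiver.Path a b) := by
  have hfin : Finite Γ.Vertex :=
    Finite.of_surjective (fun x : Fin m ⊕ Fin n ⊕ Γ.V =>
      (match x with
        | .inl i => NetVertex.source i
        | .inr (.inl j) => NetVertex.sink j
        | .inr (.inr v) => NetVertex.inner v : NetVertex m n Γ.V)) (by
      rintro (i | j | v)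
      exacts [⟨.inl i, rfl⟩, ⟨.inr (.inl j), rfl⟩, ⟨.inr (.inr v), rfl⟩])
  let R : Γ.Vertex → Γ.Vertex → Prop :=
    Relation.TransGen (fun a b => ∃ e, Γ.src e = a ∧ Γ.tgt e = b)
  have : Std.Irrefl R := ⟨Γ.acyclic⟩
  have : IsTrans Γ.Vertex R := ⟨fun _ _ _ => Relation.TransGen.trans⟩
  have wf : WellFounded R := Finite.wellFounded_of_trans_of_irrefl R
  induction b using wf.induction with
  | _ b ih =>
  have : ∀ c : Γ.Vertex, Finite (Quiver.Path a c × (c ⟶ b)) := by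
    intro c
    rcases isEmpty_or_nonempty (c ⟶ b) with h | ⟨⟨e, he⟩⟩
    · infer_instance
    · have := ih c (Relation.TransGen.single ⟨e, he⟩)
      have : Finite (c ⟶ b) := inferInstanceAs (Finite {e : Γ.E // Γ.src e = c ∧ Γ.tgt e = b})
      infer_instance
  let F : PLift (a = b) ⊕ (Σ c : Γ.Vertex, Quiver.Path a c × (c ⟶ b)) → Quiver.Path a b :=
    Sum.elim (fun h => Quiver.Path.nil.cast rfl h.down) (fun x => x.2.1.cons x.2.2)
  refine Finite.of_surjective F fun p => ?_
  cases p with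
  | nil => exact ⟨.inl ⟨rfl⟩, rfl⟩
  | cons p e => exact ⟨.inr ⟨_, p, e⟩, rfl⟩

instance (a b : Γ.Vertex) : Fintype (Quiver.Path a b) :=
  @Fintype.ofFinite _ (Γ.finite_path a b)

variable {Γ} in
/-- The oriented intersection index of a path with the cut. -/
def Cut.pathIndex (κ : Γ.Cut) {a : Γ.Vertex} : ∀ {b : Γ.Vertex}, Quiver.Path a b → ℤ
  | _, .nil => 0
  | _, .cons p e => κ.pathIndex p + κ.index e.1

end Cylinder

/-! ### The network on the torus and its double bracket -/

section Torus

variable {N : ℕ} [NeZero N] (Γ : PerfectCylindricalNetwork N N)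

/-- The vertices of the network on the torus obtained from `Γ` by gluing sink `i` to source `i`:
the `N` marked points, and the internal vertices. -/
def TorusVertex : Type := Fin N ⊕ Γ.V

/-- The image of a vertex of the cylinder on the torus. -/
def glue : Γ.Vertex → Γ.TorusVertex
  | .source i => .inl i
  | .sink j => .inl j
  | .inner v => .inr v

instance : Quiver Γ.TorusVertex :=
  ⟨fun a b => {e : Γ.E // Γ.glue (Γ.src e) = a ∧ Γ.glue (Γ.tgt e) = b}⟩

/-- The gluing map, on vertices and edges. -/
def gluing : Γ.Vertex ⥤q Γ.TorusVertex where
  obj := Γ.glue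
  map e := ⟨e.1, congrArg Γ.glue e.2.1, congrArg Γ.glue e.2.2⟩

/-- The marked points: the objects of the category `𝒞` of paths on the torus. -/
def marked (i : Fin N) : Γ.TorusVertex := .inl i

open Classical in
/-- The coefficient of `e ⊗ f` in `⦃e, f⦄` for edges `e`, `f` going out of the same internal
vertex. At a white vertex, with outgoing edges `x₁`, `x₂` and incoming edge `x₃` in
counterclockwise order, `⦃x₁, x₂⦄ = ½ x₁ ⊗ x₂` and `⦃x₂, x₁⦄ = -½ x₂ ⊗ x₁`. -/
def whiteCoeff (𝕜 : Type*) [Field 𝕜] (e f : Γ.E) : 𝕜 :=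
  if ∃ v, Γ.src e = .inner v ∧ Γ.src f = .inner v then
    if Γ.rot (.inl e) = .inl f then 1 / 2 else if Γ.rot (.inl f) = .inl e then -1 / 2 else 0
  else 0

open Classical in
/-- The coefficient of `f ⊗ e` in `⦃e, f⦄` for edges `e`, `f` going into the same internal
vertex. At a black vertex, with incoming edges `y₁`, `y₂` and outgoing edge `y₃` in
counterclockwise order, `⦃y₁, y₂⦄ = -½ y₂ ⊗ y₁` and `⦃y₂, y₁⦄ = ½ y₁ ⊗ y₂`. -/
def blackCoeff (𝕜 : Type*) [Field 𝕜] (e f : Γ.E) : 𝕜 :=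
  if ∃ v, Γ.tgt e = .inner v ∧ Γ.tgt f = .inner v then
    if Γ.rot (.inr e) = .inr f then -1 / 2 else if Γ.rot (.inr f) = .inr e then 1 / 2 else 0
  else 0

open Classical in
/-- The double brackets of the edges: the sum of the contributions of the white and the black
vertices that `e` and `f` have in common; all other local brackets are zero. -/
def edgeBracket (𝕜 : Type*) [Field 𝕜] : ArrowBracket 𝕜 Γ.TorusVertex :=
  fun {a b c d} e f =>
    (if h : a = c then Γ.whiteCoeff 𝕜 e.1 f.1 •
      (pathElt 𝕜 (e.toPath.cast h rfl) ⊗ₜ[𝕜] pathElt 𝕜 (f.toPath.cast h.symm rfl)) else 0) +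
    (if h : b = d then Γ.blackCoeff 𝕜 e.1 f.1 •
      (pathElt 𝕜 (f.toPath.cast rfl h.symm) ⊗ₜ[𝕜] pathElt 𝕜 (e.toPath.cast rfl h)) else 0)

/-- The double bracket on paths of the network. -/
def doubleBracket (𝕜 : Type*) [Field 𝕜] : Biderivation 𝕜 Γ.TorusVertex :=
  Biderivation.ofArrows (Γ.edgeBracket 𝕜)

/-! ### Boundary measurements and Hamiltonians -/

/-- `N × N` matrices with entry `(i, j)` in the Laurent polynomials in `λ` with coefficients in
`Hom(i, j)`; the coefficient of `λ ^ d` is the value at `d : ℤ`. -/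
abbrev LaurentMatrix (𝕜 : Type*) [Field 𝕜] : Type _ :=
  ∀ i j : Fin N, ℤ →₀ LinPath 𝕜 (Γ.marked i) (Γ.marked j)

namespace LaurentMatrix

variable {Γ} {𝕜 : Type*} [Field 𝕜]

/-- Matrix multiplication; the entries are multiplied by concatenation, `λ` is central. -/
def mul (X Y : Γ.LaurentMatrix 𝕜) : Γ.LaurentMatrix 𝕜 := fun i k =>
  ∑ j, (X i j).sum fun a x => (Y j k).sum fun b y => Finsupp.single (a + b) (concat 𝕜 x y)

/-- The identity matrix. -/
def one : Γ.LaurentMatrix 𝕜 := fun i j =>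
  if h : i = j then
    Finsupp.single 0 (pathElt 𝕜 (Quiver.Path.nil.cast rfl (congrArg Γ.marked h)))
  else 0

/-- Powers of a matrix. -/
def pow (X : Γ.LaurentMatrix 𝕜) : ℕ → Γ.LaurentMatrix 𝕜
  | 0 => one
  | k + 1 => mul (pow X k) X

/-- The coefficient of `λ ^ d` in the trace, a combination of loops. -/
def traceCoeff (X : Γ.LaurentMatrix 𝕜) (d : ℤ) : Loops 𝕜 Γ.marked :=
  ∑ i, loop Γ.marked i (X i i d)

end LaurentMatrix

/-- The boundary measurement matrix `B(λ)`: its entry `(i, j)` is the sum of `λ ^ d wt(p)` over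
the paths `p` on the cylinder from source `i` to sink `j`, where `d` is the intersection index of
`p` with the cut and `wt(p)` is `p`, viewed on the torus. -/
def boundaryMeasurement (𝕜 : Type*) [Field 𝕜] (κ : Γ.Cut) : Γ.LaurentMatrix 𝕜 := fun i j =>
  ∑ p : Quiver.Path (Γ.source i) (Γ.sink j),
    Finsupp.single (κ.pathIndex p) (pathElt 𝕜 (Γ.gluing.mapPath p))

/-- The Hamiltonian `H_{ij}`: the coefficient of `λ ^ j` in `tr (B(λ) ^ i)`. -/
def hamiltonian (𝕜 : Type*) [Field 𝕜] (κ : Γ.Cut) (i : ℕ) (j : ℤ) : Loops 𝕜 Γ.marked :=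
  ((Γ.boundaryMeasurement 𝕜 κ).pow i).traceCoeff j

end Torus

end PerfectCylindricalNetwork

end

/-!
Since `Γ` is embedded in the cylinder and acyclic, a lift of a path `p` from source to sink
separates the universal cover into two sides. The deck translates of the lift therefore equip every
other path with a level, and the coefficients in the double bracket at the vertices of `p` measure
the changes of the sign of the level. Along a path `q` from source to sink these changes telescope,
so the signed number of crossings of `p` with a translate of `q` only depends on the order of their
end points on the boundary circles. The level itself exists because the first cohomology of the
sphere obtained by collapsing the boundary circles vanishes. This is linear algebra on half-edges:
by Euler's formula the functions invariant under the rotation and those invariant under the face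
permutation span the kernel of the boundary map on corners.

The bracket of two Hamiltonians expands by the Leibniz rule into brackets of pairs of boundary
paths inside cyclic words. At a common vertex the double bracket exchanges the tails of the two
paths; after resumming over the exchanged pairs, each contribution is an intersection number, hence
a difference of two terms, one for the sources and one for the sinks. The term of either end depends
only on the loop cut open at two marked points, and since sinks are glued to sources the two
families of cyclic words coincide and cancel.
-/

/-! ### Rotation systems of genus zero -/

/-- The edge underlying a half-edge; `Sum.inl e` and `Sum.inr e` are the two halves of `e`. -/
def edgeOf {E : Type*} : E ⊕ E → E := Sum.elim id id

@[simp] theorem edgeOf_inl {E : Type*} (e : E) : edgeOf (.inl e : E ⊕ E) = e := rfl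

@[simp] theorem edgeOf_inr {E : Type*} (e : E) : edgeOf (.inr e : E ⊕ E) = e := rfl

theorem eq_of_sameCycle {D α : Type*} {σ : Equiv.Perm D} {x : D → α} (hx : ∀ h, x (σ h) = x h)
    {a b : D} (hab : σ.SameCycle a b) : x a = x b := by
  obtain ⟨k, rfl⟩ := hab
  induction k generalizing a with
  | zero => rfl
  | succ k ih => rw [zpow_add_one, Equiv.Perm.mul_apply, ← ih, hx]
  | pred k ih =>
    rw [zpow_sub_one, Equiv.Perm.mul_apply, ← ih, ← hx (σ⁻¹ a)]
    exact congrArg x (σ.apply_symm_apply a).symm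

/-- The space of functions which are invariant under a permutation. -/
def invariantFunctions (K : Type*) [Semiring K] {D : Type*} (σ : Equiv.Perm D) :
    Submodule K (D → K) where
  carrier := {x | ∀ h, x (σ h) = x h}
  add_mem' hx hy h := by simp [hx h, hy h]
  zero_mem' _ := rfl
  smul_mem' c x hx h := by simp [hx h]

theorem card_le_finrank_invariantFunctions (K : Type*) [Field K] {D X : Type*} [Finite D]
    [Fintype X] {σ : Equiv.Perm D} {π : D → X} (hπ : Function.Surjective π)
    (hσ : ∀ h, π (σ h) = π h) : Fintype.card X ≤ Module.finrank K (invariantFunctions K σ) := by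
  let pullback : (X → K) →ₗ[K] invariantFunctions K σ :=
    (LinearMap.funLeft K K π).codRestrict _ fun u h => congrArg u (hσ h)
  have hinj : Function.Injective pullback := fun u v huv =>
    LinearMap.funLeft_injective_of_surjective K K π hπ (congrArg Subtype.val huv)
  simpa using LinearMap.finrank_le_finrank_of_injective hinj

section RotationSystem

variable {K : Type*} [Field K] {E : Type*} {rot : Equiv.Perm (E ⊕ E)}

variable (K rot) in
/-- The boundary map of a rotation system: the corner between the half-edges `h` and `rot h` is
sent to the difference of the two underlying edges. -/
def cornerBoundary : (E ⊕ E → K) →ₗ[K] (E → K) :=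
  (LinearMap.funLeft K K Sum.inl + LinearMap.funLeft K K Sum.inr) ∘ₗ
    (LinearMap.funLeft K K rot.symm - LinearMap.id)

theorem cornerBoundary_apply (x : E ⊕ E → K) (e : E) : cornerBoundary K rot x e =
    x (rot.symm (.inl e)) - x (.inl e) + (x (rot.symm (.inr e)) - x (.inr e)) := rfl

theorem cornerBoundary_single [DecidableEq E] (h : E ⊕ E) :
    cornerBoundary K rot (Pi.single h 1) =
      Pi.single (edgeOf (rot h)) 1 - Pi.single (edgeOf h) 1 := by
  have hrot (k : E ⊕ E) : (Pi.single h 1 : E ⊕ E → K) (rot.symm k) =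
      (Pi.single (rot h) 1 : E ⊕ E → K) k := by
    simp only [Pi.single_apply, Equiv.symm_apply_eq]
  have hedge (k : E ⊕ E) (e : E) : (Pi.single k 1 : E ⊕ E → K) (.inl e) +
      (Pi.single k 1 : E ⊕ E → K) (.inr e) = (Pi.single (edgeOf k) 1 : E → K) e := by
    rcases k with k | k <;> simp [Pi.single_apply]
  ext e
  rw [cornerBoundary_apply, Pi.sub_apply, ← hedge, ← hedge, hrot, hrot]
  ring

theorem invariantFunctions_rot_le_ker_cornerBoundary :
    invariantFunctions K rot ≤ LinearMap.ker (cornerBoundary K rot) := fun x hx => by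
  have hx' (h : E ⊕ E) : x (rot.symm h) = x h := by rw [← hx, Equiv.apply_symm_apply]
  ext e
  simp [cornerBoundary_apply, hx']

theorem invariantFunctions_face_le_ker_cornerBoundary :
    invariantFunctions K ((Equiv.sumComm E E).trans rot.symm) ≤
      LinearMap.ker (cornerBoundary K rot) := fun x hx => by
  have hl (e : E) : x (rot.symm (.inl e)) = x (.inr e) := hx (.inr e)
  have hr (e : E) : x (rot.symm (.inr e)) = x (.inl e) := hx (.inl e)
  ext e
  simp [cornerBoundary_apply, hl, hr]

theorem finrank_invariantFunctions_rot_inf_face_le_one [Finite E]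
    (hconn : ∀ u : E → K, (∀ h, u (edgeOf (rot h)) = u (edgeOf h)) → ∃ c, ∀ e, u e = c) :
    Module.finrank K (invariantFunctions K rot ⊓
      invariantFunctions K ((Equiv.sumComm E E).trans rot.symm) : Submodule K (E ⊕ E → K)) ≤ 1 := by
  refine (Submodule.finrank_mono (t := Submodule.span K {fun _ => 1}) ?_).trans
    (finrank_span_le_card _ |>.trans (by simp))
  rintro x ⟨hrot, hface⟩
  have hswap (h : E ⊕ E) : x h.swap = x h := by
    have hx : x (rot (rot.symm h.swap)) = x h := (hrot _).trans (hface h)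
    rwa [Equiv.apply_symm_apply] at hx
  have hedge (h : E ⊕ E) : x (.inl (edgeOf h)) = x h := by
    rcases h with e | e
    exacts [rfl, hswap (.inr e)]
  obtain ⟨c, hc⟩ := hconn (fun e => x (.inl e)) fun h => by rw [hedge, hedge, hrot]
  refine Submodule.mem_span_singleton.2 ⟨c, funext fun h => ?_⟩
  simp [← hedge h, hc]

theorem finrank_ker_dualMap_cornerBoundary_le_one [Finite E]
    (hconn : ∀ u : E → K, (∀ h, u (edgeOf (rot h)) = u (edgeOf h)) → ∃ c, ∀ e, u e = c) :
    Module.finrank K (LinearMap.ker (cornerBoundary K rot).dualMap) ≤ 1 := by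
  classical
  have := Fintype.ofFinite E
  let total : Module.Dual K (E → K) := ∑ e, LinearMap.proj e
  refine (Submodule.finrank_mono (t := Submodule.span K {total}) ?_).trans
    (finrank_span_le_card _ |>.trans (by simp))
  intro ψ hψ
  obtain ⟨c, hc⟩ := hconn (fun e => ψ (Pi.single e 1)) fun h => by
    have hψh : ψ (cornerBoundary K rot (Pi.single h 1)) = 0 :=
      LinearMap.congr_fun (LinearMap.mem_ker.1 hψ) _
    rwa [cornerBoundary_single, map_sub, sub_eq_zero] at hψh
  refine Submodule.mem_span_singleton.2 ⟨c, LinearMap.pi_ext' fun e => LinearMap.ext_ring ?_⟩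
  simp [total, hc, Pi.single_apply]

theorem ker_cornerBoundary [Fintype E]
    (hconn : ∀ u : E → K, (∀ h, u (edgeOf (rot h)) = u (edgeOf h)) → ∃ c, ∀ e, u e = c)
    (hgenus : Fintype.card E + 2 ≤ Module.finrank K (invariantFunctions K rot) +
      Module.finrank K (invariantFunctions K ((Equiv.sumComm E E).trans rot.symm))) :
    LinearMap.ker (cornerBoundary K rot) = invariantFunctions K rot ⊔
      invariantFunctions K ((Equiv.sumComm E E).trans rot.symm) := by
  refine (Submodule.eq_of_le_of_finrank_le (sup_le invariantFunctions_rot_le_ker_cornerBoundary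
    invariantFunctions_face_le_ker_cornerBoundary) ?_).symm
  have hdim := (cornerBoundary K rot).finrank_range_add_finrank_ker
  have hdual := (cornerBoundary K rot).dualMap.finrank_range_add_finrank_ker
  have hcoker := finrank_ker_dualMap_cornerBoundary_le_one hconn
  have hsup := Submodule.finrank_sup_add_finrank_inf_eq (invariantFunctions K rot)
    (invariantFunctions K ((Equiv.sumComm E E).trans rot.symm))
  have hinf := finrank_invariantFunctions_rot_inf_face_le_one hconn
  rw [LinearMap.finrank_range_dualMap_eq_finrank_range, Subspace.dual_finrank_eq,
    Module.finrank_fintype_fun_eq_card] at hdual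
  rw [Module.finrank_fintype_fun_eq_card, Fintype.card_sum] at hdim
  omega

/-- In genus zero the first cohomology vanishes, and a cochain is closed when it is orthogonal to
the vertices and to the faces. -/
theorem exists_edge_potential [Fintype E]
    (hconn : ∀ u : E → K, (∀ h, u (edgeOf (rot h)) = u (edgeOf h)) → ∃ c, ∀ e, u e = c)
    (hgenus : Fintype.card E + 2 ≤ Module.finrank K (invariantFunctions K rot) +
      Module.finrank K (invariantFunctions K ((Equiv.sumComm E E).trans rot.symm)))
    {b : E ⊕ E → K} (hvert : ∀ x ∈ invariantFunctions K rot, ∑ h, b h * x h = 0)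
    (hface : ∀ x ∈ invariantFunctions K ((Equiv.sumComm E E).trans rot.symm),
      ∑ h, b h * x h = 0) :
    ∃ u : E → K, ∀ h, u (edgeOf (rot h)) - u (edgeOf h) = b h := by
  classical
  let β : Module.Dual K (E ⊕ E → K) := ∑ h, b h • LinearMap.proj h
  have hβ (x) : β x = ∑ h, b h * x h := by simp [β]
  obtain ⟨ψ, hψ⟩ : β ∈ LinearMap.range (cornerBoundary K rot).dualMap := by
    rw [LinearMap.range_dualMap_eq_dualAnnihilator_ker, ker_cornerBoundary hconn hgenus,
      Submodule.mem_dualAnnihilator]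
    intro x hx
    obtain ⟨u, hu, w, hw, rfl⟩ := Submodule.mem_sup.1 hx
    rw [map_add, hβ, hβ, hvert u hu, hface w hw, add_zero]
  refine ⟨fun e => ψ (Pi.single e 1), fun h => ?_⟩
  have hψh : ψ (cornerBoundary K rot (Pi.single h 1)) = β (Pi.single h 1) :=
    LinearMap.congr_fun hψ _
  rw [cornerBoundary_single, map_sub, hβ] at hψh
  simpa [Pi.single_apply] using hψh

end RotationSystem

/-! ### Vertices, rotation and potentials of a network -/

theorem fin_mk_succ {m : ℕ} [NeZero m] {k : ℕ} (hk : k + 1 < m) :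
    (⟨k + 1, hk⟩ : Fin m) = ⟨k, by omega⟩ + 1 := by
  ext
  simp [Fin.val_add, Nat.mod_eq_of_lt hk]

namespace PerfectCylindricalNetwork

section Rotation

variable {m n : ℕ} [NeZero m] [NeZero n] (Γ : PerfectCylindricalNetwork m n)

/-- The vertex at which a half-edge is attached. -/
def vertexAt (h : Γ.E ⊕ Γ.E) : NetVertex m n Γ.V := Sum.elim Γ.src Γ.tgt h

theorem src_sourceEdge (i : Fin m) : Γ.src (Γ.sourceEdge i) = .source i :=
  (Γ.src_eq_source _ i).2 rfl

theorem tgt_sinkEdge (j : Fin n) : Γ.tgt (Γ.sinkEdge j) = .sink j :=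
  (Γ.tgt_eq_sink _ j).2 rfl

theorem sourceEdge_injective : Function.Injective Γ.sourceEdge := fun i j h => by
  have hj := Γ.src_sourceEdge j
  rw [← h, Γ.src_sourceEdge] at hj
  exact NetVertex.source.inj hj

theorem sinkEdge_injective : Function.Injective Γ.sinkEdge := fun i j h => by
  have hj := Γ.tgt_sinkEdge j
  rw [← h, Γ.tgt_sinkEdge] at hj
  exact NetVertex.sink.inj hj

variable {Γ} in
theorem eq_of_vertexAt_source {h : Γ.E ⊕ Γ.E} {i : Fin m} (hh : Γ.vertexAt h = .source i) :
    h = .inl (Γ.sourceEdge i) := by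
  rcases h with e | e
  · exact congrArg _ ((Γ.src_eq_source e i).1 hh)
  · exact absurd hh (Γ.tgt_ne_source e i)

variable {Γ} in
theorem eq_of_vertexAt_sink {h : Γ.E ⊕ Γ.E} {j : Fin n} (hh : Γ.vertexAt h = .sink j) :
    h = .inr (Γ.sinkEdge j) := by
  rcases h with e | e
  · exact absurd hh (Γ.src_ne_sink e j)
  · exact congrArg _ ((Γ.tgt_eq_sink e j).1 hh)

/-- The map from the vertices of the cylinder to those of the sphere which is obtained by
collapsing each of the two boundary circles to a point. -/
def collapse : NetVertex m n Γ.V → Γ.V ⊕ Bool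
  | .source _ => .inr false
  | .sink _ => .inr true
  | .inner v => .inl v

theorem collapse_vertexAt_rot (h : Γ.E ⊕ Γ.E) :
    Γ.collapse (Γ.vertexAt (Γ.rot h)) = Γ.collapse (Γ.vertexAt h) := by
  cases hv : Γ.vertexAt h with
  | source i =>
    obtain ⟨i, rfl⟩ : ∃ i', i = i' + 1 := ⟨i - 1, by simp⟩
    rw [eq_of_vertexAt_source hv, Γ.rot_source]
    simp [vertexAt, src_sourceEdge, collapse]
  | sink j =>
    rw [eq_of_vertexAt_sink hv, Γ.rot_sink]
    simp [vertexAt, tgt_sinkEdge, collapse]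
  | inner v => rw [vertexAt, Γ.rot_inner h v hv]

theorem collapse_vertexAt_surjective :
    Function.Surjective fun h => Γ.collapse (Γ.vertexAt h) := by
  rintro (v | _ | _)
  · obtain ⟨e, he⟩ := Γ.exists_in v
    exact ⟨.inr e, by simp [vertexAt, he, collapse]⟩
  · exact ⟨.inl (Γ.sourceEdge 0), by simp [vertexAt, src_sourceEdge, collapse]⟩
  · exact ⟨.inr (Γ.sinkEdge 0), by simp [vertexAt, tgt_sinkEdge, collapse]⟩

section RotInvariant

variable {Γ} {α : Type*} {x : Γ.E ⊕ Γ.E → α} (hx : ∀ h, x (Γ.rot h) = x h)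

include hx

theorem eq_of_rot_invariant {h h' : Γ.E ⊕ Γ.E} (hh : Γ.vertexAt h = Γ.vertexAt h') :
    x h = x h' := by
  cases hv : Γ.vertexAt h with
  | source i => rw [eq_of_vertexAt_source hv, eq_of_vertexAt_source (hh.symm.trans hv)]
  | sink j => rw [eq_of_vertexAt_sink hv, eq_of_vertexAt_sink (hh.symm.trans hv)]
  | inner v => exact eq_of_sameCycle hx (Γ.rot_cyclic h h' v hv (hh.symm.trans hv))

theorem rot_invariant_source (i : Fin m) :
    x (.inl (Γ.sourceEdge i)) = x (.inl (Γ.sourceEdge 0)) := by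
  obtain ⟨k, hk⟩ := i
  induction k with
  | zero => rfl
  | succ k ih => rw [← ih (by omega), ← hx, fin_mk_succ, Γ.rot_source]

theorem rot_invariant_sink (j : Fin n) :
    x (.inr (Γ.sinkEdge j)) = x (.inr (Γ.sinkEdge 0)) := by
  obtain ⟨k, hk⟩ := j
  induction k with
  | zero => rfl
  | succ k ih => rw [← ih (by omega), fin_mk_succ, ← Γ.rot_sink, hx]

end RotInvariant

instance : Finite Γ.Vertex :=
  Finite.of_surjective (Sum.elim Γ.source (Sum.elim Γ.sink NetVertex.inner)) (by
    rintro (i | j | v)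
    exacts [⟨.inl i, rfl⟩, ⟨.inr (.inl j), rfl⟩, ⟨.inr (.inr v), rfl⟩])

/-- `Γ.Reach a b`: there is a directed path of positive length from `a` to `b`. -/
def Reach : Γ.Vertex → Γ.Vertex → Prop :=
  Relation.TransGen fun a b => ∃ e, Γ.src e = a ∧ Γ.tgt e = b

theorem wellFounded_reach : WellFounded Γ.Reach := by
  have : Std.Irrefl Γ.Reach := ⟨Γ.acyclic⟩
  have : IsTrans Γ.Vertex Γ.Reach := ⟨fun _ _ _ => Relation.TransGen.trans⟩
  exact Finite.wellFounded_of_trans_of_irrefl Γ.Reach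

/-- Every vertex is reached from a source, so the collapsed graph is connected. -/
theorem eq_sourceEdge_of_rot_invariant {α : Type*} {u : Γ.E → α}
    (hu : ∀ h, u (edgeOf (Γ.rot h)) = u (edgeOf h)) (e : Γ.E) : u e = u (Γ.sourceEdge 0) := by
  generalize hx : (Γ.src e : Γ.Vertex) = x
  induction x using Γ.wellFounded_reach.induction generalizing e with
  | _ x ih =>
  match x, hx with
  | .source i, he =>
    rw [(Γ.src_eq_source e i).1 he]
    exact rot_invariant_source (x := fun h => u (edgeOf h)) hu i
  | .sink j, he => exact absurd he (Γ.src_ne_sink e j)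
  | .inner v, he =>
    obtain ⟨g, hg⟩ := Γ.exists_in v
    rw [← ih (Γ.src g) (.single ⟨g, rfl, hg⟩) g rfl]
    exact eq_of_rot_invariant (x := fun h => u (edgeOf h)) hu (h := .inl e) (h' := .inr g)
      (he.trans hg.symm)

theorem card_edge_add_two_le_finrank (K : Type*) [Field K] :
    Fintype.card Γ.E + 2 ≤ Module.finrank K (invariantFunctions K Γ.rot) +
      Module.finrank K (invariantFunctions K Γ.facePerm) := by
  classical
  let Face := Quotient (⟨Γ.facePerm.SameCycle, Equiv.Perm.SameCycle.equivalence _⟩ :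
    Setoid (Γ.E ⊕ Γ.E))
  have : Finite Face := Quotient.finite _
  have : Fintype Face := Fintype.ofFinite _
  have hV := card_le_finrank_invariantFunctions K Γ.collapse_vertexAt_surjective
    Γ.collapse_vertexAt_rot
  have hF := card_le_finrank_invariantFunctions K (σ := Γ.facePerm) (X := Face)
    Quotient.mk_surjective fun h =>
      Quotient.sound (Equiv.Perm.sameCycle_apply_left.2 (Equiv.Perm.SameCycle.refl _ _))
  have heuler : Nat.card Face + Fintype.card Γ.V = Fintype.card Γ.E := Γ.euler
  rw [Nat.card_eq_fintype_card] at heuler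
  rw [Fintype.card_sum, Fintype.card_bool] at hV
  omega

theorem exists_potential {K : Type*} [Field K] {b : Γ.E ⊕ Γ.E → K}
    (hvert : ∀ x : Γ.E ⊕ Γ.E → K, (∀ h, x (Γ.rot h) = x h) → ∑ h, b h * x h = 0)
    (hface : ∀ x : Γ.E ⊕ Γ.E → K, (∀ h, x (Γ.facePerm h) = x h) → ∑ h, b h * x h = 0) :
    ∃ u : Γ.E → K, ∀ h, u (edgeOf (Γ.rot h)) - u (edgeOf h) = b h :=
  exists_edge_potential (fun _ hu => ⟨_, Γ.eq_sourceEdge_of_rot_invariant hu⟩)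
    (Γ.card_edge_add_two_le_finrank K) hvert hface

variable {Γ} in
theorem IsDualWalk.sum {G : Type*} [AddCommGroup G] {l : List (Γ.E ⊕ Γ.E)} {h h' : Γ.E ⊕ Γ.E}
    (hl : Γ.IsDualWalk h l h') {x : Γ.E ⊕ Γ.E → G} (hx : ∀ h, x (Γ.facePerm h) = x h) :
    (l.map fun k => x k - x k.swap).sum = x h - x h' := by
  induction l generalizing h with
  | nil => simp [eq_of_sameCycle hx hl]
  | cons k l ih =>
    rw [List.map_cons, List.sum_cons, ih hl.2, eq_of_sameCycle hx hl.1]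
    exact sub_add_sub_cancel _ (x k.swap) _

end Rotation

end PerfectCylindricalNetwork

/-! ### Edges of a path and the strips between its lifts -/

theorem lawfulBEq_sum (α β : Type*) [BEq α] [BEq β] [LawfulBEq α] [LawfulBEq β] :
    LawfulBEq (α ⊕ β) where
  rfl {a} := by
    rcases a with a | a
    exacts [beq_self_eq_true a, beq_self_eq_true a]
  eq_of_beq {a b} h := by
    rcases a with a | a <;> rcases b with b | b
    · exact congrArg _ (eq_of_beq (α := α) h)
    · exact absurd h Bool.false_ne_true
    · exact absurd h Bool.false_ne_true
    · exact congrArg _ (eq_of_beq (α := β) h)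

theorem list_sum_map_eq_sum_count_smul {α M : Type*} [Fintype α] [BEq α] [LawfulBEq α]
    [AddCommMonoid M] (l : List α) (f : α → M) : (l.map f).sum = ∑ a, l.count a • f a := by
  classical
  induction l with
  | nil => simp
  | cons b l ih => simp [List.count_cons, add_smul, Finset.sum_add_distrib, ih, add_comm, ite_smul]

namespace PerfectCylindricalNetwork

noncomputable section

variable {m n : ℕ} [NeZero m] [NeZero n] {Γ : PerfectCylindricalNetwork m n} (κ : Γ.Cut)

theorem Cut.sum_index_smul {G : Type*} [AddCommGroup G] {x : Γ.E ⊕ Γ.E → G}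
    (hx : ∀ h, x (Γ.facePerm h) = x h) :
    ∑ e, κ.index e • (x (.inl e) - x (.inr e)) =
      x (.inl (Γ.sourceEdge 0)) - x (.inl (Γ.sinkEdge 0)) := by
  classical
  have := lawfulBEq_sum Γ.E Γ.E
  rw [← κ.isDualWalk.sum hx, list_sum_map_eq_sum_count_smul, Fintype.sum_sum_type,
    ← Finset.sum_add_distrib]
  refine Finset.sum_congr rfl fun e _ => ?_
  rw [Cut.index, sub_smul, natCast_zsmul, natCast_zsmul, Sum.swap_inl, Sum.swap_inr, sub_eq_add_neg,
    ← smul_neg, neg_sub]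

/-- The edges of a path, each with the intersection index of the preceding part of the path, from
the last one to the first one. -/
def Cut.steps (κ : Γ.Cut) {a : Γ.Vertex} : ∀ {b : Γ.Vertex}, Quiver.Path a b → List (ℤ × Γ.E)
  | _, .nil => []
  | _, .cons p e => (κ.pathIndex p, e.1) :: κ.steps p

variable {κ}

section Steps

variable {a b c : Γ.Vertex} {p : Quiver.Path a b} {x y : ℤ × Γ.E}

theorem Cut.reach_of_mem_steps (hx : x ∈ κ.steps p) :
    Γ.tgt x.2 = b ∨ Γ.Reach (Γ.tgt x.2) b := by
  induction p with
  | nil => simp [Cut.steps] at hx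
  | cons p e ih =>
    rcases List.mem_cons.1 hx with rfl | hx
    · exact .inl e.2.2
    · have he : Γ.Reach _ _ := .single ⟨e.1, e.2⟩
      rcases ih hx with h | h
      · exact .inr (h ▸ he)
      · exact .inr (h.trans he)

theorem Cut.tgt_ne_of_mem_steps (e : b ⟶ c) (hx : x ∈ κ.steps p) : Γ.tgt x.2 ≠ Γ.tgt e.1 := by
  intro h
  have he : Γ.Reach b c := .single ⟨e.1, e.2⟩
  rw [e.2.2] at h
  rcases reach_of_mem_steps hx with h' | h'
  · exact Γ.acyclic b (h.symm.trans h' ▸ he)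
  · exact Γ.acyclic b (he.trans (h ▸ h'))

theorem Cut.src_ne_of_mem_steps (hx : x ∈ κ.steps p) : Γ.src x.2 ≠ b := by
  intro h
  have he : Γ.Reach b (Γ.tgt x.2) := .single ⟨x.2, h, rfl⟩
  rcases reach_of_mem_steps hx with h' | h'
  · exact Γ.acyclic b (h' ▸ he)
  · exact Γ.acyclic b (he.trans h')

theorem Cut.eq_of_tgt_eq (hx : x ∈ κ.steps p) (hy : y ∈ κ.steps p)
    (h : Γ.tgt x.2 = Γ.tgt y.2) : x = y := by
  induction p with
  | nil => simp [Cut.steps] at hx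
  | cons p e ih =>
    rcases List.mem_cons.1 hx with rfl | hx <;> rcases List.mem_cons.1 hy with rfl | hy
    · rfl
    · exact absurd h.symm (tgt_ne_of_mem_steps e hy)
    · exact absurd h (tgt_ne_of_mem_steps e hx)
    · exact ih hx hy

theorem Cut.eq_of_src_eq (hx : x ∈ κ.steps p) (hy : y ∈ κ.steps p)
    (h : Γ.src x.2 = Γ.src y.2) : x = y := by
  induction p with
  | nil => simp [Cut.steps] at hx
  | cons p e ih =>
    rcases List.mem_cons.1 hx with rfl | hx <;> rcases List.mem_cons.1 hy with rfl | hy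
    · rfl
    · exact absurd (h.symm.trans e.2.1) (src_ne_of_mem_steps hy)
    · exact absurd (h.trans e.2.1) (src_ne_of_mem_steps hx)
    · exact ih hx hy

theorem Cut.nodup_map_snd_steps (p : Quiver.Path a b) : ((κ.steps p).map Prod.snd).Nodup := by
  induction p with
  | nil => exact List.nodup_nil
  | cons p e ih =>
    refine List.nodup_cons.2 ⟨fun he => ?_, ih⟩
    obtain ⟨x, hx, hxe⟩ := List.mem_map.1 he
    exact src_ne_of_mem_steps hx ((congrArg Γ.src hxe).trans e.2.1)

theorem Cut.exists_pred (hy : y ∈ κ.steps p) : (Γ.src y.2 = a ∧ y.1 = 0) ∨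
    ∃ x ∈ κ.steps p, Γ.tgt x.2 = Γ.src y.2 ∧ y.1 = x.1 + κ.index x.2 := by
  induction p with
  | nil => simp [Cut.steps] at hy
  | cons p e ih =>
    rcases List.mem_cons.1 hy with rfl | hy
    · cases p with
      | nil => exact .inl ⟨e.2.1, rfl⟩
      | cons p f =>
        exact .inr ⟨(κ.pathIndex p, f.1), by simp [Cut.steps], f.2.2.trans e.2.1.symm, rfl⟩
    · rcases ih hy with h | ⟨x, hx, h⟩
      · exact .inl h
      · exact .inr ⟨x, List.mem_cons_of_mem _ hx, h⟩

theorem Cut.exists_succ (hx : x ∈ κ.steps p) :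
    (Γ.tgt x.2 = b ∧ x.1 + κ.index x.2 = κ.pathIndex p) ∨
      ∃ y ∈ κ.steps p, Γ.src y.2 = Γ.tgt x.2 ∧ y.1 = x.1 + κ.index x.2 := by
  induction p with
  | nil => simp [Cut.steps] at hx
  | cons p e ih =>
    rcases List.mem_cons.1 hx with rfl | hx
    · exact .inl ⟨e.2.2, rfl⟩
    · rcases ih hx with h | ⟨y, hy, h⟩
      · exact .inr ⟨_, List.mem_cons_self, e.2.1.trans h.1.symm, h.2.symm⟩
      · exact .inr ⟨y, List.mem_cons_of_mem _ hy, h⟩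

variable (κ) in
theorem Cut.sum_steps_rot_invariant {G : Type*} [AddCommGroup G] {i : Fin m}
    (p : Quiver.Path (Γ.source i) c) {x : Γ.E ⊕ Γ.E → G} (hx : ∀ h, x (Γ.rot h) = x h)
    {h : Γ.E ⊕ Γ.E} (hh : Γ.vertexAt h = c) :
    ((κ.steps p).map fun y => x (.inl y.2) - x (.inr y.2)).sum =
      x (.inl (Γ.sourceEdge i)) - x h := by
  induction p generalizing h with
  | nil => rw [eq_of_vertexAt_source hh]; simp [Cut.steps]
  | cons p e ih =>
    rw [Cut.steps, List.map_cons, List.sum_cons, ih (h := .inl e.1) e.2.1,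
      eq_of_rot_invariant hx (h := .inr e.1) (e.2.2.trans hh.symm)]
    abel

variable (κ) in
open Classical in
/-- The indicator function of the edges of a path. -/
def Cut.onPath (p : Quiver.Path a b) (e : Γ.E) : ℚ :=
  if e ∈ (κ.steps p).map Prod.snd then 1 else 0

theorem Cut.onPath_eq_one (hx : x ∈ κ.steps p) : κ.onPath p x.2 = 1 :=
  if_pos (List.mem_map_of_mem hx)

theorem Cut.onPath_eq_zero {e : Γ.E} (he : ∀ x ∈ κ.steps p, x.2 ≠ e) : κ.onPath p e = 0 :=
  if_neg fun h => by
    obtain ⟨x, hx, hxe⟩ := List.mem_map.1 h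
    exact he x hx hxe

variable (κ) in
theorem Cut.sum_onPath (p : Quiver.Path a b) (f : Γ.E → ℚ) :
    ∑ e, κ.onPath p e * f e = ((κ.steps p).map fun y => f y.2).sum := by
  classical
  rw [show (fun y : ℤ × Γ.E => f y.2) = f ∘ Prod.snd from rfl, ← List.map_map,
    list_sum_map_eq_sum_count_smul]
  refine Finset.sum_congr rfl fun e _ => ?_
  rw [Cut.onPath, (nodup_map_snd_steps p).count]
  split_ifs <;> simp

end Steps

open Classical in
variable (Γ) in
/-- The contribution of the corner between `h` and `rot h` to the jump of the numbering of the
sheets of the universal cover of the cylinder: the left end of the cut lies between the last and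
the first source, the right end between the last and the first sink. -/
def seam (h : Γ.E ⊕ Γ.E) : ℚ :=
  (if h = .inl (Γ.sourceEdge 0) then 1 else 0) - if Γ.rot h = .inr (Γ.sinkEdge 0) then 1 else 0

theorem sum_seam (x : Γ.E ⊕ Γ.E → ℚ) : ∑ h, Γ.seam h * x h =
    x (.inl (Γ.sourceEdge 0)) - x (Γ.rot.symm (.inr (Γ.sinkEdge 0))) := by
  classical
  simp only [seam, sub_mul, Finset.sum_sub_distrib, ite_mul, one_mul, zero_mul,
    ← Equiv.eq_symm_apply]
  simp

/-- The levels of the two sides of the half-edges with respect to a path `p`: the lifts of `p` to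
the universal cover of the cylinder divide it into strips, which are numbered from bottom to
top. -/
structure Cut.Levels (κ : Γ.Cut) {a : Fin m} {b : Fin n}
    (p : Quiver.Path (Γ.source a) (Γ.sink b)) where
  /-- the level on the left of a half-edge, at its vertex -/
  left : Γ.E ⊕ Γ.E → ℚ
  /-- the level on the right of a half-edge, at its vertex -/
  right : Γ.E ⊕ Γ.E → ℚ
  right_inl : ∀ e, right (.inl e) = left (.inl e) - κ.onPath p e
  left_inr : ∀ e, left (.inr e) = right (.inl e) - κ.index e
  right_inr : ∀ e, right (.inr e) = left (.inl e) - κ.index e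
  right_rot : ∀ h, right (Γ.rot h) = left h - Γ.seam h
  left_source : left (.inl (Γ.sourceEdge a)) = 0

section Levels

variable (κ) {a : Fin m} {b : Fin n} (p : Quiver.Path (Γ.source a) (Γ.sink b))

/-- The level on the left of a half-edge, relative to the left of the tail of its edge. -/
def Cut.leftOffset : Γ.E ⊕ Γ.E → ℚ :=
  Sum.elim (fun _ => 0) fun e => -κ.onPath p e - κ.index e

/-- The level on the right of a half-edge, relative to the left of the tail of its edge. -/
def Cut.rightOffset : Γ.E ⊕ Γ.E → ℚ :=
  Sum.elim (fun e => -κ.onPath p e) fun e => -κ.index e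

/-- The jump of the level from an edge to the next one around a vertex. -/
def Cut.levelJump (h : Γ.E ⊕ Γ.E) : ℚ :=
  κ.leftOffset p h - κ.rightOffset p (Γ.rot h) - Γ.seam h

/-- A path enters and leaves each vertex equally often, up to its two ends, which the seam
compensates on the sphere. -/
theorem Cut.sum_levelJump_rot_invariant {x : Γ.E ⊕ Γ.E → ℚ} (hx : ∀ h, x (Γ.rot h) = x h) :
    ∑ h, κ.levelJump p h * x h = 0 := by
  have hrot : ∑ h, κ.rightOffset p (Γ.rot h) * x h = ∑ h, κ.rightOffset p h * x h := by
    rw [← Equiv.sum_comp Γ.rot fun h => κ.rightOffset p h * x h]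
    simp only [hx]
  have hoffset : ∑ h, (κ.leftOffset p h - κ.rightOffset p h) * x h =
      x (.inl (Γ.sourceEdge a)) - x (.inr (Γ.sinkEdge b)) := by
    rw [← κ.sum_steps_rot_invariant p hx (h := .inr (Γ.sinkEdge b)) (Γ.tgt_sinkEdge b),
      ← κ.sum_onPath p fun e => x (.inl e) - x (.inr e), Fintype.sum_sum_type,
      ← Finset.sum_add_distrib]
    refine Finset.sum_congr rfl fun e _ => ?_
    simp only [Cut.leftOffset, Cut.rightOffset, Sum.elim_inl, Sum.elim_inr]
    ring
  have hsink : x (Γ.rot.symm (.inr (Γ.sinkEdge 0))) = x (.inr (Γ.sinkEdge 0)) := by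
    rw [← hx, Equiv.apply_symm_apply]
  simp only [Cut.levelJump, sub_mul, Finset.sum_sub_distrib] at hoffset ⊢
  rw [hrot, hoffset, sum_seam, rot_invariant_source hx, rot_invariant_sink hx, hsink, sub_self]

/-- Around a face the level changes by the intersection numbers with the cut, which sum to the
seam. -/
theorem Cut.sum_levelJump_face_invariant {x : Γ.E ⊕ Γ.E → ℚ}
    (hx : ∀ h, x (Γ.facePerm h) = x h) : ∑ h, κ.levelJump p h * x h = 0 := by
  have hface : ∑ h, κ.rightOffset p (Γ.rot h) * x h = ∑ h, κ.rightOffset p h.swap * x h := by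
    have hrot (h : Γ.E ⊕ Γ.E) : Γ.rot (Γ.facePerm h) = h.swap := Γ.rot.apply_symm_apply _
    rw [← Equiv.sum_comp Γ.facePerm]
    simp only [hx, hrot]
  have hoffset : ∑ h, (κ.leftOffset p h - κ.rightOffset p h.swap) * x h =
      x (.inl (Γ.sourceEdge 0)) - x (.inl (Γ.sinkEdge 0)) := by
    rw [← κ.sum_index_smul hx, Fintype.sum_sum_type, ← Finset.sum_add_distrib]
    refine Finset.sum_congr rfl fun e _ => ?_
    simp only [Cut.leftOffset, Cut.rightOffset, Sum.swap_inl, Sum.swap_inr, Sum.elim_inl,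
      Sum.elim_inr, zsmul_eq_mul]
    ring
  have hsink : x (Γ.rot.symm (.inr (Γ.sinkEdge 0))) = x (.inl (Γ.sinkEdge 0)) :=
    hx (.inl (Γ.sinkEdge 0))
  simp only [Cut.levelJump, sub_mul, Finset.sum_sub_distrib] at hoffset ⊢
  rw [hface, hoffset, sum_seam, hsink, sub_self]

theorem Cut.nonempty_levels : Nonempty (κ.Levels p) := by
  obtain ⟨u, hu⟩ := Γ.exists_potential (fun x => κ.sum_levelJump_rot_invariant p)
    (fun x => κ.sum_levelJump_face_invariant p)
  refine ⟨⟨fun h => u (edgeOf h) + κ.leftOffset p h - u (Γ.sourceEdge a),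
    fun h => u (edgeOf h) + κ.rightOffset p h - u (Γ.sourceEdge a), ?_, ?_, ?_, ?_, ?_⟩⟩
  · intro e; simp [Cut.leftOffset, Cut.rightOffset]; ring
  · intro e; simp [Cut.leftOffset, Cut.rightOffset]; ring
  · intro e; simp [Cut.leftOffset, Cut.rightOffset]; ring
  · intro h; linarith [hu h, Cut.levelJump.eq_1 κ p h]
  · simp [Cut.leftOffset]

end Levels

end

end PerfectCylindricalNetwork

/-! ### Trivalent vertices and the position of half-edges -/

theorem sign_add_half_sub_sign (R : Type*) [Ring R] (n : ℤ) (t : SignType) :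
    (SignType.sign ((n : ℚ) + t / 2) : R) - SignType.sign (n : ℚ) =
      if n = 0 then (t : R) else 0 := by
  have ht : -1 ≤ (t : ℚ) ∧ (t : ℚ) ≤ 1 := by cases t <;> norm_num
  rcases lt_trichotomy n 0 with h | rfl | h
  · have hn : (n : ℚ) ≤ -1 := by exact_mod_cast Int.le_sub_one_of_lt h
    rw [sign_neg (by linarith), sign_neg (by linarith), if_neg h.ne, sub_self]
  · have hhalf : SignType.sign (-1 / 2 : ℚ) = -1 := sign_neg (by norm_num)
    cases t <;> simp [hhalf]
  · have hn : (1 : ℚ) ≤ n := by exact_mod_cast h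
    rw [sign_pos (by linarith), sign_pos (by linarith), if_neg h.ne', sub_self]

theorem sign_sub_sign_sub_half (R : Type*) [Ring R] (n : ℤ) (t : SignType) :
    (SignType.sign (n : ℚ) : R) - SignType.sign ((n : ℚ) - t / 2) =
      if n = 0 then (t : R) else 0 := by
  have h := sign_add_half_sub_sign R n (-t)
  rw [SignType.coe_neg, neg_div, ← sub_eq_add_neg, SignType.coe_neg] at h
  rw [← neg_sub, h]
  split_ifs <;> simp

namespace PerfectCylindricalNetwork

section Trivalent

variable {m n : ℕ} [NeZero m] [NeZero n] {Γ : PerfectCylindricalNetwork m n}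
  {h k : Γ.E ⊕ Γ.E} {v : Γ.V}

theorem vertexAt_rot (hv : Γ.vertexAt h = .inner v) : Γ.vertexAt (Γ.rot h) = .inner v :=
  Γ.rot_inner h v hv

theorem ncard_halfEdges (v : Γ.V) : {h | Γ.vertexAt h = .inner v}.ncard = 3 :=
  Γ.trivalent v

theorem rot_ne (hv : Γ.vertexAt h = .inner v) : Γ.rot h ≠ h := by
  intro hh
  have hsub : {k | Γ.vertexAt k = .inner v} ⊆ {h} := fun k hk =>
    (eq_of_rot_invariant (x := fun k => k = h)
      (fun k => by rw [← Γ.rot.apply_eq_iff_eq (x := k), hh]) (hk.trans hv.symm)).mpr rfl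
  have hcard := Set.ncard_le_ncard hsub
  rw [ncard_halfEdges, Set.ncard_singleton] at hcard
  omega

theorem rot_rot_ne (hv : Γ.vertexAt h = .inner v) : Γ.rot (Γ.rot h) ≠ h := by
  intro hh
  have hsub : {k | Γ.vertexAt k = .inner v} ⊆ {h, Γ.rot h} := fun k hk =>
    (eq_of_rot_invariant (x := fun k => k = h ∨ k = Γ.rot h) (fun k => by
      rw [← Γ.rot.apply_eq_iff_eq (x := k), ← Γ.rot.apply_eq_iff_eq (x := k) (y := Γ.rot h), hh,
        or_comm]) (hk.trans hv.symm)).mpr (.inl rfl)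
  have hcard := (Set.ncard_le_ncard hsub).trans (Set.ncard_insert_le h {Γ.rot h})
  rw [ncard_halfEdges, Set.ncard_singleton] at hcard
  omega

theorem eq_rot_or_eq_rot_rot (hv : Γ.vertexAt h = .inner v) (hk : Γ.vertexAt k = .inner v) :
    k = h ∨ k = Γ.rot h ∨ k = Γ.rot (Γ.rot h) := by
  have hsub : {h, Γ.rot h, Γ.rot (Γ.rot h)} ⊆ {k | Γ.vertexAt k = .inner v} := by
    rintro _ (rfl | rfl | rfl)
    exacts [hv, vertexAt_rot hv, vertexAt_rot (vertexAt_rot hv)]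
  have hcard : ({h, Γ.rot h, Γ.rot (Γ.rot h)} : Set (Γ.E ⊕ Γ.E)).ncard = 3 :=
    Set.ncard_eq_three.2 ⟨_, _, _, (rot_ne hv).symm, (rot_rot_ne hv).symm,
      (rot_ne (vertexAt_rot hv)).symm, rfl⟩
  have heq := Set.eq_of_subset_of_ncard_le hsub (by rw [hcard, ncard_halfEdges])
  exact heq.symm.subset hk

theorem rot_rot_rot (hv : Γ.vertexAt h = .inner v) : Γ.rot (Γ.rot (Γ.rot h)) = h := by
  have hv' := vertexAt_rot hv
  rcases eq_rot_or_eq_rot_rot hv (vertexAt_rot (vertexAt_rot hv')) with hh | hh | hh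
  · exact hh
  · exact absurd hh (rot_rot_ne hv')
  · exact absurd hh (rot_ne (vertexAt_rot hv'))

theorem exists_inner_of_tgt_eq_src {e f : Γ.E} (h : Γ.tgt e = Γ.src f) :
    ∃ v, Γ.tgt e = .inner v ∧ Γ.src f = .inner v := by
  rw [h]
  cases hs : Γ.src f with
  | source i => exact absurd (h.trans hs) (Γ.tgt_ne_source _ _)
  | sink j => exact absurd hs (Γ.src_ne_sink _ _)
  | inner v => exact ⟨v, rfl, rfl⟩

theorem seam_eq_zero (hv : Γ.vertexAt h = .inner v) : Γ.seam h = 0 := by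
  have hsource : h ≠ .inl (Γ.sourceEdge 0) := by
    rintro rfl
    cases (Γ.src_sourceEdge 0).symm.trans hv
  have hsink : Γ.rot h ≠ .inr (Γ.sinkEdge 0) := fun hh => by
    have hv' := hh ▸ vertexAt_rot hv
    cases (Γ.tgt_sinkEdge 0).symm.trans hv'
  rw [seam, if_neg hsource, if_neg hsink, sub_zero]

variable (Γ) in
open Classical in
/-- The turn from a half-edge to another one at the same inner vertex: `1` if the second one comes
next in counterclockwise order, `-1` if it comes next in clockwise order, and `0` if the two
half-edges agree. -/
noncomputable def turn (h k : Γ.E ⊕ Γ.E) : SignType :=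
  if Γ.rot h = k then 1 else if Γ.rot k = h then -1 else 0

end Trivalent

namespace Cut.Levels

noncomputable section

variable {m n : ℕ} [NeZero m] [NeZero n] {Γ : PerfectCylindricalNetwork m n} {κ : Γ.Cut}
  {a : Fin m} {b : Fin n} {p : Quiver.Path (Γ.source a) (Γ.sink b)} (Λ : κ.Levels p)
  {h k : Γ.E ⊕ Γ.E} {v : Γ.V} {x y : ℤ × Γ.E}

/-- The level in the middle of an edge at a half-edge, where the levels are shifted such that the
lifts of `p` have integral levels. -/
def mid (h : Γ.E ⊕ Γ.E) : ℚ := (Λ.left h + Λ.right h + 1) / 2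

theorem mid_inr (e : Γ.E) : Λ.mid (.inr e) = Λ.mid (.inl e) - κ.index e := by
  rw [mid, mid, Λ.left_inr, Λ.right_inr]
  ring

theorem right_rot_of_inner (hv : Γ.vertexAt h = .inner v) : Λ.right (Γ.rot h) = Λ.left h := by
  rw [Λ.right_rot, seam_eq_zero hv, sub_zero]

theorem left_sub_right_inl (e : Γ.E) : Λ.left (.inl e) - Λ.right (.inl e) = κ.onPath p e := by
  rw [Λ.right_inl, sub_sub_cancel]

theorem left_sub_right_inr (e : Γ.E) : Λ.left (.inr e) - Λ.right (.inr e) = -κ.onPath p e := by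
  rw [Λ.left_inr, Λ.right_inr, Λ.right_inl]
  ring

theorem left_eq_right (hsrc : ∀ y ∈ κ.steps p, h ≠ .inl y.2)
    (htgt : ∀ x ∈ κ.steps p, h ≠ .inr x.2) : Λ.left h = Λ.right h := by
  rw [← sub_eq_zero]
  rcases h with e | e
  · rw [left_sub_right_inl, onPath_eq_zero fun y hy hye => hsrc y hy (congrArg _ hye.symm)]
  · rw [left_sub_right_inr, onPath_eq_zero fun x hx hxe => htgt x hx (congrArg _ hxe.symm),
      neg_zero]

theorem left_eq_right_of_ne (hx : x ∈ κ.steps p) (hy : y ∈ κ.steps p)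
    (hxh : Γ.vertexAt h = Γ.tgt x.2) (hyh : Γ.vertexAt h = Γ.src y.2) (hhx : h ≠ .inr x.2)
    (hhy : h ≠ .inl y.2) : Λ.left h = Λ.right h := by
  refine Λ.left_eq_right ?_ ?_
  · rintro y' hy' rfl
    exact hhy (by rw [eq_of_src_eq hy' hy hyh])
  · rintro x' hx' rfl
    exact hhx (by rw [eq_of_tgt_eq hx' hx hxh])

theorem left_succ (hx : x ∈ κ.steps p) (hy : y ∈ κ.steps p) (hxy : Γ.tgt x.2 = Γ.src y.2) :
    Λ.left (.inl y.2) = Λ.right (.inr x.2) := by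
  obtain ⟨v, hxv, hyv⟩ := exists_inner_of_tgt_eq_src hxy
  have hv : Γ.vertexAt (.inl y.2) = .inner v := hyv
  have hv' := vertexAt_rot hv
  rcases eq_rot_or_eq_rot_rot hv (k := .inr x.2) hxv with h | h | h
  · simp at h
  · rw [h, Λ.right_rot_of_inner hv]
  · rw [h, Λ.right_rot_of_inner hv', Λ.left_eq_right_of_ne hx hy (hv'.trans hxv.symm)
      (hv'.trans hyv.symm) (h ▸ (rot_ne hv').symm) (rot_ne hv), Λ.right_rot_of_inner hv]

theorem left_of_mem_steps (hy : y ∈ κ.steps p) : Λ.left (.inl y.2) = -y.1 := by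
  generalize hv : (Γ.src y.2 : Γ.Vertex) = v
  induction v using Γ.wellFounded_reach.induction generalizing y with
  | _ v ih =>
  rcases exists_pred hy with ⟨hsrc, hzero⟩ | ⟨x, hx, hxy, hindex⟩
  · rw [(Γ.src_eq_source y.2 a).1 hsrc, Λ.left_source, hzero, Int.cast_zero, neg_zero]
  · rw [Λ.left_succ hx hy hxy, Λ.right_inr, ih _ (.single ⟨x.2, rfl, hxy.trans hv⟩) hx rfl,
      hindex]
    push_cast
    ring

theorem mid_inl_of_mem_steps (hy : y ∈ κ.steps p) : Λ.mid (.inl y.2) = -y.1 := by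
  rw [mid, Λ.right_inl, Λ.left_of_mem_steps hy, onPath_eq_one hy]
  ring

theorem mid_inr_of_mem_steps (hx : x ∈ κ.steps p) :
    Λ.mid (.inr x.2) = -(x.1 + κ.index x.2 : ℤ) := by
  rw [Λ.mid_inr, Λ.mid_inl_of_mem_steps hx]
  push_cast
  ring

theorem mid_eq_add_turn (hv : Γ.vertexAt h = .inner v) (hk : Γ.vertexAt k = .inner v)
    (hhk : k ≠ h → Λ.left k = Λ.right k) :
    Λ.mid k = Λ.mid h + (Λ.left h - Λ.right h) * Γ.turn h k / 2 := by
  rcases eq_rot_or_eq_rot_rot hv hk with rfl | rfl | rfl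
  · rw [turn, if_neg (rot_ne hv), if_neg (rot_ne hv)]
    simp
  · rw [mid, mid, ← hhk (rot_ne hv), hhk (rot_ne hv), Λ.right_rot_of_inner hv, turn, if_pos rfl]
    simp only [SignType.coe_one]
    ring
  · have hrot := Λ.right_rot_of_inner hk
    rw [rot_rot_rot hv] at hrot
    rw [mid, mid, ← hhk (rot_rot_ne hv), ← hrot, turn, if_neg (rot_ne (vertexAt_rot hv)).symm,
      if_pos (rot_rot_rot hv)]
    simp only [SignType.coe_neg, SignType.coe_one]
    ring

end

end Cut.Levels

end PerfectCylindricalNetwork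

/-! ### Intersection numbers of paths -/

theorem list_sum_map_eq_of_nodup {α M : Type*} [AddCommMonoid M] {l : List α} {f : α → M} {a : α}
    (hl : l.Nodup) (ha : a ∈ l) (h : ∀ b ∈ l, b ≠ a → f b = 0) : (l.map f).sum = f a := by
  classical
  rw [List.sum_map_eq_nsmul_single a f fun b hba hb => h b hb hba, List.count_eq_one_of_mem hl ha,
    one_smul]

theorem fin_eq_add_of_forall_succ {N : ℕ} [NeZero N] {f : Fin N → ℚ} {a : Fin N}
    (h : ∀ i, i + 1 ≠ 0 → f (i + 1) = f i - if i = a then 1 else 0) (i : Fin N) :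
    f i = f a + if a < i then -1 else 0 := by
  have hzero (k : ℕ) (hk : k < N) : f ⟨k, hk⟩ = f 0 + if a.val < k then -1 else 0 := by
    induction k with
    | zero => simp
    | succ k ih =>
      rw [fin_mk_succ hk, h _ (by rw [← fin_mk_succ hk]; simp [Fin.ext_iff]), ih (by omega)]
      simp only [Fin.ext_iff]
      split_ifs <;> first | omega | ring
  have ha := hzero a a.2
  rw [if_neg (lt_irrefl _), add_zero] at ha
  rw [ha]
  exact hzero i i.2

namespace PerfectCylindricalNetwork

noncomputable section

variable {N : ℕ} [NeZero N] {Γ : PerfectCylindricalNetwork N N} (𝕜 : Type*) [Field 𝕜]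

section Coefficients

variable {e f : Γ.E} {v : Γ.V}

theorem whiteCoeff_eq_turn (he : Γ.src e = .inner v) (hf : Γ.src f = .inner v) :
    Γ.whiteCoeff 𝕜 e f = (Γ.turn (.inl e) (.inl f) : 𝕜) / 2 := by
  rw [whiteCoeff, if_pos ⟨v, he, hf⟩, turn]
  split_ifs <;> simp

theorem blackCoeff_eq_turn (he : Γ.tgt e = .inner v) (hf : Γ.tgt f = .inner v) :
    Γ.blackCoeff 𝕜 e f = (Γ.turn (.inr f) (.inr e) : 𝕜) / 2 := by
  rw [blackCoeff, if_pos ⟨v, he, hf⟩, turn]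
  split_ifs with hef hfe hfe
  · exact absurd (hef ▸ hfe) (rot_rot_ne (h := .inr e) he)
  all_goals simp

theorem whiteCoeff_eq_zero (h : ∀ v, Γ.src e = .inner v → Γ.src f ≠ .inner v) :
    Γ.whiteCoeff 𝕜 e f = 0 :=
  if_neg fun ⟨v, he, hf⟩ => h v he hf

theorem blackCoeff_eq_zero (h : ∀ v, Γ.tgt e = .inner v → Γ.tgt f ≠ .inner v) :
    Γ.blackCoeff 𝕜 e f = 0 :=
  if_neg fun ⟨v, he, hf⟩ => h v he hf

end Coefficients

namespace Cut

variable {κ : Γ.Cut}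

section LocalSums

variable {a b : Γ.Vertex} {p : Quiver.Path a b} {e : Γ.E} {v : Γ.V} {x : ℤ × Γ.E}

variable (κ) in
/-- The sum of the coefficients of the brackets of the edges of a path, with index `z` at their
tails, with an edge `e` of the same tail. -/
def whiteSum (p : Quiver.Path a b) (e : Γ.E) (z : ℤ) : 𝕜 :=
  ((κ.steps p).map fun x => if x.1 = z then Γ.whiteCoeff 𝕜 x.2 e else 0).sum

variable (κ) in
/-- The sum of the coefficients of the brackets of an edge `e` with the edges of a path of the same
head, with index `z` at their heads. -/
def blackSum (p : Quiver.Path a b) (e : Γ.E) (z : ℤ) : 𝕜 :=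
  ((κ.steps p).map fun x => if x.1 + κ.index x.2 = z then Γ.blackCoeff 𝕜 e x.2 else 0).sum

theorem whiteSum_eq_zero (h : ∀ x ∈ κ.steps p, ∀ v, Γ.src x.2 = .inner v → Γ.src e ≠ .inner v)
    (z : ℤ) : κ.whiteSum 𝕜 p e z = 0 := by
  refine List.sum_eq_zero fun t ht => ?_
  obtain ⟨x, hx, rfl⟩ := List.mem_map.1 ht
  rw [whiteCoeff_eq_zero 𝕜 (h x hx), ite_self]

theorem blackSum_eq_zero (h : ∀ x ∈ κ.steps p, ∀ v, Γ.tgt x.2 = .inner v → Γ.tgt e ≠ .inner v)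
    (z : ℤ) : κ.blackSum 𝕜 p e z = 0 := by
  refine List.sum_eq_zero fun t ht => ?_
  obtain ⟨x, hx, rfl⟩ := List.mem_map.1 ht
  rw [blackCoeff_eq_zero 𝕜 fun v he hx' => h x hx v hx' he, ite_self]

theorem whiteSum_eq_turn (hx : x ∈ κ.steps p) (hxv : Γ.src x.2 = .inner v)
    (he : Γ.src e = .inner v) (z : ℤ) :
    κ.whiteSum 𝕜 p e z = (if z - x.1 = 0 then (Γ.turn (.inl x.2) (.inl e) : 𝕜) else 0) / 2 := by
  rw [whiteSum, list_sum_map_eq_of_nodup (nodup_map_snd_steps p).of_map hx fun y hy hyx => ?_,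
    whiteCoeff_eq_turn 𝕜 hxv he, ite_div, zero_div]
  · exact if_congr (by rw [sub_eq_zero, eq_comm]) rfl rfl
  · rw [whiteCoeff_eq_zero 𝕜 fun w hyw hew => hyx (eq_of_src_eq hy hx ?_), ite_self]
    rw [hyw, ← hew, he, hxv]

theorem blackSum_eq_turn (hx : x ∈ κ.steps p) (hxv : Γ.tgt x.2 = .inner v)
    (he : Γ.tgt e = .inner v) (z : ℤ) : κ.blackSum 𝕜 p e z =
      (if z - (x.1 + κ.index x.2) = 0 then (Γ.turn (.inr x.2) (.inr e) : 𝕜) else 0) / 2 := by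
  rw [blackSum, list_sum_map_eq_of_nodup (nodup_map_snd_steps p).of_map hx fun y hy hyx => ?_,
    blackCoeff_eq_turn 𝕜 he hxv, ite_div, zero_div]
  · exact if_congr (by rw [sub_eq_zero, eq_comm]) rfl rfl
  · rw [blackCoeff_eq_zero 𝕜 fun w hew hyw => hyx (eq_of_tgt_eq hy hx ?_), ite_self]
    rw [hyw, ← hew, he, hxv]

end LocalSums

section VertexLevels

variable {a b : Fin N} {p : Quiver.Path (Γ.source a) (Γ.sink b)}

/-- A vertex `v` has level `α` with respect to a path `p` if the double brackets at `v` of the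
edges of `p` with another path passing through `v` with index `z` measure the changes of the side
of `p` on which the other path runs. -/
structure Levels.IsLevel (Λ : κ.Levels p) (v : NetVertex N N Γ.V) (α : ℚ) : Prop where
  whiteSum_eq : ∀ e, Γ.src e = v → ∀ z : ℤ, κ.whiteSum 𝕜 p e z =
    ((SignType.sign (Λ.mid (.inl e) + z) : 𝕜) - SignType.sign (α + z)) / 2
  blackSum_eq : ∀ e, Γ.tgt e = v → ∀ z : ℤ, κ.blackSum 𝕜 p e z =
    ((SignType.sign (α + z) : 𝕜) - SignType.sign (Λ.mid (.inr e) + z)) / 2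

namespace Levels

variable (Λ : κ.Levels p)

theorem isLevel_source (i : Fin N) :
    Λ.IsLevel 𝕜 (.source i) (Λ.mid (.inl (Γ.sourceEdge i))) where
  whiteSum_eq e he z := by
    rw [(Γ.src_eq_source e i).1 he, sub_self, zero_div, whiteSum_eq_zero]
    intro x _ v _ hv
    cases (Γ.src_sourceEdge i).symm.trans hv
  blackSum_eq e he := absurd he (Γ.tgt_ne_source e i)

theorem isLevel_sink (j : Fin N) : Λ.IsLevel 𝕜 (.sink j) (Λ.mid (.inr (Γ.sinkEdge j))) where
  whiteSum_eq e he := absurd he (Γ.src_ne_sink e j)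
  blackSum_eq e he z := by
    rw [(Γ.tgt_eq_sink e j).1 he, sub_self, zero_div, blackSum_eq_zero]
    intro x _ v _ hv
    cases (Γ.tgt_sinkEdge j).symm.trans hv

theorem isLevel_of_mem_steps {v : Γ.V} {x y : ℤ × Γ.E} (hx : x ∈ κ.steps p) (hy : y ∈ κ.steps p)
    (hxv : Γ.tgt x.2 = .inner v) (hyv : Γ.src y.2 = .inner v) (hxy : y.1 = x.1 + κ.index x.2) :
    Λ.IsLevel 𝕜 (.inner v) (-y.1) where
  whiteSum_eq e he z := by
    have hmid := Λ.mid_eq_add_turn (h := .inl y.2) (k := .inl e) hyv he fun hey =>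
      Λ.left_eq_right_of_ne hx hy (he.trans hxv.symm) (he.trans hyv.symm) Sum.inl_ne_inr hey
    rw [left_sub_right_inl, onPath_eq_one hy, one_mul, Λ.mid_inl_of_mem_steps hy] at hmid
    rw [whiteSum_eq_turn 𝕜 hy hyv he, ← sign_add_half_sub_sign, hmid]
    push_cast
    ring_nf
  blackSum_eq e he z := by
    have hmid := Λ.mid_eq_add_turn (h := .inr x.2) (k := .inr e) hxv he fun hex =>
      Λ.left_eq_right_of_ne hx hy (he.trans hxv.symm) (he.trans hyv.symm) hex Sum.inr_ne_inl
    rw [left_sub_right_inr, onPath_eq_one hx, Λ.mid_inr_of_mem_steps hx, ← hxy] at hmid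
    rw [blackSum_eq_turn 𝕜 hx hxv he, ← hxy, ← sign_sub_sign_sub_half, hmid]
    push_cast
    ring_nf

theorem exists_isLevel_of_forall_ne {v : Γ.V} (hsrc : ∀ y ∈ κ.steps p, Γ.src y.2 ≠ .inner v)
    (htgt : ∀ x ∈ κ.steps p, Γ.tgt x.2 ≠ .inner v) : ∃ α, Λ.IsLevel 𝕜 (.inner v) α := by
  obtain ⟨g, hg⟩ := Γ.exists_in v
  have hmid (k : Γ.E ⊕ Γ.E) (hk : Γ.vertexAt k = .inner v) : Λ.mid k = Λ.mid (.inr g) := by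
    have hlr (h : Γ.E ⊕ Γ.E) (hv : Γ.vertexAt h = .inner v) : Λ.left h = Λ.right h :=
      Λ.left_eq_right (fun y hy hhy => hsrc y hy (by rwa [hhy] at hv))
        fun x hx hhx => htgt x hx (by rwa [hhx] at hv)
    rw [Λ.mid_eq_add_turn (h := .inr g) hg hk fun _ => hlr k hk, hlr (.inr g) hg]
    ring
  refine ⟨Λ.mid (.inr g), fun e he z => ?_, fun e he z => ?_⟩
  · rw [hmid (.inl e) he, sub_self, zero_div, whiteSum_eq_zero]
    exact fun x hx w hxw hew => hsrc x hx (hxw.trans (hew.symm.trans he))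
  · rw [hmid (.inr e) he, sub_self, zero_div, blackSum_eq_zero]
    exact fun x hx w hxw hew => htgt x hx (hxw.trans (hew.symm.trans he))

theorem exists_isLevel_inner (v : Γ.V) : ∃ α, Λ.IsLevel 𝕜 (.inner v) α := by
  by_cases hsrc : ∃ y ∈ κ.steps p, Γ.src y.2 = .inner v
  · obtain ⟨y, hy, hyv⟩ := hsrc
    rcases exists_pred hy with ⟨h, _⟩ | ⟨x, hx, hxy, hindex⟩
    · cases h.symm.trans hyv
    · exact ⟨_, Λ.isLevel_of_mem_steps 𝕜 hx hy (hxy.trans hyv) hyv hindex⟩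
  by_cases htgt : ∃ x ∈ κ.steps p, Γ.tgt x.2 = .inner v
  · obtain ⟨x, hx, hxv⟩ := htgt
    rcases exists_succ hx with ⟨h, _⟩ | ⟨y, hy, hxy, _⟩
    · cases h.symm.trans hxv
    · exact absurd ⟨y, hy, hxy.trans hxv⟩ hsrc
  push Not at hsrc htgt
  exact Λ.exists_isLevel_of_forall_ne 𝕜 hsrc htgt

end Levels

end VertexLevels

theorem exists_mem_steps_src {x y : Γ.Vertex} (p : Quiver.Path x y) (h : x ≠ y) :
    ∃ s ∈ κ.steps p, Γ.src s.2 = x := by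
  induction p with
  | nil => exact absurd rfl h
  | @cons c d p e ih =>
    by_cases hc : x = c
    · exact ⟨_, List.mem_cons_self, e.2.1.trans hc.symm⟩
    · obtain ⟨s, hs, hsx⟩ := ih hc
      exact ⟨s, List.mem_cons_of_mem _ hs, hsx⟩

theorem exists_mem_steps_tgt {x y : Γ.Vertex} (p : Quiver.Path x y) (h : x ≠ y) :
    ∃ s ∈ κ.steps p, Γ.tgt s.2 = y ∧ s.1 + κ.index s.2 = κ.pathIndex p := by
  cases p with
  | nil => exact absurd rfl h
  | cons p e => exact ⟨_, List.mem_cons_self, e.2.2, rfl⟩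

section BoundaryLevels

variable {a b : Fin N} {p : Quiver.Path (Γ.source a) (Γ.sink b)}

theorem onPath_sourceEdge (i : Fin N) :
    κ.onPath p (Γ.sourceEdge i) = if i = a then 1 else 0 := by
  split_ifs with h
  · subst h
    obtain ⟨s, hs, hsrc⟩ := exists_mem_steps_src (κ := κ) p nofun
    rw [← (Γ.src_eq_source s.2 i).1 hsrc, onPath_eq_one hs]
  · refine onPath_eq_zero fun x hx hxi => ?_
    have hsrc : Γ.src x.2 = .source i := hxi ▸ Γ.src_sourceEdge i
    rcases exists_pred hx with ⟨hxa, _⟩ | ⟨y, _, hyx, _⟩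
    · exact h (NetVertex.source.inj (hsrc.symm.trans hxa))
    · exact Γ.tgt_ne_source _ _ (hyx.trans hsrc)

theorem onPath_sinkEdge (j : Fin N) : κ.onPath p (Γ.sinkEdge j) = if j = b then 1 else 0 := by
  split_ifs with h
  · subst h
    obtain ⟨s, hs, htgt, _⟩ := exists_mem_steps_tgt (κ := κ) p nofun
    rw [← (Γ.tgt_eq_sink s.2 j).1 htgt, onPath_eq_one hs]
  · refine onPath_eq_zero fun x hx hxj => ?_
    have htgt : Γ.tgt x.2 = .sink j := hxj ▸ Γ.tgt_sinkEdge j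
    rcases exists_succ hx with ⟨hxb, _⟩ | ⟨y, _, hyx, _⟩
    · exact h (NetVertex.sink.inj (htgt.symm.trans hxb))
    · exact Γ.src_ne_sink _ _ (hyx.trans htgt)

namespace Levels

variable (Λ : κ.Levels p)

theorem left_sourceEdge (i : Fin N) :
    Λ.left (.inl (Γ.sourceEdge i)) = if a < i then -1 else 0 := by
  rw [fin_eq_add_of_forall_succ (f := fun i => Λ.left (.inl (Γ.sourceEdge i))) (a := a) ?_ i,
    Λ.left_source, zero_add]
  intro i hi
  have hseam : Γ.seam (.inl (Γ.sourceEdge (i + 1))) = 0 := by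
    rw [seam, Γ.rot_source, if_neg, if_neg Sum.inl_ne_inr, sub_zero]
    exact fun h => hi (Γ.sourceEdge_injective (Sum.inl_injective h))
  have hrot := Λ.right_rot (.inl (Γ.sourceEdge (i + 1)))
  rw [hseam, sub_zero, Γ.rot_source, Λ.right_inl, onPath_sourceEdge] at hrot
  exact hrot.symm

theorem right_sinkEdge (j : Fin N) :
    Λ.right (.inr (Γ.sinkEdge j)) = -κ.pathIndex p + if b < j then -1 else 0 := by
  obtain ⟨s, hs, hsb, hindex⟩ := exists_mem_steps_tgt (κ := κ) p nofun
  have hend : Λ.right (.inr (Γ.sinkEdge b)) = -κ.pathIndex p := by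
    rw [← (Γ.tgt_eq_sink s.2 b).1 hsb, Λ.right_inr, Λ.left_of_mem_steps hs, ← hindex]
    push_cast
    ring
  rw [fin_eq_add_of_forall_succ (f := fun j => Λ.right (.inr (Γ.sinkEdge j))) (a := b) ?_ j, hend]
  intro j hj
  have hseam : Γ.seam (.inr (Γ.sinkEdge j)) = 0 := by
    rw [seam, Γ.rot_sink, if_neg Sum.inr_ne_inl, if_neg, sub_zero]
    exact fun h => hj (Γ.sinkEdge_injective (Sum.inr_injective h))
  have hrot := Λ.right_rot (.inr (Γ.sinkEdge j))
  rw [hseam, sub_zero, Γ.rot_sink] at hrot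
  rw [hrot, ← onPath_sinkEdge (κ := κ) (p := p), sub_eq_add_neg, ← left_sub_right_inr,
    add_sub_cancel]

end Levels

/-- The position of the `i`-th point on a boundary circle relative to the `a`-th point. -/
def relPos (a i : Fin N) : ℚ :=
  if i < a then 1 / 2 else if i = a then 0 else -1 / 2

namespace Levels

variable (Λ : κ.Levels p)

theorem mid_sourceEdge (i : Fin N) : Λ.mid (.inl (Γ.sourceEdge i)) = relPos a i := by
  rw [mid, Λ.right_inl, onPath_sourceEdge, Λ.left_sourceEdge, relPos]
  split_ifs <;> first | omega | ring

theorem mid_sinkEdge (j : Fin N) :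
    Λ.mid (.inr (Γ.sinkEdge j)) = relPos b j - κ.pathIndex p := by
  have hleft := Λ.left_sub_right_inr (Γ.sinkEdge j)
  rw [sub_eq_iff_eq_add, onPath_sinkEdge] at hleft
  rw [mid, hleft, Λ.right_sinkEdge, relPos]
  split_ifs <;> first | omega | ring

theorem exists_forall_isLevel : ∃ α : NetVertex N N Γ.V → ℚ, (∀ v, Λ.IsLevel 𝕜 v (α v)) ∧
    (∀ i, α (.source i) = relPos a i) ∧ ∀ j, α (.sink j) = relPos b j - κ.pathIndex p := by
  choose α hα using Λ.exists_isLevel_inner 𝕜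
  refine ⟨fun
    | .source i => Λ.mid (.inl (Γ.sourceEdge i))
    | .sink j => Λ.mid (.inr (Γ.sinkEdge j))
    | .inner v => α v, ?_, Λ.mid_sourceEdge, Λ.mid_sinkEdge⟩
  rintro (i | j | v)
  exacts [Λ.isLevel_source 𝕜 i, Λ.isLevel_sink 𝕜 j, hα v]

end Levels

end BoundaryLevels

variable (κ)

/-- The intersection number of two paths, the second one lifted `δ` sheets higher than the first
one to the universal cover of the cylinder, as a sum of local contributions. -/
def crossing {x y x' y' : Γ.Vertex} (p : Quiver.Path x y) (q : Quiver.Path x' y') (δ : ℤ) : 𝕜 :=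
  ((κ.steps q).map fun s =>
    κ.whiteSum 𝕜 p s.2 (s.1 - δ) + κ.blackSum 𝕜 p s.2 (s.1 + κ.index s.2 - δ)).sum

/-- The local contributions telescope along the second path, so that only the order of the end
points on the boundary circles matters. -/
theorem crossing_eq {a b i j : Fin N} (p : Quiver.Path (Γ.source a) (Γ.sink b))
    (q : Quiver.Path (Γ.source i) (Γ.sink j)) (δ : ℤ) : κ.crossing 𝕜 p q δ =
      ((SignType.sign (relPos b j - (δ + κ.pathIndex p - κ.pathIndex q : ℤ)) : 𝕜) -
        SignType.sign (relPos a i - δ)) / 2 := by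
  obtain ⟨Λ⟩ := κ.nonempty_levels p
  obtain ⟨α, hα, hsource, hsink⟩ := Λ.exists_forall_isLevel 𝕜
  have htelescope {x y : Γ.Vertex} (q : Quiver.Path x y) : κ.crossing 𝕜 p q δ =
      ((SignType.sign (α y + (κ.pathIndex q - δ : ℤ)) : 𝕜) - SignType.sign (α x - δ)) / 2 := by
    induction q with
    | nil => simp [crossing, steps, pathIndex, sub_eq_add_neg]
    | @cons c d q e ih =>
      have hmid : Λ.mid (.inl e.1) - (κ.index e.1 : ℚ) + (κ.pathIndex q + κ.index e.1 - δ : ℤ) =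
          Λ.mid (.inl e.1) + (κ.pathIndex q - δ : ℤ) := by
        push_cast
        ring
      rw [crossing] at ih
      rw [crossing, steps, List.map_cons, List.sum_cons, ih, (hα c).whiteSum_eq e.1 e.2.1,
        (hα d).blackSum_eq e.1 e.2.2, Λ.mid_inr, hmid, pathIndex]
      ring
  have hend : α (.sink j) + (κ.pathIndex q - δ : ℤ) =
      relPos b j - (δ + κ.pathIndex p - κ.pathIndex q : ℤ) := by
    rw [hsink]
    push_cast
    ring
  rw [← hend, ← hsource]
  exact htelescope q

end Cut

end

end PerfectCylindricalNetwork

/-! ### Splittings of paths and cyclic classes -/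

section Splitting

variable {V M : Type*} [Quiver V] [AddCommMonoid M]

/-- The sum of `g c d p₁ e p₂` over all decompositions of a path as a path `p₁`, followed by an
arrow `e : c ⟶ d` and a path `p₂`. -/
def splitSum {a : V} : ∀ {b : V}, Quiver.Path a b →
    (∀ c d : V, Quiver.Path a c → (c ⟶ d) → Quiver.Path d b → M) → M
  | _, .nil, _ => 0
  | _, .cons p e, g =>
    g _ _ p e .nil + splitSum p fun c d p₁ e₁ p₂ => g c d p₁ e₁ (p₂.cons e)

theorem map_splitSum {M' F : Type*} [AddCommMonoid M'] [FunLike F M M'] [AddMonoidHomClass F M M']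
    (φ : F) {a b : V} (p : Quiver.Path a b)
    (g : ∀ c d : V, Quiver.Path a c → (c ⟶ d) → Quiver.Path d b → M) :
    φ (splitSum p g) = splitSum p fun c d p₁ e p₂ => φ (g c d p₁ e p₂) := by
  induction p with
  | nil => exact map_zero φ
  | cons p e ih => rw [splitSum, splitSum, map_add, ih]

theorem splitSum_congr {a b : V} (p : Quiver.Path a b)
    {g g' : ∀ c d : V, Quiver.Path a c → (c ⟶ d) → Quiver.Path d b → M}
    (h : ∀ c d (p₁ : Quiver.Path a c) (e : c ⟶ d) (p₂ : Quiver.Path d b),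
      (p₁.cons e).comp p₂ = p → g c d p₁ e p₂ = g' c d p₁ e p₂) : splitSum p g = splitSum p g' := by
  induction p with
  | nil => rfl
  | cons p e ih =>
    rw [splitSum, splitSum, h _ _ p e .nil rfl, ih]
    exact fun c d p₁ e₁ p₂ h' => h _ _ _ _ _ (by rw [Quiver.Path.comp_cons, h'])

theorem splitSum_add {a b : V} (p : Quiver.Path a b)
    (g g' : ∀ c d : V, Quiver.Path a c → (c ⟶ d) → Quiver.Path d b → M) :
    splitSum p (fun c d p₁ e p₂ => g c d p₁ e p₂ + g' c d p₁ e p₂) =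
      splitSum p g + splitSum p g' := by
  induction p with
  | nil => exact (add_zero 0).symm
  | cons p e ih => simp only [splitSum, ih, add_add_add_comm]

theorem splitSum_sum {ι : Type*} (s : Finset ι) {a b : V} (p : Quiver.Path a b)
    (g : ι → ∀ c d : V, Quiver.Path a c → (c ⟶ d) → Quiver.Path d b → M) :
    splitSum p (fun c d p₁ e p₂ => ∑ i ∈ s, g i c d p₁ e p₂) = ∑ i ∈ s, splitSum p (g i) := by
  induction p with
  | nil => exact Finset.sum_const_zero.symm
  | cons p e ih => simp only [splitSum, ih, Finset.sum_add_distrib]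

theorem splitSum_ite (P : Prop) [Decidable P] {a b : V} (p : Quiver.Path a b)
    (g : ∀ c d : V, Quiver.Path a c → (c ⟶ d) → Quiver.Path d b → M) :
    (splitSum p fun c d p₁ e p₂ => if P then g c d p₁ e p₂ else 0) =
      if P then splitSum p g else 0 := by
  split_ifs
  · rfl
  · exact (map_splitSum (0 : M →+ M) p g).symm

theorem splitSum_smul {𝕜 : Type*} [Semiring 𝕜] [Module 𝕜 M] {a b : V} (p : Quiver.Path a b)
    (g : ∀ c d : V, Quiver.Path a c → (c ⟶ d) → Quiver.Path d b → 𝕜) (m : M) :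
    (splitSum p fun c d p₁ e p₂ => g c d p₁ e p₂ • m) = splitSum p g • m :=
  (map_splitSum (LinearMap.toSpanSingleton 𝕜 M m) p g).symm

end Splitting

noncomputable section CloseUp

variable {𝕜 : Type*} [CommRing 𝕜] {V ι : Type*} [Quiver V] (pt : ι → V)

/-- The class of a loop in the cyclic space. -/
def loopClass (𝕜 : Type*) [CommRing 𝕜] {c : ι} (w : Quiver.Path (pt c) (pt c)) :
    CyclicSpace 𝕜 pt :=
  cyclicClass pt (loop pt c (pathElt 𝕜 w))

theorem loopClass_comm {c d : ι} (w : Quiver.Path (pt c) (pt d))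
    (w' : Quiver.Path (pt d) (pt c)) :
    loopClass pt 𝕜 (w.comp w') = loopClass pt 𝕜 (w'.comp w) := by
  rw [loopClass, loopClass, pathElt_comp, pathElt_comp, cyclicClass_comm]

/-- The linear map which sends `x ⊗ y` to the class of the loop `x u y v`. -/
def closeUp {a b c d : ι} (u : Quiver.Path (pt b) (pt a)) (v : Quiver.Path (pt d) (pt c)) :
    LinPath 𝕜 (pt c) (pt b) ⊗[𝕜] LinPath 𝕜 (pt a) (pt d) →ₗ[𝕜] CyclicSpace 𝕜 pt :=
  cyclicClass pt ∘ₗ loop pt c ∘ₗ concatTensor ∘ₗ rmul₂ (pathElt 𝕜 v) ∘ₗ rmul₁ (pathElt 𝕜 u)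

theorem closeUp_apply {a b c d : ι} (u : Quiver.Path (pt b) (pt a)) (v : Quiver.Path (pt d) (pt c))
    (t : LinPath 𝕜 (pt c) (pt b) ⊗[𝕜] LinPath 𝕜 (pt a) (pt d)) :
    closeUp pt u v t = cyclicClass pt (loop pt c
      (concatTensor (rmul₂ (pathElt 𝕜 v) (rmul₁ (pathElt 𝕜 u) t)))) :=
  rfl

theorem closeUp_nil {a c : ι} (t : LinPath 𝕜 (pt c) (pt a) ⊗[𝕜] LinPath 𝕜 (pt a) (pt c)) :
    closeUp pt .nil .nil t = cyclicClass pt (loop pt c (concatTensor t)) := by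
  rw [closeUp_apply, rmul₁_nil, rmul₂_nil]

theorem closeUp_tmul {a b c d : ι} (u : Quiver.Path (pt b) (pt a)) (v : Quiver.Path (pt d) (pt c))
    (x : Quiver.Path (pt c) (pt b)) (y : Quiver.Path (pt a) (pt d)) :
    closeUp pt u v (pathElt 𝕜 x ⊗ₜ pathElt 𝕜 y) =
      loopClass pt 𝕜 ((x.comp u).comp (y.comp v)) := by
  rw [closeUp_apply, loopClass, pathElt_comp, pathElt_comp, pathElt_comp]
  rfl

theorem closeUp_lmul₂ {a a' b c d : ι} (u : Quiver.Path (pt b) (pt a))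
    (v : Quiver.Path (pt d) (pt c)) (f : Quiver.Path (pt a) (pt a'))
    (t : LinPath 𝕜 (pt c) (pt b) ⊗[𝕜] LinPath 𝕜 (pt a') (pt d)) :
    closeUp pt u v (lmul₂ (pathElt 𝕜 f) t) = closeUp pt (u.comp f) v t := by
  rw [closeUp_apply, closeUp_apply, ← lmul₂_rmul₁, ← lmul₂_rmul₂, concatTensor_lmul₂,
    rmul₁_rmul₂, pathElt_comp, rmul₁_comp]

theorem closeUp_rmul₁ {a b b' c d : ι} (u : Quiver.Path (pt b') (pt a))
    (v : Quiver.Path (pt d) (pt c)) (f : Quiver.Path (pt b) (pt b'))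
    (t : LinPath 𝕜 (pt c) (pt b) ⊗[𝕜] LinPath 𝕜 (pt a) (pt d)) :
    closeUp pt u v (rmul₁ (pathElt 𝕜 f) t) = closeUp pt (f.comp u) v t := by
  rw [closeUp_apply, closeUp_apply, pathElt_comp, rmul₁_comp]

theorem closeUp_rmul₂ {a b c d d' : ι} (u : Quiver.Path (pt b) (pt a))
    (v : Quiver.Path (pt d') (pt c)) (f : Quiver.Path (pt d) (pt d'))
    (t : LinPath 𝕜 (pt c) (pt b) ⊗[𝕜] LinPath 𝕜 (pt a) (pt d)) :
    closeUp pt u v (rmul₂ (pathElt 𝕜 f) t) = closeUp pt u (f.comp v) t := by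
  rw [closeUp_apply, closeUp_apply, pathElt_comp, rmul₂_comp, rmul₁_rmul₂]

theorem closeUp_lmul₁ {a b c c' d : ι} (u : Quiver.Path (pt b) (pt a))
    (v : Quiver.Path (pt d) (pt c)) (f : Quiver.Path (pt c) (pt c'))
    (t : LinPath 𝕜 (pt c') (pt b) ⊗[𝕜] LinPath 𝕜 (pt a) (pt d)) :
    closeUp pt u v (lmul₁ (pathElt 𝕜 f) t) = closeUp pt u (v.comp f) t := by
  rw [closeUp_apply, closeUp_apply, ← lmul₁_rmul₁, ← lmul₁_rmul₂, concatTensor_lmul₁,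
    cyclicClass_comm, pathElt_comp, rmul₂_comp, concatTensor_rmul₂ (pathElt 𝕜 f)]

/-- The linear map which sends `s ⊗ t` to the class of the loop `(q₁ s p₂) u (p₁ t q₂) v`. -/
def insertTensor {a b c d : ι} {x y x' y' : V} (u : Quiver.Path (pt b) (pt a))
    (v : Quiver.Path (pt d) (pt c)) (q₁ : Quiver.Path (pt c) x') (q₂ : Quiver.Path y' (pt d))
    (p₁ : Quiver.Path (pt a) x) (p₂ : Quiver.Path y (pt b)) :
    LinPath 𝕜 x' y ⊗[𝕜] LinPath 𝕜 x y' →ₗ[𝕜] CyclicSpace 𝕜 pt :=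
  closeUp pt u v ∘ₗ rmul₂ (pathElt 𝕜 q₂) ∘ₗ lmul₁ (pathElt 𝕜 q₁) ∘ₗ rmul₁ (pathElt 𝕜 p₂) ∘ₗ
    lmul₂ (pathElt 𝕜 p₁)

theorem insertTensor_tmul {a b c d : ι} {x y x' y' : V} (u : Quiver.Path (pt b) (pt a))
    (v : Quiver.Path (pt d) (pt c)) (q₁ : Quiver.Path (pt c) x') (q₂ : Quiver.Path y' (pt d))
    (p₁ : Quiver.Path (pt a) x) (p₂ : Quiver.Path y (pt b)) (s : Quiver.Path x' y)
    (t : Quiver.Path x y') :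
    insertTensor pt u v q₁ q₂ p₁ p₂ (pathElt 𝕜 s ⊗ₜ pathElt 𝕜 t) =
      loopClass pt 𝕜 ((((q₁.comp s).comp p₂).comp u).comp (((p₁.comp t).comp q₂).comp v)) := by
  rw [← closeUp_tmul, Quiver.Path.comp_assoc q₁, pathElt_comp q₁, pathElt_comp s, pathElt_comp _ q₂,
    pathElt_comp p₁]
  rfl

variable {V' : Type*} [Quiver V'] (Φ : V' ⥤q V)

theorem pathArrowBracket_mapPath (ε : ArrowBracket 𝕜 V) {a b : V'} (p : Quiver.Path a b)
    {c d : V} (f : c ⟶ d) : pathArrowBracket ε f (Φ.mapPath p) =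
      splitSum p fun _ _ p₁ e p₂ => rmul₁ (pathElt 𝕜 (Φ.mapPath p₂))
        (lmul₂ (pathElt 𝕜 (Φ.mapPath p₁)) (ε (Φ.map e) f)) := by
  induction p with
  | nil => rfl
  | cons p e ih =>
    rw [Prefunctor.mapPath_cons, pathArrowBracket, splitSum, ih, Prefunctor.mapPath_nil,
      rmul₁_nil, map_splitSum]
    refine congrArg _ (splitSum_congr _ fun c d p₁ e₁ p₂ _ => ?_)
    rw [Prefunctor.mapPath_cons, ← Quiver.Path.comp_toPath_eq_cons, pathElt_comp, rmul₁_comp]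

theorem pathBracket_mapPath (ε : ArrowBracket 𝕜 V) {a b a' b' : V'} (p : Quiver.Path a b)
    (q : Quiver.Path a' b') : pathBracket ε (Φ.mapPath p) (Φ.mapPath q) =
      splitSum q fun _ _ q₁ f q₂ => splitSum p fun _ _ p₁ e p₂ =>
        rmul₂ (pathElt 𝕜 (Φ.mapPath q₂)) (lmul₁ (pathElt 𝕜 (Φ.mapPath q₁))
        (rmul₁ (pathElt 𝕜 (Φ.mapPath p₂))
        (lmul₂ (pathElt 𝕜 (Φ.mapPath p₁)) (ε (Φ.map e) (Φ.map f))))) := by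
  simp only [← map_splitSum, ← pathArrowBracket_mapPath]
  induction q with
  | nil => rfl
  | cons q f ih =>
    rw [Prefunctor.mapPath_cons, pathBracket, splitSum, ih, Prefunctor.mapPath_nil,
      rmul₂_nil, map_splitSum]
    refine congrArg _ (splitSum_congr _ fun c d q₁ f₁ q₂ _ => ?_)
    rw [Prefunctor.mapPath_cons, ← Quiver.Path.comp_toPath_eq_cons, pathElt_comp, rmul₂_comp]

end CloseUp

/-! ### Exchanging the tails of two paths -/

namespace PerfectCylindricalNetwork

noncomputable section Exchange

variable {N : ℕ} [NeZero N] {Γ : PerfectCylindricalNetwork N N}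

instance : Fintype Γ.Vertex := Fintype.ofFinite _

instance : DecidableEq Γ.Vertex := Classical.decEq _

instance (a b : Γ.Vertex) : Fintype (a ⟶ b) :=
  @Fintype.ofFinite _ (inferInstanceAs (Finite {e : Γ.E // Γ.src e = a ∧ Γ.tgt e = b}))

section PathSums

variable {M : Type*} [AddCommMonoid M] {a b a' b' : Γ.Vertex}

/-- The nontrivial paths from `a` to `b`, as a path followed by a last edge. -/
abbrev PathStep (a b : Γ.Vertex) : Type := Σ c : Γ.Vertex, (c ⟶ b) × Quiver.Path a c

/-- The nontrivial paths from `a` to `b`, as a first edge followed by a path. -/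
abbrev StepPath (a b : Γ.Vertex) : Type := Σ c : Γ.Vertex, (a ⟶ c) × Quiver.Path c b

/-- A path is either trivial or has a last edge. -/
def pathEquiv (a b : Γ.Vertex) : Quiver.Path a b ≃ PLift (a = b) ⊕ PathStep a b where
  toFun p := match b, p with
    | _, .nil => .inl ⟨rfl⟩
    | _, .cons p e => .inr ⟨_, e, p⟩
  invFun := Sum.elim (fun h => (Quiver.Path.nil : Quiver.Path a a).cast rfl h.down)
    fun x => x.2.2.cons x.2.1
  left_inv p := by cases p <;> rfl
  right_inv x := by rcases x with ⟨⟨rfl⟩⟩ | x <;> rfl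

theorem sum_path (F : Quiver.Path a b → M) :
    ∑ p, F p = (if h : a = b then F ((Quiver.Path.nil : Quiver.Path a a).cast rfl h) else 0) +
      ∑ c, ∑ e : c ⟶ b, ∑ p : Quiver.Path a c, F (p.cons e) := by
  rw [← Equiv.sum_comp (pathEquiv a b).symm, Fintype.sum_sum_type]
  congr 1
  · split_ifs with h
    · exact Fintype.sum_eq_single ⟨h⟩ fun x hx => absurd (Subsingleton.elim _ _) hx
    · exact Finset.sum_eq_zero fun x => absurd x.down h
  · simp only [Fintype.sum_sigma, Fintype.sum_prod_type]
    rfl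

theorem sum_sum_path {S : Type*} [Fintype S] (v : S → Γ.Vertex)
    (F : ∀ s, Quiver.Path (v s) b → M) : ∑ s, ∑ p, F s p =
      (∑ s, if h : v s = b then F s ((Quiver.Path.nil : Quiver.Path (v s) (v s)).cast rfl h)
        else 0) +
      ∑ c, ∑ e : c ⟶ b, ∑ s, ∑ p : Quiver.Path (v s) c, F s (p.cons e) := by
  simp only [sum_path (b := b), Finset.sum_add_distrib]
  rw [Finset.sum_comm]
  exact congrArg _ (Finset.sum_congr rfl fun c _ => Finset.sum_comm)

theorem sum_splitSum (g : ∀ c d : Γ.Vertex, Quiver.Path a c → (c ⟶ d) → Quiver.Path d b → M) :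
    ∑ p, splitSum p g = ∑ d, ∑ c, ∑ e : c ⟶ d, ∑ p₁ : Quiver.Path a c, ∑ p₂ : Quiver.Path d b,
      g c d p₁ e p₂ := by
  induction b using Γ.wellFounded_reach.induction with
  | _ b ih =>
  have hlast : ∑ s : Σ d, PathStep a d, (if h : s.1 = b then
      g s.2.1 s.1 s.2.2.2 s.2.2.1 ((Quiver.Path.nil : Quiver.Path s.1 s.1).cast rfl h) else 0) =
      ∑ c, ∑ e : c ⟶ b, ∑ p : Quiver.Path a c, g c b p e .nil := by
    rw [Fintype.sum_sigma, Fintype.sum_eq_single b fun d hd => by simp [hd]]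
    simp [Fintype.sum_sigma, Fintype.sum_prod_type]
  have hnil : (if h : a = b then splitSum ((Quiver.Path.nil : Quiver.Path a a).cast rfl h) g
      else 0) = 0 := by
    split_ifs with h
    · subst h
      rfl
    · rfl
  have hsplit := sum_sum_path (fun s : Σ d, PathStep a d => s.1)
    fun s p₂ => g s.2.1 s.1 s.2.2.2 s.2.2.1 p₂
  simp only [hlast, Fintype.sum_sigma, Fintype.sum_prod_type] at hsplit
  rw [hsplit, sum_path, hnil, zero_add]
  simp only [splitSum, Finset.sum_add_distrib]
  exact congrArg _ (Finset.sum_congr rfl fun c _ => Finset.sum_congr rfl fun e _ =>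
    ih c (.single ⟨e.1, e.2⟩) _)

theorem sum_splitSum_pathStep
    (g : ∀ c d : Γ.Vertex, Quiver.Path a c → (c ⟶ d) → Quiver.Path d b → M) :
    ∑ p, splitSum p g =
      ∑ d, ∑ x : PathStep a d, ∑ p₂ : Quiver.Path d b, g x.1 d x.2.2 x.2.1 p₂ := by
  simp only [sum_splitSum, Fintype.sum_sigma, Fintype.sum_prod_type]

theorem sum_splitSum_stepPath
    (g : ∀ c d : Γ.Vertex, Quiver.Path a c → (c ⟶ d) → Quiver.Path d b → M) :
    ∑ p, splitSum p g =
      ∑ c, ∑ p₁ : Quiver.Path a c, ∑ x : StepPath c b, g c x.1 p₁ x.2.1 x.2.2 := by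
  simp only [sum_splitSum, Fintype.sum_sigma, Fintype.sum_prod_type]
  rw [Finset.sum_comm]
  exact Finset.sum_congr rfl fun c _ =>
    (Finset.sum_congr rfl fun d _ => Finset.sum_comm).trans Finset.sum_comm

theorem sum_sum_splitSum_common_src
    (φ : Quiver.Path a b → Quiver.Path a' b' → Quiver.Path a' b → Quiver.Path a b' →
      Γ.E → Γ.E → M) :
    ∑ q, ∑ p, splitSum q (fun c _ q₁ f q₂ => splitSum p fun c' _ p₁ e p₂ =>
      if h : c' = c then
        φ p q (((q₁.cast rfl h.symm).cons e).comp p₂) (((p₁.cast rfl h).cons f).comp q₂) e.1 f.1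
      else 0) =
    ∑ c, ∑ q₁ : Quiver.Path a' c, ∑ y : StepPath c b', ∑ p₁ : Quiver.Path a c,
      ∑ x : StepPath c b, φ ((p₁.cons x.2.1).comp x.2.2) ((q₁.cons y.2.1).comp y.2.2)
        ((q₁.cons x.2.1).comp x.2.2) ((p₁.cons y.2.1).comp y.2.2) x.2.1.1 y.2.1.1 := by
  calc _ = ∑ q, ∑ p, splitSum q fun c _ q₁ f q₂ => splitSum p fun c' _ p₁ e p₂ =>
        if h : c' = c then φ ((p₁.cons e).comp p₂) ((q₁.cons f).comp q₂)
          (((q₁.cast rfl h.symm).cons e).comp p₂) (((p₁.cast rfl h).cons f).comp q₂) e.1 f.1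
        else 0 := by
        refine Finset.sum_congr rfl fun q _ => Finset.sum_congr rfl fun p _ =>
          splitSum_congr q fun c d q₁ f q₂ hq => splitSum_congr p fun c' d' p₁ e p₂ hp => ?_
        rw [hp, hq]
    _ = _ := by
        simp only [← splitSum_sum, sum_splitSum_stepPath]
        refine Finset.sum_congr rfl fun c _ => Finset.sum_congr rfl fun q₁ _ =>
          Finset.sum_congr rfl fun y _ => ?_
        rw [Fintype.sum_eq_single c fun c' hc' => by simp only [dif_neg hc', Finset.sum_const_zero]]
        simp only [dif_pos, Quiver.Path.cast_rfl_rfl]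

theorem sum_sum_splitSum_common_tgt
    (φ : Quiver.Path a b → Quiver.Path a' b' → Quiver.Path a' b → Quiver.Path a b' →
      Γ.E → Γ.E → M) :
    ∑ q, ∑ p, splitSum q (fun _ d q₁ f q₂ => splitSum p fun _ d' p₁ e p₂ =>
      if h : d' = d then
        φ p q (((q₁.cons f).cast rfl h.symm).comp p₂) (((p₁.cons e).cast rfl h).comp q₂) e.1 f.1
      else 0) =
    ∑ d, ∑ y : PathStep a' d, ∑ q₂ : Quiver.Path d b', ∑ x : PathStep a d,
      ∑ p₂ : Quiver.Path d b, φ ((x.2.2.cons x.2.1).comp p₂) ((y.2.2.cons y.2.1).comp q₂)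
        ((y.2.2.cons y.2.1).comp p₂) ((x.2.2.cons x.2.1).comp q₂) x.2.1.1 y.2.1.1 := by
  calc _ = ∑ q, ∑ p, splitSum q fun _ d q₁ f q₂ => splitSum p fun _ d' p₁ e p₂ =>
        if h : d' = d then φ ((p₁.cons e).comp p₂) ((q₁.cons f).comp q₂)
          (((q₁.cons f).cast rfl h.symm).comp p₂) (((p₁.cons e).cast rfl h).comp q₂) e.1 f.1
        else 0 := by
        refine Finset.sum_congr rfl fun q _ => Finset.sum_congr rfl fun p _ =>
          splitSum_congr q fun c d q₁ f q₂ hq => splitSum_congr p fun c' d' p₁ e p₂ hp => ?_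
        rw [hp, hq]
    _ = _ := by
        simp only [← splitSum_sum, sum_splitSum_pathStep]
        refine Finset.sum_congr rfl fun d _ => Finset.sum_congr rfl fun y _ =>
          Finset.sum_congr rfl fun q₂ _ => ?_
        rw [Fintype.sum_eq_single d fun d' hd' => by simp only [dif_neg hd', Finset.sum_const_zero]]
        simp only [dif_pos, Quiver.Path.cast_rfl_rfl]

theorem sum_sum_sum_reverse {ι₁ ι₂ ι₃ : Type*} [Fintype ι₁] [Fintype ι₂] [Fintype ι₃]
    (F : ι₁ → ι₂ → ι₃ → M) : ∑ x, ∑ y, ∑ z, F x y z = ∑ z, ∑ y, ∑ x, F x y z :=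
  calc _ = ∑ x, ∑ z, ∑ y, F x y z := Finset.sum_congr rfl fun _ _ => Finset.sum_comm
    _ = ∑ z, ∑ x, ∑ y, F x y z := Finset.sum_comm
    _ = _ := Finset.sum_congr rfl fun _ _ => Finset.sum_comm

/-- Two paths through a common vertex turn into two other such paths when they exchange their
tails, and this is an involution. -/
theorem sum_sum_splitSum_exchange_src
    (φ : Quiver.Path a b → Quiver.Path a' b' → Quiver.Path a' b → Quiver.Path a b' →
      Γ.E → Γ.E → M) :
    ∑ q, ∑ p, splitSum q (fun c _ q₁ f q₂ => splitSum p fun c' _ p₁ e p₂ =>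
      if h : c' = c then
        φ p q (((q₁.cast rfl h.symm).cons e).comp p₂) (((p₁.cast rfl h).cons f).comp q₂) e.1 f.1
      else 0) =
    ∑ r', ∑ r, splitSum r' (fun c _ p₁ f q₂ => splitSum r fun c' _ q₁ e p₂ =>
      if h : c' = c then
        φ (((p₁.cast rfl h.symm).cons e).comp p₂) (((q₁.cast rfl h).cons f).comp q₂) r r' e.1 f.1
      else 0) := by
  rw [sum_sum_splitSum_common_src, sum_sum_splitSum_common_src fun r r' p q => φ p q r r']
  exact Finset.sum_congr rfl fun c _ => sum_sum_sum_reverse _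

theorem sum_sum_splitSum_exchange_tgt
    (φ : Quiver.Path a b → Quiver.Path a' b' → Quiver.Path a' b → Quiver.Path a b' →
      Γ.E → Γ.E → M) :
    ∑ q, ∑ p, splitSum q (fun _ d q₁ f q₂ => splitSum p fun _ d' p₁ e p₂ =>
      if h : d' = d then
        φ p q (((q₁.cons f).cast rfl h.symm).comp p₂) (((p₁.cons e).cast rfl h).comp q₂) e.1 f.1
      else 0) =
    ∑ r', ∑ r, splitSum r' (fun _ d p₁ e q₂ => splitSum r fun _ d' q₁ f p₂ =>
      if h : d' = d then
        φ (((p₁.cons e).cast rfl h.symm).comp p₂) (((q₁.cons f).cast rfl h).comp q₂) r r' e.1 f.1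
      else 0) := by
  rw [sum_sum_splitSum_common_tgt,
    sum_sum_splitSum_common_tgt fun r r' p q f e => φ p q r r' e f]
  exact Finset.sum_congr rfl fun c _ => sum_sum_sum_reverse _

end PathSums

end Exchange

end PerfectCylindricalNetwork

/-! ### The double bracket of two boundary paths -/

namespace PerfectCylindricalNetwork

noncomputable section BoundaryBracket

variable {N : ℕ} [NeZero N] {Γ : PerfectCylindricalNetwork N N} {a b a' b' : Fin N}

theorem Cut.pathIndex_comp (κ : Γ.Cut) {x y z : Γ.Vertex} (p : Quiver.Path x y)
    (q : Quiver.Path y z) : κ.pathIndex (p.comp q) = κ.pathIndex p + κ.pathIndex q := by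
  induction q with
  | nil => exact (add_zero _).symm
  | cons q e ih => rw [Quiver.Path.comp_cons, pathIndex, pathIndex, ih, add_assoc]

theorem Cut.splitSum_eq_sum_steps {M : Type*} [AddCommMonoid M] (κ : Γ.Cut) {x y : Γ.Vertex}
    (p : Quiver.Path x y) (φ : ℤ × Γ.E → M) :
    splitSum p (fun _ _ p₁ e _ => φ (κ.pathIndex p₁, e.1)) = ((κ.steps p).map φ).sum := by
  induction p with
  | nil => rfl
  | cons p e ih => rw [splitSum, steps, List.map_cons, List.sum_cons, ih]

theorem Cut.crossing_eq_splitSum (𝕜 : Type*) [Field 𝕜] (κ : Γ.Cut) {x y x' y' : Γ.Vertex}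
    (p : Quiver.Path x y) (q : Quiver.Path x' y') (δ : ℤ) :
    κ.crossing 𝕜 p q δ = splitSum q fun _ _ q₁ f _ => splitSum p fun _ _ p₁ e _ =>
      (if κ.pathIndex p₁ = κ.pathIndex q₁ - δ then Γ.whiteCoeff 𝕜 e.1 f.1 else 0) +
      if κ.pathIndex p₁ + κ.index e.1 = κ.pathIndex q₁ + κ.index f.1 - δ then
        Γ.blackCoeff 𝕜 f.1 e.1 else 0 := by
  rw [crossing, ← splitSum_eq_sum_steps]
  refine splitSum_congr _ fun c d q₁ f q₂ _ => ?_
  rw [splitSum_add, whiteSum, blackSum, ← splitSum_eq_sum_steps, ← splitSum_eq_sum_steps]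

/-- A path from a source to a sink, as a path on the torus. -/
abbrev torusPath (p : Quiver.Path (Γ.source a) (Γ.sink b)) :
    Quiver.Path (Γ.marked a) (Γ.marked b) :=
  Γ.gluing.mapPath p

/-- The class of the loop `r P r' Q`. -/
def exchangeClass (𝕜 : Type*) [Field 𝕜] (P : Quiver.Path (Γ.marked b) (Γ.marked a))
    (Q : Quiver.Path (Γ.marked b') (Γ.marked a')) (r : Quiver.Path (Γ.source a') (Γ.sink b))
    (r' : Quiver.Path (Γ.source a) (Γ.sink b')) : CyclicSpace 𝕜 Γ.marked :=
  loopClass Γ.marked 𝕜 (((torusPath r).comp P).comp ((torusPath r').comp Q))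

theorem doubleBracket_pathElt (𝕜 : Type*) [Field 𝕜] {x y x' y' : Γ.TorusVertex}
    (p : Quiver.Path x y) (q : Quiver.Path x' y') :
    (Γ.doubleBracket 𝕜).br (pathElt 𝕜 p) (pathElt 𝕜 q) = pathBracket (Γ.edgeBracket 𝕜) p q :=
  bilinearExt_single ..

theorem gluing_mapPath_cons_comp {x u v y : Γ.Vertex} (s : Quiver.Path x u) (g : u ⟶ v)
    (t : Quiver.Path v y) : Γ.gluing.mapPath ((s.cons g).comp t) =
      ((Γ.gluing.mapPath s).comp (Γ.gluing.map g).toPath).comp (Γ.gluing.mapPath t) := by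
  rw [Prefunctor.mapPath_comp]
  rfl

variable (𝕜 : Type*) [Field 𝕜] (P : Quiver.Path (Γ.marked b) (Γ.marked a))
    (Q : Quiver.Path (Γ.marked b') (Γ.marked a'))

open Classical in
theorem insertTensor_edgeBracket {x y x' y' : Γ.TorusVertex}
    (q₁ : Quiver.Path (Γ.marked a') x') (q₂ : Quiver.Path y' (Γ.marked b'))
    (p₁ : Quiver.Path (Γ.marked a) x) (p₂ : Quiver.Path y (Γ.marked b))
    (e : x ⟶ y) (f : x' ⟶ y') :
    insertTensor Γ.marked P Q q₁ q₂ p₁ p₂ (Γ.edgeBracket 𝕜 e f) =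
      (if h : x = x' then Γ.whiteCoeff 𝕜 e.1 f.1 • loopClass Γ.marked 𝕜
        ((((q₁.comp (e.toPath.cast h rfl)).comp p₂).comp P).comp
          (((p₁.comp (f.toPath.cast h.symm rfl)).comp q₂).comp Q)) else 0) +
      (if h : y = y' then Γ.blackCoeff 𝕜 e.1 f.1 • loopClass Γ.marked 𝕜
        ((((q₁.comp (f.toPath.cast rfl h.symm)).comp p₂).comp P).comp
          (((p₁.comp (e.toPath.cast rfl h)).comp q₂).comp Q)) else 0) := by
  rw [edgeBracket, map_add, apply_dite (insertTensor ..), apply_dite (insertTensor ..)]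
  simp only [map_smul, insertTensor_tmul, map_zero]

theorem dite_smul_eq_zero {R M : Type*} [Semiring R] [AddCommMonoid M] [Module R M] {p : Prop}
    {_ : Decidable p} {k : R} (hk : k = 0) (m : p → M) : (if h : p then k • m h else 0) = 0 := by
  simp [hk]

theorem insertTensor_edgeBracket_gluing {c d c' d' : Γ.Vertex}
    (q₁ : Quiver.Path (Γ.source a') c) (f : c ⟶ d) (q₂ : Quiver.Path d (Γ.sink b'))
    (p₁ : Quiver.Path (Γ.source a) c') (e : c' ⟶ d') (p₂ : Quiver.Path d' (Γ.sink b)) :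
    insertTensor Γ.marked (a := a) (b := b) (c := a') (d := b') P Q (Γ.gluing.mapPath q₁)
      (Γ.gluing.mapPath q₂) (Γ.gluing.mapPath p₁) (Γ.gluing.mapPath p₂)
      (Γ.edgeBracket 𝕜 (Γ.gluing.map e) (Γ.gluing.map f)) =
    (if h : c' = c then Γ.whiteCoeff 𝕜 e.1 f.1 • exchangeClass 𝕜 P Q
      (((q₁.cast rfl h.symm).cons e).comp p₂) (((p₁.cast rfl h).cons f).comp q₂) else 0) +
    (if h : d' = d then Γ.blackCoeff 𝕜 e.1 f.1 • exchangeClass 𝕜 P Q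
      (((q₁.cons f).cast rfl h.symm).comp p₂) (((p₁.cons e).cast rfl h).comp q₂) else 0) := by
  refine (insertTensor_edgeBracket 𝕜 P Q (Γ.gluing.mapPath q₁) (Γ.gluing.mapPath q₂)
    (Γ.gluing.mapPath p₁) (Γ.gluing.mapPath p₂) (Γ.gluing.map e) (Γ.gluing.map f)).trans ?_
  congr 1
  · by_cases h : c' = c
    · subst h
      rw [dif_pos rfl, dif_pos rfl, Quiver.Path.cast_rfl_rfl q₁, Quiver.Path.cast_rfl_rfl p₁,
        exchangeClass, torusPath, torusPath, gluing_mapPath_cons_comp, gluing_mapPath_cons_comp]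
      rfl
    · rw [dif_neg h]
      exact dite_smul_eq_zero (whiteCoeff_eq_zero 𝕜 fun v he hf =>
        h (e.2.1.symm.trans (he.trans (hf.symm.trans f.2.1)))) _
  · by_cases h : d' = d
    · subst h
      rw [dif_pos rfl, dif_pos rfl, Quiver.Path.cast_rfl_rfl (q₁.cons f),
        Quiver.Path.cast_rfl_rfl (p₁.cons e), exchangeClass, torusPath, torusPath,
        gluing_mapPath_cons_comp, gluing_mapPath_cons_comp]
      rfl
    · rw [dif_neg h]
      exact dite_smul_eq_zero (blackCoeff_eq_zero 𝕜 fun v he hf =>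
        h (e.2.2.symm.trans (he.trans (hf.symm.trans f.2.2)))) _

theorem closeUp_doubleBracket (p : Quiver.Path (Γ.source a) (Γ.sink b))
    (q : Quiver.Path (Γ.source a') (Γ.sink b')) :
    closeUp Γ.marked P Q
      ((Γ.doubleBracket 𝕜).br (pathElt 𝕜 (torusPath p)) (pathElt 𝕜 (torusPath q))) =
    (splitSum q fun c _ q₁ f q₂ => splitSum p fun c' _ p₁ e p₂ =>
      if h : c' = c then Γ.whiteCoeff 𝕜 e.1 f.1 • exchangeClass 𝕜 P Q
        (((q₁.cast rfl h.symm).cons e).comp p₂) (((p₁.cast rfl h).cons f).comp q₂) else 0) +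
    splitSum q fun _ d q₁ f q₂ => splitSum p fun _ d' p₁ e p₂ =>
      if h : d' = d then Γ.blackCoeff 𝕜 e.1 f.1 • exchangeClass 𝕜 P Q
        (((q₁.cons f).cast rfl h.symm).comp p₂) (((p₁.cons e).cast rfl h).comp q₂) else 0 := by
  simp only [← splitSum_add, ← insertTensor_edgeBracket_gluing]
  rw [doubleBracket_pathElt]
  refine (congrArg (closeUp Γ.marked P Q)
    (pathBracket_mapPath Γ.gluing (Γ.edgeBracket 𝕜) p q)).trans ?_
  refine (map_splitSum (closeUp Γ.marked P Q) q _).trans ?_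
  exact splitSum_congr q fun _ _ _ _ _ _ => map_splitSum (closeUp Γ.marked P Q) p _

variable (κ : Γ.Cut) (A B : ℤ)

theorem sum_white_exchange :
    ∑ q : Quiver.Path (Γ.source a') (Γ.sink b'), ∑ p : Quiver.Path (Γ.source a) (Γ.sink b),
      (if κ.pathIndex p = A ∧ κ.pathIndex q = B then
        splitSum q fun c _ q₁ f q₂ => splitSum p fun c' _ p₁ e p₂ =>
          if h : c' = c then Γ.whiteCoeff 𝕜 e.1 f.1 • exchangeClass 𝕜 P Q
            (((q₁.cast rfl h.symm).cons e).comp p₂) (((p₁.cast rfl h).cons f).comp q₂) else 0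
      else 0) =
    ∑ r' : Quiver.Path (Γ.source a) (Γ.sink b'), ∑ r : Quiver.Path (Γ.source a') (Γ.sink b),
      if κ.pathIndex r + κ.pathIndex r' = A + B then
        (splitSum r' fun _ _ p₁ f _ => splitSum r fun _ _ q₁ e _ =>
          if κ.pathIndex q₁ = κ.pathIndex p₁ - (A - κ.pathIndex r) then
            Γ.whiteCoeff 𝕜 e.1 f.1 else 0) • exchangeClass 𝕜 P Q r r' else 0 := by
  have hexchange := sum_sum_splitSum_exchange_src (a := Γ.source a) (b := Γ.sink b)
    (a' := Γ.source a') (b' := Γ.sink b') fun p q r r' e f =>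
      if κ.pathIndex p = A ∧ κ.pathIndex q = B then
        Γ.whiteCoeff 𝕜 e f • exchangeClass 𝕜 P Q r r' else 0
  refine (Eq.trans ?_ hexchange).trans ?_
  · simp only [← splitSum_ite]
    refine Finset.sum_congr rfl fun q _ => Finset.sum_congr rfl fun p _ =>
      splitSum_congr _ fun _ _ _ _ _ _ => splitSum_congr _ fun _ _ _ _ _ _ => ?_
    split_ifs <;> rfl
  · simp only [← splitSum_ite, ← splitSum_smul]
    refine Finset.sum_congr rfl fun r' _ => Finset.sum_congr rfl fun r _ =>
      splitSum_congr _ fun c d p₁ f q₂ hr' => splitSum_congr _ fun c' d' q₁ e p₂ hr => ?_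
    by_cases h : c' = c
    · subst h hr hr'
      simp only [dif_pos, Quiver.Path.cast_rfl_rfl, ite_smul, zero_smul, ← ite_and]
      refine if_congr ?_ rfl rfl
      simp only [Cut.pathIndex_comp, Cut.pathIndex]
      lia
    · rw [dif_neg h, whiteCoeff_eq_zero 𝕜 fun v he hf =>
        h (e.2.1.symm.trans (he.trans (hf.symm.trans f.2.1)))]
      simp

theorem sum_black_exchange :
    ∑ q : Quiver.Path (Γ.source a') (Γ.sink b'), ∑ p : Quiver.Path (Γ.source a) (Γ.sink b),
      (if κ.pathIndex p = A ∧ κ.pathIndex q = B then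
        splitSum q fun _ d q₁ f q₂ => splitSum p fun _ d' p₁ e p₂ =>
          if h : d' = d then Γ.blackCoeff 𝕜 e.1 f.1 • exchangeClass 𝕜 P Q
            (((q₁.cons f).cast rfl h.symm).comp p₂) (((p₁.cons e).cast rfl h).comp q₂) else 0
      else 0) =
    ∑ r' : Quiver.Path (Γ.source a) (Γ.sink b'), ∑ r : Quiver.Path (Γ.source a') (Γ.sink b),
      if κ.pathIndex r + κ.pathIndex r' = A + B then
        (splitSum r' fun _ _ p₁ e _ => splitSum r fun _ _ q₁ f _ =>
          if κ.pathIndex q₁ + κ.index f.1 =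
              κ.pathIndex p₁ + κ.index e.1 - (A - κ.pathIndex r) then
            Γ.blackCoeff 𝕜 e.1 f.1 else 0) • exchangeClass 𝕜 P Q r r' else 0 := by
  have hexchange := sum_sum_splitSum_exchange_tgt (a := Γ.source a) (b := Γ.sink b)
    (a' := Γ.source a') (b' := Γ.sink b') fun p q r r' e f =>
      if κ.pathIndex p = A ∧ κ.pathIndex q = B then
        Γ.blackCoeff 𝕜 e f • exchangeClass 𝕜 P Q r r' else 0
  refine (Eq.trans ?_ hexchange).trans ?_
  · simp only [← splitSum_ite]
    refine Finset.sum_congr rfl fun q _ => Finset.sum_congr rfl fun p _ =>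
      splitSum_congr _ fun _ _ _ _ _ _ => splitSum_congr _ fun _ _ _ _ _ _ => ?_
    split_ifs <;> rfl
  · simp only [← splitSum_ite, ← splitSum_smul]
    refine Finset.sum_congr rfl fun r' _ => Finset.sum_congr rfl fun r _ =>
      splitSum_congr _ fun c d p₁ e q₂ hr' => splitSum_congr _ fun c' d' q₁ f p₂ hr => ?_
    by_cases h : d' = d
    · subst h hr hr'
      simp only [dif_pos, Quiver.Path.cast_rfl_rfl, ite_smul, zero_smul, ← ite_and]
      refine if_congr ?_ rfl rfl
      simp only [Cut.pathIndex_comp, Cut.pathIndex]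
      lia
    · rw [dif_neg h, blackCoeff_eq_zero 𝕜 fun v he hf =>
        h (f.2.2.symm.trans (hf.trans (he.symm.trans e.2.2)))]
      simp

/-- The exchange of tails turns the brackets at all common vertices of two paths into a single
intersection number of the new paths. -/
theorem sum_closeUp_doubleBracket :
    ∑ q : Quiver.Path (Γ.source a') (Γ.sink b'), ∑ p : Quiver.Path (Γ.source a) (Γ.sink b),
      (if κ.pathIndex p = A ∧ κ.pathIndex q = B then closeUp Γ.marked P Q
        ((Γ.doubleBracket 𝕜).br (pathElt 𝕜 (torusPath p)) (pathElt 𝕜 (torusPath q))) else 0) =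
    ∑ r' : Quiver.Path (Γ.source a) (Γ.sink b'), ∑ r : Quiver.Path (Γ.source a') (Γ.sink b),
      if κ.pathIndex r + κ.pathIndex r' = A + B then
        κ.crossing 𝕜 r r' (A - κ.pathIndex r) • exchangeClass 𝕜 P Q r r' else 0 := by
  simp_rw [closeUp_doubleBracket, ite_add_zero, Finset.sum_add_distrib]
  rw [sum_white_exchange, sum_black_exchange]
  simp_rw [← Finset.sum_add_distrib, ← ite_add_zero, ← add_smul, ← splitSum_add,
    Cut.crossing_eq_splitSum]

end BoundaryBracket

end PerfectCylindricalNetwork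

/-! ### Words of boundary paths -/

namespace PerfectCylindricalNetwork

noncomputable section Words

variable {N : ℕ} [NeZero N] {Γ : PerfectCylindricalNetwork N N}

variable (Γ) in
/-- Paths between marked points on the torus, together with an integer which plays the role of the
exponent of `λ`. -/
abbrev IndexedPath (a b : Fin N) : Type := Quiver.Path (Γ.marked a) (Γ.marked b) × ℤ

namespace IndexedPath

/-- The trivial path with index zero. -/
def nil {a : Fin N} : Γ.IndexedPath a a := (Quiver.Path.nil, 0)

/-- Concatenation of paths, which adds the indices. -/
def comp {a b c : Fin N} (x : Γ.IndexedPath a b) (y : Γ.IndexedPath b c) : Γ.IndexedPath a c :=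
  (x.1.comp y.1, x.2 + y.2)

theorem comp_nil {a b : Fin N} (x : Γ.IndexedPath a b) : x.comp nil = x :=
  Prod.ext rfl (add_zero _)

theorem nil_comp {a b : Fin N} (x : Γ.IndexedPath a b) : nil.comp x = x :=
  Prod.ext (Quiver.Path.nil_comp _) (zero_add _)

theorem comp_assoc {a b c d : Fin N} (x : Γ.IndexedPath a b) (y : Γ.IndexedPath b c)
    (z : Γ.IndexedPath c d) : (x.comp y).comp z = x.comp (y.comp z) :=
  Prod.ext (Quiver.Path.comp_assoc ..) (add_assoc ..)

end IndexedPath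

/-- A path on the cylinder as a path on the torus, indexed by its intersection with the cut. -/
def Cut.indexed (κ : Γ.Cut) {a b : Fin N} (p : Quiver.Path (Γ.source a) (Γ.sink b)) :
    Γ.IndexedPath a b :=
  (torusPath p, κ.pathIndex p)

variable (Γ) in
/-- Sequences of `k` boundary paths, each of which starts at the source glued to the sink at which
the previous one ends. They index the terms of an entry of the `k`-th power of the boundary
measurement matrix. -/
def Word : ℕ → Fin N → Fin N → Type
  | 0, a, b => PLift (a = b)
  | k + 1, a, b => Σ c, Word k a c × Quiver.Path (Γ.source c) (Γ.sink b)

instance instFintypeWord : ∀ (k : ℕ) (a b : Fin N), Fintype (Γ.Word k a b)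
  | 0, a, b => inferInstanceAs (Fintype (PLift (a = b)))
  | k + 1, a, b =>
    have := instFintypeWord k
    inferInstanceAs (Fintype (Σ c, Γ.Word k a c × Quiver.Path (Γ.source c) (Γ.sink b)))

/-- The concatenation of the paths in a word. -/
def Word.eval (κ : Γ.Cut) {a : Fin N} : ∀ {k : ℕ} {b : Fin N}, Γ.Word k a b → Γ.IndexedPath a b
  | 0, _, w => w.down ▸ IndexedPath.nil
  | _ + 1, _, w => (Word.eval κ w.2.1).comp (κ.indexed w.2.2)

variable (κ : Γ.Cut) {M : Type*} [AddCommMonoid M]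

theorem sum_word_zero {a b : Fin N} (F : Γ.IndexedPath a b → M) :
    ∑ w : Γ.Word 0 a b, F (w.eval κ) = if h : a = b then F (h ▸ IndexedPath.nil) else 0 := by
  split_ifs with h
  · exact Fintype.sum_eq_single (α := PLift (a = b)) (f := fun w => F (Word.eval κ (k := 0) w))
      ⟨h⟩ fun x hx => absurd (Subsingleton.elim _ _) hx
  · exact Finset.sum_eq_zero fun x => absurd (PLift.down x) h

theorem sum_sum_word_zero_left {b : Fin N} (F : ∀ a, Γ.IndexedPath a b → M) :
    ∑ a, ∑ w : Γ.Word 0 a b, F a (w.eval κ) = F b .nil := by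
  simp only [fun a => sum_word_zero κ (F a)]
  rw [Fintype.sum_eq_single b fun a ha => dif_neg ha, dif_pos rfl]

theorem sum_sum_word_zero_right {a : Fin N} (F : ∀ b, Γ.IndexedPath a b → M) :
    ∑ b, ∑ w : Γ.Word 0 a b, F b (w.eval κ) = F a .nil := by
  simp only [fun b => sum_word_zero κ (F b)]
  rw [Fintype.sum_eq_single a fun b hb => dif_neg hb.symm, dif_pos rfl]

theorem sum_word_succ {k : ℕ} {a b : Fin N} (F : Γ.IndexedPath a b → M) :
    ∑ w : Γ.Word (k + 1) a b, F (w.eval κ) = ∑ c, ∑ x : Γ.Word k a c,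
      ∑ p : Quiver.Path (Γ.source c) (Γ.sink b), F ((x.eval κ).comp (κ.indexed p)) := by
  refine (Fintype.sum_sigma
    (fun w : Σ c, Γ.Word k a c × Quiver.Path (Γ.source c) (Γ.sink b) =>
      F ((w.2.1.eval κ).comp (κ.indexed w.2.2)))).trans ?_
  exact Finset.sum_congr rfl fun c _ => Fintype.sum_prod_type _

theorem sum_word_one {a b : Fin N} (F : Γ.IndexedPath a b → M) :
    ∑ w : Γ.Word 1 a b, F (w.eval κ) =
      ∑ p : Quiver.Path (Γ.source a) (Γ.sink b), F (κ.indexed p) := by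
  rw [sum_word_succ, sum_sum_word_zero_right κ fun c x => ∑ p, F (x.comp (κ.indexed p))]
  simp only [IndexedPath.nil_comp]

theorem sum_word_add {s t : ℕ} {a b : Fin N} (F : Γ.IndexedPath a b → M) :
    ∑ w : Γ.Word (s + t) a b, F (w.eval κ) =
      ∑ c, ∑ x : Γ.Word s a c, ∑ y : Γ.Word t c b, F ((x.eval κ).comp (y.eval κ)) := by
  induction t generalizing b with
  | zero =>
    simp only [Finset.sum_comm (s := (Finset.univ : Finset (Γ.Word s a _)))]
    rw [sum_sum_word_zero_left κ fun c y => ∑ x : Γ.Word s a c, F ((x.eval κ).comp y)]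
    simp only [IndexedPath.comp_nil]
    rfl
  | succ t ih =>
    rw [← add_assoc, sum_word_succ]
    simp only [fun c x => sum_word_succ κ (k := t) (a := c) (b := b)
      fun y => F (IndexedPath.comp x y)]
    calc _ = ∑ c, ∑ p : Quiver.Path (Γ.source c) (Γ.sink b), ∑ d, ∑ x : Γ.Word s a d,
          ∑ y : Γ.Word t d c, F (((x.eval κ).comp (y.eval κ)).comp (κ.indexed p)) := by
          refine Finset.sum_congr rfl fun c _ => ?_
          rw [Finset.sum_comm]
          exact Finset.sum_congr rfl fun p _ => ih fun w => F (w.comp (κ.indexed p))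
      _ = ∑ c, ∑ d, ∑ x : Γ.Word s a d, ∑ y : Γ.Word t d c,
          ∑ p : Quiver.Path (Γ.source c) (Γ.sink b),
            F ((x.eval κ).comp ((y.eval κ).comp (κ.indexed p))) := by
          simp only [IndexedPath.comp_assoc, Finset.sum_comm (t := (Finset.univ :
            Finset (Quiver.Path (Γ.source _) (Γ.sink b))))]
      _ = _ := by
          rw [Finset.sum_comm]
          exact Finset.sum_congr rfl fun d _ => Finset.sum_comm

theorem sum_word_succ_left {m : ℕ} {a b : Fin N} (F : Γ.IndexedPath a b → M) :
    ∑ w : Γ.Word (m + 1) a b, F (w.eval κ) = ∑ c, ∑ p : Quiver.Path (Γ.source a) (Γ.sink c),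
      ∑ y : Γ.Word m c b, F ((κ.indexed p).comp (y.eval κ)) := by
  rw [add_comm, sum_word_add]
  exact Finset.sum_congr rfl fun c _ =>
    sum_word_one κ fun x => ∑ y : Γ.Word m c b, F (x.comp (y.eval κ))

end Words

end PerfectCylindricalNetwork

/-! ### Pairs of words which compose to a loop -/

namespace PerfectCylindricalNetwork

noncomputable section PairSum

variable {N : ℕ} [NeZero N] {Γ : PerfectCylindricalNetwork N N} (κ : Γ.Cut)

section AddCommMonoid

variable {M : Type*} [AddCommMonoid M]

/-- The sum of `C` over all pairs of words of lengths `i` and `m` which compose to a loop. For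
`m = 0` it computes the trace of a power of the boundary measurement matrix; positive `m` occur when
the Leibniz rule moves letters from the first word to the second. -/
def Cut.pairSum (i m : ℕ) (C : ∀ a b, Γ.IndexedPath a b → Γ.IndexedPath b a → M) : M :=
  ∑ a, ∑ b, ∑ w : Γ.Word i a b, ∑ y : Γ.Word m b a, C a b (w.eval κ) (y.eval κ)

theorem Cut.pairSum_add (i m : ℕ) (C C' : ∀ a b, Γ.IndexedPath a b → Γ.IndexedPath b a → M) :
    κ.pairSum i m (fun a b w y => C a b w y + C' a b w y) =
      κ.pairSum i m C + κ.pairSum i m C' := by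
  simp only [Cut.pairSum, Finset.sum_add_distrib]

theorem Cut.pairSum_comm (i m k n : ℕ)
    (C : ∀ a b, Γ.IndexedPath a b → Γ.IndexedPath b a →
      ∀ c d, Γ.IndexedPath c d → Γ.IndexedPath d c → M) :
    κ.pairSum i m (fun a b w y => κ.pairSum k n (C a b w y)) =
      κ.pairSum k n fun c d z x => κ.pairSum i m fun a b w y => C a b w y c d z x := by
  have bundle (s t : ℕ) (D : ∀ a b, Γ.IndexedPath a b → Γ.IndexedPath b a → M) :
      κ.pairSum s t D = ∑ u : Σ a b, Γ.Word s a b × Γ.Word t b a,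
        D u.1 u.2.1 (u.2.2.1.eval κ) (u.2.2.2.eval κ) := by
    simp only [Cut.pairSum, Fintype.sum_sigma, Fintype.sum_prod_type]
  simp only [bundle]
  exact Finset.sum_comm

theorem Cut.pairSum_zero_right (i : ℕ) (C : ∀ a b, Γ.IndexedPath a b → Γ.IndexedPath b a → M) :
    κ.pairSum i 0 C = ∑ a, ∑ w : Γ.Word i a a, C a a (w.eval κ) .nil := by
  refine Finset.sum_congr rfl fun a _ => ?_
  simp only [fun b (w : Γ.Word i a b) => sum_word_zero κ fun y => C a b (w.eval κ) y]
  rw [Fintype.sum_eq_single a fun b hb => by simp only [dif_neg hb, Finset.sum_const_zero]]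
  exact Finset.sum_congr rfl fun w _ => dif_pos rfl

theorem Cut.pairSum_one (m : ℕ) (C : ∀ a b, Γ.IndexedPath a b → Γ.IndexedPath b a → M) :
    κ.pairSum 1 m C = ∑ a, ∑ b, ∑ p : Quiver.Path (Γ.source a) (Γ.sink b), ∑ y : Γ.Word m b a,
      C a b (κ.indexed p) (y.eval κ) :=
  Finset.sum_congr rfl fun a _ => Finset.sum_congr rfl fun b _ =>
    sum_word_one κ fun w => ∑ y : Γ.Word m b a, C a b w (y.eval κ)

theorem Cut.pairSum_succ_left (i m : ℕ) (C : ∀ a b, Γ.IndexedPath a b → Γ.IndexedPath b a → M) :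
    κ.pairSum (i + 1) m C = ∑ a, ∑ b, ∑ c, ∑ w : Γ.Word i a b,
      ∑ p : Quiver.Path (Γ.source b) (Γ.sink c), ∑ y : Γ.Word m c a,
        C a c ((w.eval κ).comp (κ.indexed p)) (y.eval κ) := by
  refine Finset.sum_congr rfl fun a _ => ?_
  rw [Finset.sum_comm]
  exact Finset.sum_congr rfl fun c _ =>
    sum_word_succ κ fun w => ∑ y : Γ.Word m c a, C a c w (y.eval κ)

theorem Cut.pairSum_succ_right (i m : ℕ) (C : ∀ a b, Γ.IndexedPath a b → Γ.IndexedPath b a → M) :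
    κ.pairSum i (m + 1) C = ∑ a, ∑ b, ∑ c, ∑ w : Γ.Word i a b,
      ∑ p : Quiver.Path (Γ.source b) (Γ.sink c), ∑ y : Γ.Word m c a,
        C a b (w.eval κ) ((κ.indexed p).comp (y.eval κ)) := by
  refine Finset.sum_congr rfl fun a _ => Finset.sum_congr rfl fun b _ => ?_
  refine Eq.trans ?_ Finset.sum_comm
  exact Finset.sum_congr rfl fun w _ => sum_word_succ_left κ fun y => C a b (w.eval κ) y

theorem Cut.pairSum_one_add (i m : ℕ) (C : ∀ a b, Γ.IndexedPath a b → Γ.IndexedPath b a → M) :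
    κ.pairSum 1 (m + i) C = ∑ a, ∑ b, ∑ c, ∑ w : Γ.Word i a b,
      ∑ p : Quiver.Path (Γ.source b) (Γ.sink c), ∑ y : Γ.Word m c a,
        C b c (κ.indexed p) ((y.eval κ).comp (w.eval κ)) := by
  let reorder : (Σ b c, Quiver.Path (Γ.source b) (Γ.sink c) × Σ a, Γ.Word m c a × Γ.Word i a b) ≃
      Σ a b c, Γ.Word i a b × Quiver.Path (Γ.source b) (Γ.sink c) × Γ.Word m c a :=
    ⟨fun ⟨b, c, p, a, y, w⟩ => ⟨a, b, c, w, p, y⟩, fun ⟨a, b, c, w, p, y⟩ => ⟨b, c, p, a, y, w⟩,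
      fun _ => rfl, fun _ => rfl⟩
  rw [Cut.pairSum_one]
  simp only [fun b c (p : Quiver.Path (Γ.source b) (Γ.sink c)) =>
    sum_word_add κ (s := m) (t := i) fun y => C b c (κ.indexed p) y]
  have reindex := Fintype.sum_equiv reorder
    (fun ⟨b, c, p, _, y, w⟩ => C b c (κ.indexed p) ((y.eval κ).comp (w.eval κ)))
    (fun ⟨_, b, c, w, p, y⟩ => C b c (κ.indexed p) ((y.eval κ).comp (w.eval κ))) fun _ => rfl
  simpa only [Fintype.sum_sigma, Fintype.sum_prod_type] using reindex

theorem Cut.pairSum_succ_succ_comp_indexed (m n : ℕ)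
    (C : ∀ a b, Γ.IndexedPath a b → Γ.IndexedPath b a → M) :
    κ.pairSum (m + 1) (n + 1) C =
      ∑ a, ∑ b, ∑ a', ∑ b', ∑ P : Γ.Word m b a, ∑ Q : Γ.Word n b' a',
        ∑ r' : Quiver.Path (Γ.source a) (Γ.sink b'), ∑ r : Quiver.Path (Γ.source a') (Γ.sink b),
          C b b' ((P.eval κ).comp (κ.indexed r')) ((Q.eval κ).comp (κ.indexed r)) := by
  let reorder : (Σ b a b', Γ.Word m b a × Quiver.Path (Γ.source a) (Γ.sink b') ×
      Σ a', Γ.Word n b' a' × Quiver.Path (Γ.source a') (Γ.sink b)) ≃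
      Σ a b a' b', Γ.Word m b a × Γ.Word n b' a' × Quiver.Path (Γ.source a) (Γ.sink b') ×
        Quiver.Path (Γ.source a') (Γ.sink b) :=
    ⟨fun ⟨b, a, b', P, r', a', Q, r⟩ => ⟨a, b, a', b', P, Q, r', r⟩,
      fun ⟨a, b, a', b', P, Q, r', r⟩ => ⟨b, a, b', P, r', a', Q, r⟩, fun _ => rfl, fun _ => rfl⟩
  rw [Cut.pairSum_succ_left]
  simp only [fun b b' u => sum_word_succ κ (k := n) fun y => C b b' u y]
  have reindex := Fintype.sum_equiv reorder
    (fun ⟨b, _, b', P, r', _, Q, r⟩ =>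
      C b b' ((P.eval κ).comp (κ.indexed r')) ((Q.eval κ).comp (κ.indexed r)))
    (fun ⟨_, b, _, b', P, Q, r', r⟩ =>
      C b b' ((P.eval κ).comp (κ.indexed r')) ((Q.eval κ).comp (κ.indexed r))) fun _ => rfl
  simpa only [Fintype.sum_sigma, Fintype.sum_prod_type] using reindex

theorem Cut.pairSum_succ_succ_indexed_comp (m n : ℕ)
    (C : ∀ a b, Γ.IndexedPath a b → Γ.IndexedPath b a → M) :
    κ.pairSum (m + 1) (n + 1) C =
      ∑ a, ∑ b, ∑ a', ∑ b', ∑ P : Γ.Word m b a, ∑ Q : Γ.Word n b' a',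
        ∑ r' : Quiver.Path (Γ.source a) (Γ.sink b'), ∑ r : Quiver.Path (Γ.source a') (Γ.sink b),
          C a' a ((κ.indexed r).comp (P.eval κ)) ((κ.indexed r').comp (Q.eval κ)) := by
  let reorder : (Σ a' a b', (Σ b, Quiver.Path (Γ.source a') (Γ.sink b) × Γ.Word m b a) ×
      Quiver.Path (Γ.source a) (Γ.sink b') × Γ.Word n b' a') ≃
      Σ a b a' b', Γ.Word m b a × Γ.Word n b' a' × Quiver.Path (Γ.source a) (Γ.sink b') ×
        Quiver.Path (Γ.source a') (Γ.sink b) :=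
    ⟨fun ⟨a', a, b', ⟨b, r, P⟩, r', Q⟩ => ⟨a, b, a', b', P, Q, r', r⟩,
      fun ⟨a, b, a', b', P, Q, r', r⟩ => ⟨a', a, b', ⟨b, r, P⟩, r', Q⟩,
      fun _ => rfl, fun _ => rfl⟩
  rw [Cut.pairSum_succ_right]
  simp only [fun a' a b' => sum_word_succ_left κ (m := m) (a := a') (b := a)
    fun (u : Γ.IndexedPath a' a) => ∑ r' : Quiver.Path (Γ.source a) (Γ.sink b'),
      ∑ Q : Γ.Word n b' a', C a' a u ((κ.indexed r').comp (Word.eval κ Q))]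
  have reindex := Fintype.sum_equiv reorder
    (fun ⟨a', a, _, ⟨_, r, P⟩, r', Q⟩ =>
      C a' a ((κ.indexed r).comp (P.eval κ)) ((κ.indexed r').comp (Q.eval κ)))
    (fun ⟨a, _, a', _, P, Q, r', r⟩ =>
      C a' a ((κ.indexed r).comp (P.eval κ)) ((κ.indexed r').comp (Q.eval κ))) fun _ => rfl
  simpa only [Fintype.sum_sigma, Fintype.sum_prod_type] using reindex

theorem Cut.pairSum_one_pairSum_one (m n : ℕ)
    (C : ∀ a b, Γ.IndexedPath a b → Γ.IndexedPath b a →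
      ∀ c d, Γ.IndexedPath c d → Γ.IndexedPath d c → M) :
    κ.pairSum 1 m (fun a b w y => κ.pairSum 1 n (C a b w y)) =
      ∑ a, ∑ b, ∑ a', ∑ b', ∑ P : Γ.Word m b a, ∑ Q : Γ.Word n b' a',
        ∑ q : Quiver.Path (Γ.source a') (Γ.sink b'), ∑ p : Quiver.Path (Γ.source a) (Γ.sink b),
          C a b (κ.indexed p) (P.eval κ) a' b' (κ.indexed q) (Q.eval κ) := by
  let reorder : (Σ a b, Quiver.Path (Γ.source a) (Γ.sink b) × Γ.Word m b a × Σ a' b',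
      Quiver.Path (Γ.source a') (Γ.sink b') × Γ.Word n b' a') ≃
      Σ a b a' b', Γ.Word m b a × Γ.Word n b' a' × Quiver.Path (Γ.source a') (Γ.sink b') ×
        Quiver.Path (Γ.source a) (Γ.sink b) :=
    ⟨fun ⟨a, b, p, P, a', b', q, Q⟩ => ⟨a, b, a', b', P, Q, q, p⟩,
      fun ⟨a, b, a', b', P, Q, q, p⟩ => ⟨a, b, p, P, a', b', q, Q⟩, fun _ => rfl, fun _ => rfl⟩
  simp only [Cut.pairSum_one]
  have reindex := Fintype.sum_equiv reorder
    (fun ⟨a, b, p, P, a', b', q, Q⟩ =>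
      C a b (κ.indexed p) (P.eval κ) a' b' (κ.indexed q) (Q.eval κ))
    (fun ⟨a, b, a', b', P, Q, q, p⟩ =>
      C a b (κ.indexed p) (P.eval κ) a' b' (κ.indexed q) (Q.eval κ))
    fun _ => rfl
  simpa only [Fintype.sum_sigma, Fintype.sum_prod_type] using reindex

end AddCommMonoid

section AddCommGroup

variable {M : Type*} [AddCommGroup M] {C : ∀ a b, Γ.IndexedPath a b → Γ.IndexedPath b a → M}

/-- In a cyclic word the Leibniz rule splits off the last letter of the first word: the bracket hits
either this letter or the remaining ones, and the letters which are not hit join the second word. -/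
theorem Cut.pairSum_succ
    (hC : ∀ a b c (w : Γ.IndexedPath a b) (p : Γ.IndexedPath b c) (y : Γ.IndexedPath c a),
      C a c (w.comp p) y = C b c p (y.comp w) + C a b w (p.comp y)) (i m : ℕ) :
    κ.pairSum (i + 1) m C = κ.pairSum 1 (m + i) C + κ.pairSum i (m + 1) C := by
  rw [pairSum_succ_left, pairSum_one_add, pairSum_succ_right]
  simp only [hC, Finset.sum_add_distrib]

theorem Cut.pairSum_zero_left
    (hC : ∀ a b c (w : Γ.IndexedPath a b) (p : Γ.IndexedPath b c) (y : Γ.IndexedPath c a),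
      C a c (w.comp p) y = C b c p (y.comp w) + C a b w (p.comp y)) (m : ℕ) :
    κ.pairSum 0 m C = 0 := by
  have eq_zero a (y : Γ.IndexedPath a a) : C a a .nil y = 0 := by
    simpa only [IndexedPath.comp_nil, IndexedPath.nil_comp, left_eq_add] using hC a a a .nil .nil y
  refine Finset.sum_eq_zero fun a _ => ?_
  rw [sum_sum_word_zero_right κ fun b w => ∑ y : Γ.Word m b a, C a b w (y.eval κ)]
  exact Finset.sum_eq_zero fun y _ => eq_zero a _

theorem Cut.pairSum_eq_zero
    (hC : ∀ a b c (w : Γ.IndexedPath a b) (p : Γ.IndexedPath b c) (y : Γ.IndexedPath c a),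
      C a c (w.comp p) y = C b c p (y.comp w) + C a b w (p.comp y))
    (h : ∀ m, κ.pairSum 1 m C = 0) (i m : ℕ) : κ.pairSum i m C = 0 := by
  induction i generalizing m with
  | zero => exact κ.pairSum_zero_left hC m
  | succ i ih => rw [κ.pairSum_succ hC, h, ih, add_zero]

end AddCommGroup

end PairSum

end PerfectCylindricalNetwork

/-! ### Brackets of the Hamiltonians -/

namespace PerfectCylindricalNetwork

noncomputable section Hamiltonians

variable {N : ℕ} [NeZero N] {Γ : PerfectCylindricalNetwork N N} (𝕜 : Type*) [Field 𝕜] (κ : Γ.Cut)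

/-- The bracket of `w` and `z`, closed up by `y` and `x`, if the loops `wy` and `zx` have indices
`j` and `l`. -/
def bracketTerm (j l : ℤ) {a b c d : Fin N} (w : Γ.IndexedPath a b) (y : Γ.IndexedPath b a)
    (z : Γ.IndexedPath c d) (x : Γ.IndexedPath d c) : CyclicSpace 𝕜 Γ.marked :=
  if w.2 + y.2 = j ∧ z.2 + x.2 = l then
    closeUp Γ.marked y.1 x.1 ((Γ.doubleBracket 𝕜).br (pathElt 𝕜 w.1) (pathElt 𝕜 z.1)) else 0

theorem bracketTerm_comp_left (j l : ℤ) {a b b' c d : Fin N} (w : Γ.IndexedPath a b)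
    (p : Γ.IndexedPath b b') (y : Γ.IndexedPath b' a) (z : Γ.IndexedPath c d)
    (x : Γ.IndexedPath d c) : bracketTerm 𝕜 j l (w.comp p) y z x =
      bracketTerm 𝕜 j l p (y.comp w) z x + bracketTerm 𝕜 j l w (p.comp y) z x := by
  have index_rotate : (w.comp p).2 + y.2 = p.2 + (y.comp w).2 := by
    simp only [IndexedPath.comp]
    ring
  have index_assoc : w.2 + (p.comp y).2 = p.2 + (y.comp w).2 := by
    simp only [IndexedPath.comp]
    ring
  rw [bracketTerm, bracketTerm, bracketTerm, index_rotate, index_assoc]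
  split_ifs
  · simp only [IndexedPath.comp, pathElt_comp, Biderivation.leibniz_left, map_add,
      closeUp_lmul₂, closeUp_rmul₁]
  · exact (add_zero 0).symm

theorem bracketTerm_comp_right (j l : ℤ) {a b c d d' : Fin N} (w : Γ.IndexedPath a b)
    (y : Γ.IndexedPath b a) (z : Γ.IndexedPath c d) (p : Γ.IndexedPath d d')
    (x : Γ.IndexedPath d' c) : bracketTerm 𝕜 j l w y (z.comp p) x =
      bracketTerm 𝕜 j l w y p (x.comp z) + bracketTerm 𝕜 j l w y z (p.comp x) := by
  have index_rotate : (z.comp p).2 + x.2 = p.2 + (x.comp z).2 := by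
    simp only [IndexedPath.comp]
    ring
  have index_assoc : z.2 + (p.comp x).2 = p.2 + (x.comp z).2 := by
    simp only [IndexedPath.comp]
    ring
  rw [bracketTerm, bracketTerm, bracketTerm, index_rotate, index_assoc]
  split_ifs
  · simp only [IndexedPath.comp, pathElt_comp, Biderivation.leibniz_right, map_add,
      closeUp_lmul₁, closeUp_rmul₂]
  · exact (add_zero 0).symm

/-- The class of the loop `uv`, if it has index `j + l`, weighted by the relative position of its
marked points `a` and `c` after lifting `c` along `u` and shifting it back by `j` sheets. -/
def signTerm (j l : ℤ) (a c : Fin N) (u : Γ.IndexedPath a c) (v : Γ.IndexedPath c a) :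
    CyclicSpace 𝕜 Γ.marked :=
  if u.2 + v.2 = j + l then
    ((SignType.sign (Cut.relPos a c - (j - u.2 : ℤ)) : 𝕜) / 2) •
      loopClass Γ.marked 𝕜 (u.1.comp v.1) else 0

section Exchange

variable {a b a' b' : Fin N} (P : Γ.IndexedPath b a) (Q : Γ.IndexedPath b' a')
  (r : Quiver.Path (Γ.source a') (Γ.sink b)) (r' : Quiver.Path (Γ.source a) (Γ.sink b'))

theorem exchangeClass_rotate (P : Quiver.Path (Γ.marked b) (Γ.marked a))
    (Q : Quiver.Path (Γ.marked b') (Γ.marked a')) : exchangeClass 𝕜 P Q r r' =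
      loopClass Γ.marked 𝕜 ((P.comp (torusPath r')).comp (Q.comp (torusPath r))) := by
  rw [exchangeClass, Quiver.Path.comp_assoc, loopClass_comm]
  simp only [Quiver.Path.comp_assoc]

/-- The crossing number is a difference of two terms, one for each end, and either of them only
depends on the loop cut open at the two marked points at this end. -/
theorem crossing_smul_exchangeClass (j l : ℤ) :
    (if κ.pathIndex r + κ.pathIndex r' = j - P.2 + (l - Q.2) then
      κ.crossing 𝕜 r r' (j - P.2 - κ.pathIndex r) • exchangeClass 𝕜 P.1 Q.1 r r' else 0) =
    signTerm 𝕜 j l b b' (P.comp (κ.indexed r')) (Q.comp (κ.indexed r)) -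
      signTerm 𝕜 j l a' a ((κ.indexed r).comp P) ((κ.indexed r').comp Q) := by
  have tgt_term : signTerm 𝕜 j l b b' (P.comp (κ.indexed r')) (Q.comp (κ.indexed r)) =
      if P.2 + κ.pathIndex r' + (Q.2 + κ.pathIndex r) = j + l then
        ((SignType.sign (Cut.relPos b b' - (j - (P.2 + κ.pathIndex r') : ℤ)) : 𝕜) / 2) •
          exchangeClass 𝕜 P.1 Q.1 r r' else 0 := by
    rw [exchangeClass_rotate]
    rfl
  have src_term : signTerm 𝕜 j l a' a ((κ.indexed r).comp P) ((κ.indexed r').comp Q) =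
      if κ.pathIndex r + P.2 + (κ.pathIndex r' + Q.2) = j + l then
        ((SignType.sign (Cut.relPos a' a - (j - (κ.pathIndex r + P.2) : ℤ)) : 𝕜) / 2) •
          exchangeClass 𝕜 P.1 Q.1 r r' else 0 := rfl
  have tgt_sheet : j - P.2 - κ.pathIndex r + κ.pathIndex r - κ.pathIndex r' =
      j - (P.2 + κ.pathIndex r') := by ring
  have src_sheet : j - P.2 - κ.pathIndex r = j - (κ.pathIndex r + P.2) := by ring
  rw [tgt_term, src_term, Cut.crossing_eq, tgt_sheet, src_sheet]
  by_cases h : κ.pathIndex r + κ.pathIndex r' = j - P.2 + (l - Q.2)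
  · rw [if_pos h, if_pos (by omega), if_pos (by omega), sub_div, sub_smul]
  · rw [if_neg h, if_neg (by omega), if_neg (by omega), sub_zero]

theorem sum_bracketTerm_indexed (j l : ℤ) :
    ∑ q : Quiver.Path (Γ.source a') (Γ.sink b'), ∑ p : Quiver.Path (Γ.source a) (Γ.sink b),
      bracketTerm 𝕜 j l (κ.indexed p) P (κ.indexed q) Q =
    ∑ r' : Quiver.Path (Γ.source a) (Γ.sink b'), ∑ r : Quiver.Path (Γ.source a') (Γ.sink b),
      (signTerm 𝕜 j l b b' (P.comp (κ.indexed r')) (Q.comp (κ.indexed r)) -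
        signTerm 𝕜 j l a' a ((κ.indexed r).comp P) ((κ.indexed r').comp Q)) := by
  simp only [← crossing_smul_exchangeClass]
  rw [← sum_closeUp_doubleBracket]
  refine Finset.sum_congr rfl fun q _ => Finset.sum_congr rfl fun p _ => ?_
  exact if_congr (and_congr eq_sub_iff_add_eq.symm eq_sub_iff_add_eq.symm) rfl rfl

end Exchange

/-- Cyclic words do not distinguish the two ends, so the terms of the two ends cancel. -/
theorem pairSum_one_bracketTerm (j l : ℤ) (m n : ℕ) :
    κ.pairSum 1 m (fun _ _ w y => κ.pairSum 1 n fun _ _ z x => bracketTerm 𝕜 j l w y z x) = 0 := by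
  calc _ = ∑ a, ∑ b, ∑ a', ∑ b', ∑ P : Γ.Word m b a, ∑ Q : Γ.Word n b' a',
        ∑ q : Quiver.Path (Γ.source a') (Γ.sink b'), ∑ p : Quiver.Path (Γ.source a) (Γ.sink b),
          bracketTerm 𝕜 j l (κ.indexed p) (P.eval κ) (κ.indexed q) (Q.eval κ) :=
        κ.pairSum_one_pairSum_one m n fun _ _ w y _ _ z x => bracketTerm 𝕜 j l w y z x
    _ = ∑ a, ∑ b, ∑ a', ∑ b', ∑ P : Γ.Word m b a, ∑ Q : Γ.Word n b' a',
        ∑ r' : Quiver.Path (Γ.source a) (Γ.sink b'), ∑ r : Quiver.Path (Γ.source a') (Γ.sink b),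
          (signTerm 𝕜 j l b b' ((P.eval κ).comp (κ.indexed r')) ((Q.eval κ).comp (κ.indexed r)) -
            signTerm 𝕜 j l a' a ((κ.indexed r).comp (P.eval κ))
              ((κ.indexed r').comp (Q.eval κ))) := by
        simp only [sum_bracketTerm_indexed]
    _ = κ.pairSum (m + 1) (n + 1) (signTerm 𝕜 j l) -
        κ.pairSum (m + 1) (n + 1) (signTerm 𝕜 j l) := by
        simp only [Finset.sum_sub_distrib]
        rw [← κ.pairSum_succ_succ_comp_indexed m n (signTerm 𝕜 j l),
          ← κ.pairSum_succ_succ_indexed_comp m n (signTerm 𝕜 j l)]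
    _ = 0 := sub_self _

theorem pairSum_bracketTerm (j l : ℤ) (i m k n : ℕ) :
    κ.pairSum i m (fun _ _ w y => κ.pairSum k n fun _ _ z x => bracketTerm 𝕜 j l w y z x) = 0 := by
  refine κ.pairSum_eq_zero (fun a b c w p y => ?_) (fun m => ?_) i m
  · simp only [bracketTerm_comp_left, Cut.pairSum_add]
  · rw [Cut.pairSum_comm]
    refine κ.pairSum_eq_zero (fun a b c w p y => ?_) (fun n => ?_) k n
    · simp only [bracketTerm_comp_right, Cut.pairSum_add]
    · rw [Cut.pairSum_comm]
      exact pairSum_one_bracketTerm 𝕜 κ j l m n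

theorem sum_single_boundaryMeasurement {a b c : Fin N} (n : ℤ)
    (x : LinPath 𝕜 (Γ.marked a) (Γ.marked c)) :
    ((Γ.boundaryMeasurement 𝕜 κ c b).sum fun n' y => Finsupp.single (n + n') (concat 𝕜 x y)) =
      ∑ p : Quiver.Path (Γ.source c) (Γ.sink b),
        Finsupp.single (n + κ.pathIndex p) (concat 𝕜 x (pathElt 𝕜 (torusPath p))) := by
  rw [boundaryMeasurement, ← Finsupp.sum_finsetSum_index (fun _ => by simp) fun _ _ _ => by simp]
  exact Finset.sum_congr rfl fun p _ => Finsupp.sum_single_index (by simp)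

theorem boundaryMeasurement_pow (k : ℕ) (a b : Fin N) :
    (Γ.boundaryMeasurement 𝕜 κ).pow k a b =
      ∑ w : Γ.Word k a b, Finsupp.single (w.eval κ).2 (pathElt 𝕜 (w.eval κ).1) := by
  induction k generalizing b with
  | zero =>
    rw [sum_word_zero κ fun x => Finsupp.single x.2 (pathElt 𝕜 x.1)]
    refine dite_congr rfl (fun h => ?_) fun _ => rfl
    subst h
    rfl
  | succ k ih =>
    rw [sum_word_succ κ fun x => Finsupp.single x.2 (pathElt 𝕜 x.1), LaurentMatrix.pow,
      LaurentMatrix.mul]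
    refine Finset.sum_congr rfl fun c _ => ?_
    simp only [ih, sum_single_boundaryMeasurement]
    rw [← Finsupp.sum_finsetSum_index (fun _ => by simp)
      fun _ _ _ => by simp [Finset.sum_add_distrib]]
    refine Finset.sum_congr rfl fun w _ => (Finsupp.sum_single_index (by simp)).trans ?_
    simp only [IndexedPath.comp, Cut.indexed, pathElt_comp]

theorem cyclicClass_hamiltonian (i : ℕ) (j : ℤ) :
    cyclicClass Γ.marked (Γ.hamiltonian 𝕜 κ i j) = ∑ a, ∑ w : Γ.Word i a a,
      if (w.eval κ).2 = j then loopClass Γ.marked 𝕜 (w.eval κ).1 else 0 := by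
  rw [hamiltonian, LaurentMatrix.traceCoeff, map_sum]
  refine Finset.sum_congr rfl fun a _ => ?_
  rw [boundaryMeasurement_pow, Finsupp.finsetSum_apply, map_sum, map_sum]
  refine Finset.sum_congr rfl fun w _ => ?_
  rw [Finsupp.single_apply]
  split_ifs
  · rfl
  · rw [map_zero, map_zero]

theorem cyclicBracket_ite_loopClass (j l : ℤ) {a c : Fin N} (w : Γ.IndexedPath a a)
    (z : Γ.IndexedPath c c) :
    cyclicBracket (Γ.doubleBracket 𝕜) Γ.marked (if w.2 = j then loopClass Γ.marked 𝕜 w.1 else 0)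
      (if z.2 = l then loopClass Γ.marked 𝕜 z.1 else 0) = bracketTerm 𝕜 j l w .nil z .nil := by
  simp only [bracketTerm, IndexedPath.nil, add_zero, closeUp_nil, ite_and]
  split_ifs
  · exact cyclicBracket_mk ..
  · exact map_zero _
  · rw [map_zero, LinearMap.zero_apply]
  · exact map_zero _

theorem cyclicBracket_hamiltonian (i k : ℕ) (j l : ℤ) :
    cyclicBracket (Γ.doubleBracket 𝕜) Γ.marked (cyclicClass Γ.marked (Γ.hamiltonian 𝕜 κ i j))
      (cyclicClass Γ.marked (Γ.hamiltonian 𝕜 κ k l)) =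
    κ.pairSum i 0 fun _ _ w y => κ.pairSum k 0 fun _ _ z x => bracketTerm 𝕜 j l w y z x := by
  simp only [cyclicClass_hamiltonian, LinearMap.map_sum₂]
  simp only [map_sum, cyclicBracket_ite_loopClass, Cut.pairSum_zero_right]

end Hamiltonians

end PerfectCylindricalNetwork

theorem mainTheorem4_general {𝕜 : Type*} [Field 𝕜] [NeZero (2 : 𝕜)] {N : ℕ} [NeZero N]
    (Γ : PerfectCylindricalNetwork N N) (κ : Γ.Cut) (i k : ℕ) (j l : ℤ) :
    cyclicBracket (Γ.doubleBracket 𝕜) Γ.marked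
      (cyclicClass Γ.marked (Γ.hamiltonian 𝕜 κ i j))
      (cyclicClass Γ.marked (Γ.hamiltonian 𝕜 κ k l)) = 0 :=
  (PerfectCylindricalNetwork.cyclicBracket_hamiltonian 𝕜 κ i k j l).trans
    (PerfectCylindricalNetwork.pairSum_bracketTerm 𝕜 κ j l i 0 k 0)

theorem mainTheorem4 {𝕜 : Type*} [Field 𝕜] [CharZero 𝕜] {N : ℕ} [NeZero N]
    (Γ : PerfectCylindricalNetwork N N) (κ : Γ.Cut) (i k : ℕ) (j l : ℤ) :
    cyclicBracket (Γ.doubleBracket 𝕜) Γ.marked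
      (cyclicClass Γ.marked (Γ.hamiltonian 𝕜 κ i j))
      (cyclicClass Γ.marked (Γ.hamiltonian 𝕜 κ k l)) = 0 :=
  mainTheorem4_general Γ κ i k j l
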